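/- All graphs are finite and simple, and $|G|$ is the number of vertices of $G$. A hole of $G$ is an induced subgraph that is a cycle of length at least four; it is odd if its length is odd, and a shortest odd hole is an odd hole of minimum length among all odd holes of $G$. For a shortest odd hole $C$, a vertex $v$ of $G$ is $C$-major if no three-vertex path of $C$ contains all the neighbours of $v$ in $V(C)$. A shortest odd hole $C$ is heavy-cleanable if there is an edge $uv$ of $C$ such that every $C$-major vertex is adjacent to $u$ or to $v$. A pyramid in $G$ consists of a vertex $v_0$ and, for $i=1,2,3$, an induced path $P_i$ of $G$ between $v_0$ and a vertex $v_i \ne v_0$, such that $P_1,P_2,P_3$ are pairwise vertex-disjoint except for $v_0$; at least two of them have length at least two; $v_1,v_2,v_3$ are pairwise adjacent; and for $i\neq j$ the only edge between $V(P_i)\setminus\{v_0\}$ and $V(P_j)\setminus\{v_0\}$ is $v_iv_j$. A jewel in $G$ consists of distinct vertices $v_1,\ldots,v_5$ such that $v_1v_2,v_2v_3,v_3v_4,v_4v_5,v_5v_1$ are edges and $v_1v_3,v_2v_4,v_1v_4$ are non-edges, and a path $P$ of $G$ between $v_1$ and $v_4$, not containing $v_5$, such that none of $v_2,v_3,v_5$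 has a neighbour in the interior of $P$. Theorem. There is an algorithm with the following specifications. Input: a graph $G$ containing no pyramid and no jewel. Output: determines one of the following: (1) $G$ contains an odd hole; (2) there is no heavy-cleanable shortest odd hole in $G$. Running time: $O(|G|^8)$. Here an algorithm is a fixed program for a random access machine with words of $O(\log |G|)$ bits, on which arithmetic, comparison and memory access on words take one step each, and the input is given by its adjacency matrix. The bound means that for some constant $c$ the machine halts after at most $c\,(|G|+1)^8$ steps on every such input. -/

import Mathlib

namespace OddHole

/-! ### Graph notions -/

section Graphs

variable {V : Type*}

/-- `C` is the vertex set of a hole of `G`: the subgraph induced on `C` is a cycle of length at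
least four. The length of the hole is `C.ncard`. -/
def IsHole (G : SimpleGraph V) (C : Set V) : Prop :=
  4 ≤ C.ncard ∧ Nonempty (SimpleGraph.cycleGraph C.ncard ≃g G.induce C)

/-- A hole of odd length. -/
def IsOddHole (G : SimpleGraph V) (C : Set V) : Prop :=
  IsHole G C ∧ Odd C.ncard

/-- `G` contains an odd hole. -/
def HasOddHole (G : SimpleGraph V) : Prop :=
  ∃ C : Set V, IsOddHole G C

/-- An odd hole of minimum length among all odd holes of `G`. -/
def IsShortestOddHole (G : SimpleGraph V) (C : Set V) : Prop :=
  IsOddHole G C ∧ ∀ C' : Set V, IsOddHole G C' → C.ncard ≤ C'.ncard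

/-- The vertex `v` is `C`-major: no three-vertex path `a - b - c` of the hole `C` contains all the
neighbours of `v` in `C`. -/
def IsMajor (G : SimpleGraph V) (C : Set V) (v : V) : Prop :=
  ¬ ∃ a ∈ C, ∃ b ∈ C, ∃ c ∈ C, a ≠ c ∧ G.Adj a b ∧ G.Adj b c ∧
      ∀ u ∈ C, G.Adj v u → u = a ∨ u = b ∨ u = c

/-- `C` is heavy-cleanable: some edge `uv` of `C` is such that every `C`-major vertex is adjacent
to one of `u`, `v`. (Used for shortest odd holes `C`.) -/
def IsHeavyCleanable (G : SimpleGraph V) (C : Set V) : Prop :=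
  ∃ u ∈ C, ∃ v ∈ C, G.Adj u v ∧ ∀ x : V, IsMajor G C x → G.Adj x u ∨ G.Adj x v

/-- A walk that traverses an induced path of `G`. -/
def IsInducedPath {G : SimpleGraph V} {u v : V} (p : G.Walk u v) : Prop :=
  p.IsPath ∧ ∀ x ∈ p.support, ∀ y ∈ p.support, G.Adj x y → s(x, y) ∈ p.edges

/-- `G` contains a pyramid, with apex `v₀`, base `{v 0, v 1, v 2}` and constituent paths `P i`. -/
def HasPyramid (G : SimpleGraph V) : Prop :=
  ∃ (v₀ : V) (v : Fin 3 → V) (P : ∀ i, G.Walk v₀ (v i)),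
    (∀ i, IsInducedPath (P i)) ∧
    (∀ i j, i ≠ j → ∀ x, x ∈ (P i).support → x ∈ (P j).support → x = v₀) ∧
    (∀ i, v i ≠ v₀) ∧
    (∃ i j, i ≠ j ∧ 2 ≤ (P i).length ∧ 2 ≤ (P j).length) ∧
    (∀ i j, i ≠ j → G.Adj (v i) (v j)) ∧
    (∀ i j, i ≠ j → ∀ x ∈ (P i).support, ∀ y ∈ (P j).support, x ≠ v₀ → y ≠ v₀ →
      G.Adj x y → x = v i ∧ y = v j)

/-- `G` contains a jewel, formed by `v₁, …, v₅` and the path `P` between `v₁` and `v₄`. The path is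
disjoint from `v₂, v₃, v₅`; for `v₂` and `v₃` this follows from the other conditions, and for `v₅`
it only says that a hole of length five alone is not a jewel. -/
def HasJewel (G : SimpleGraph V) : Prop :=
  ∃ (v₁ v₂ v₃ v₄ v₅ : V) (P : G.Walk v₁ v₄),
    [v₁, v₂, v₃, v₄, v₅].Nodup ∧
    G.Adj v₁ v₂ ∧ G.Adj v₂ v₃ ∧ G.Adj v₃ v₄ ∧ G.Adj v₄ v₅ ∧ G.Adj v₅ v₁ ∧
    ¬ G.Adj v₁ v₃ ∧ ¬ G.Adj v₂ v₄ ∧ ¬ G.Adj v₁ v₄ ∧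
    P.IsPath ∧ v₅ ∉ P.support ∧
    ∀ x ∈ P.support, x ≠ v₁ → x ≠ v₄ → ¬ G.Adj v₂ x ∧ ¬ G.Adj v₃ x ∧ ¬ G.Adj v₅ x

end Graphs

/-! ### A word random access machine

Programs use finitely many registers and finitely many arrays, both named by natural numbers.
Every machine word holds a natural number smaller than a word bound `W`; an operation whose result
does not fit into a word has no outcome. Each operation on words, each memory access and each test
takes one step. -/

/-- The memory: `reg x` is the content of register `x`, `arr a i` is entry `i` of array `a`. -/
structure Memory where
  reg : ℕ → ℕ
  arr : ℕ → ℕ → ℕ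

/-- Write `v` into register `x`. -/
def Memory.setReg (m : Memory) (x v : ℕ) : Memory :=
  { m with reg := Function.update m.reg x v }

/-- Write `v` into entry `i` of array `a`. -/
def Memory.setArr (m : Memory) (a i v : ℕ) : Memory :=
  { m with arr := Function.update m.arr a (Function.update (m.arr a) i v) }

/-- The binary word operations. -/
inductive Op where
  | add
  | sub
  | mul
  | lt
  | eq

/-- Subtraction is truncated at zero; comparisons return `1` for true and `0` for false. -/
def Op.apply : Op → ℕ → ℕ → ℕ
  | .add, a, b => a + b
  | .sub, a, b => a - b
  | .mul, a, b => a * b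
  | .lt, a, b => if a < b then 1 else 0
  | .eq, a, b => if a = b then 1 else 0

/-- Expressions: constants, registers, array entries, and applied operations. -/
inductive Expr where
  | const (k : ℕ)
  | reg (x : ℕ)
  | get (a : ℕ) (i : Expr)
  | op (o : Op) (e₁ e₂ : Expr)

/-- The value of an expression. -/
def Expr.val (m : Memory) : Expr → ℕ
  | .const k => k
  | .reg x => m.reg x
  | .get a i => m.arr a (i.val m)
  | .op o e₁ e₂ => o.apply (e₁.val m) (e₂.val m)

/-- The value of the expression and all values met while evaluating it fit into a word. -/
def Expr.Fits (W : ℕ) (m : Memory) : Expr → Prop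
  | .const k => k < W
  | .reg x => m.reg x < W
  | .get a i => i.Fits W m ∧ m.arr a (i.val m) < W
  | .op o e₁ e₂ => e₁.Fits W m ∧ e₂.Fits W m ∧ o.apply (e₁.val m) (e₂.val m) < W

/-- The number of steps needed to evaluate an expression. -/
def Expr.cost : Expr → ℕ
  | .const _ => 1
  | .reg _ => 1
  | .get _ i => i.cost + 1
  | .op _ e₁ e₂ => e₁.cost + e₂.cost + 1

/-- Programs; `loop e p` repeats `p` while the value of `e` is not zero. -/
inductive Program where
  | skip
  | assign (x : ℕ) (e : Expr)
  | store (a : ℕ) (i e : Expr)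
  | seq (p q : Program)
  | ite (e : Expr) (p q : Program)
  | loop (e : Expr) (p : Program)

/-- `Exec W p m m' t`: with word bound `W`, the program `p` started in memory `m` halts in memory
`m'` after exactly `t` steps. An expression counts as true when its value is not zero. The rules are
deterministic, so `m'` and `t` are determined by `W`, `p` and `m`. -/
inductive Exec (W : ℕ) : Program → Memory → Memory → ℕ → Prop
  | skip (m : Memory) : Exec W .skip m m 1
  | assign (m : Memory) (x : ℕ) (e : Expr) (he : e.Fits W m) :
      Exec W (.assign x e) m (m.setReg x (e.val m)) (e.cost + 1)
  | store (m : Memory) (a : ℕ) (i e : Expr) (hi : i.Fits W m) (he : e.Fits W m) :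
      Exec W (.store a i e) m (m.setArr a (i.val m) (e.val m)) (i.cost + e.cost + 1)
  | seq {p q : Program} {m m' m'' : Memory} {s t : ℕ}
      (hp : Exec W p m m' s) (hq : Exec W q m' m'' t) :
      Exec W (.seq p q) m m'' (s + t)
  | iteTrue {e : Expr} {p q : Program} {m m' : Memory} {t : ℕ}
      (he : e.Fits W m) (h : e.val m ≠ 0) (hp : Exec W p m m' t) :
      Exec W (.ite e p q) m m' (e.cost + 1 + t)
  | iteFalse {e : Expr} {p q : Program} {m m' : Memory} {t : ℕ}
      (he : e.Fits W m) (h : e.val m = 0) (hq : Exec W q m m' t) :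
      Exec W (.ite e p q) m m' (e.cost + 1 + t)
  | loopTrue {e : Expr} {p : Program} {m m' m'' : Memory} {s t : ℕ}
      (he : e.Fits W m) (h : e.val m ≠ 0) (hp : Exec W p m m' s)
      (hw : Exec W (.loop e p) m' m'' t) :
      Exec W (.loop e p) m m'' (e.cost + 1 + s + t)
  | loopFalse {e : Expr} {p : Program} {m : Memory}
      (he : e.Fits W m) (h : e.val m = 0) :
      Exec W (.loop e p) m m (e.cost + 1)

open Classical in
/-- The memory that holds the input graph `G` on `n` vertices: register `0` holds `n`, array `0`
holds the adjacency matrix row by row, and everything else is zero. -/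
noncomputable def inputMemory {n : ℕ} (G : SimpleGraph (Fin n)) : Memory where
  reg x := if x = 0 then n else 0
  arr a i := if a = 0 ∧ ∃ u v : Fin n, G.Adj u v ∧ i = u.val * n + v.val then 1 else 0

end OddHole

/-! Let `C` be a heavy-cleanable shortest odd hole of length `2 * m + 1`. The algorithm guesses five
vertices of `C`: the ends of the heavy edge, their other neighbours on `C`, and the vertex of `C`
opposite the edge. It discards the remaining neighbours of the two ends, searches breadth-first from
the opposite vertex, and tests whether the two tree paths to the neighbours of the edge, closed up
by the edge, form a hole. The answer `1` is given only after an explicit test of an odd hole, so it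
is always correct. What needs proof is that the right guess succeeds.

For the right guess, the kept set contains `C` and no `C`-major vertex: `C` is clean
(`IsHeavyCleanable.exists_clean`). The search returns shortest paths, which need not run along `C`.
The crux is `Setting.swap`: without pyramids and jewels, a route of kept vertices between two
vertices of a clean shortest odd hole is never shorter than their distance along the hole, and one
of exactly that length may replace the shorter arc, leaving a clean hole. Two such replacements
(`Setting.swap_twice`) turn `C` into the hole built from the tree paths.

`Setting.swap` is proved by strong induction on the length `k` of the route. For `k ≥ 3`, a
counterexample (`Defect`) is an induced path whose interior avoids the hole, because shorter routes
can already be swapped; its interior has few neighbours on the hole, all near the ends. A path that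
is joined to the hole at two separate pieces produces either two holes of different parity, one of
them odd and too short (`Attached.false_of_even`), or, if one piece is a vertex and the other an
edge, a pyramid (`Attached.hasPyramid`). This gives the new hole. The same dichotomy, applied to a
single vertex (`Setting.minor_of_clusters`), shows that no kept vertex is major for it. Jewels enter
only for `k = 2` (`Setting.swap_two`).

There are at most `n ^ 5` guesses, each handled in time `O(n ^ 3)`. -/

namespace OddHole

/-! ### Holes and induced paths as sequences indexed by natural numbers. -/

section Sequences

variable {V : Type*} {G : SimpleGraph V}

/-- `f 0, …, f (L - 1)` are the vertices of a hole of length `L`, in cyclic order. -/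
structure HoleSeq (G : SimpleGraph V) (L : ℕ) (f : ℕ → V) : Prop where
  four_le : 4 ≤ L
  ne : ∀ i j, i < j → j < L → f i ≠ f j
  adj : ∀ i j, i < j → j < L → (G.Adj (f i) (f j) ↔ j = i + 1 ∨ (i = 0 ∧ j + 1 = L))

/-- `p 0, …, p k` are the vertices of an induced path of length `k`, in order. -/
structure PathSeq (G : SimpleGraph V) (k : ℕ) (p : ℕ → V) : Prop where
  ne : ∀ i j, i < j → j ≤ k → p i ≠ p j
  adj : ∀ i j, i < j → j ≤ k → (G.Adj (p i) (p j) ↔ j = i + 1)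

/-- The cyclic sequence `f 0, …, f (L - 1)` started at `a`. -/
def rot (L a : ℕ) (f : ℕ → V) (i : ℕ) : V :=
  if a + i < L then f (a + i) else f (a + i - L)

/-- The cyclic sequence `f 0, …, f (L - 1)` started at `a` and traversed backwards. -/
def flip (L a : ℕ) (f : ℕ → V) (i : ℕ) : V :=
  if i ≤ a then f (a - i) else f (a + L - i)

/-- The sequence `p` up to position `k`, and `f` from there on. -/
def splice (k : ℕ) (p f : ℕ → V) (i : ℕ) : V :=
  if i ≤ k then p i else f i

theorem splice_of_le {k i : ℕ} (p f : ℕ → V) (h : i ≤ k) : splice k p f i = p i := if_pos h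

theorem splice_of_lt {k i : ℕ} (p f : ℕ → V) (h : k < i) : splice k p f i = f i :=
  if_neg (by omega)

theorem HoleSeq.eq_of_eq {L : ℕ} {f : ℕ → V} (hf : HoleSeq G L f) {i j : ℕ} (hi : i < L)
    (hj : j < L) (h : f i = f j) : i = j := by
  rcases lt_trichotomy i j with h' | h' | h'
  · exact absurd h (hf.ne i j h' hj)
  · exact h'
  · exact absurd h.symm (hf.ne j i h' hi)

theorem HoleSeq.adj_iff {L : ℕ} {f : ℕ → V} (hf : HoleSeq G L f) {i j : ℕ} (hi : i < L)
    (hj : j < L) : G.Adj (f i) (f j) ↔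
      j = i + 1 ∨ i = j + 1 ∨ (i = 0 ∧ j + 1 = L) ∨ (j = 0 ∧ i + 1 = L) := by
  have h4 := hf.four_le
  rcases lt_trichotomy i j with h' | h' | h'
  · rw [hf.adj i j h' hj]; omega
  · subst h'; simp; omega
  · rw [G.adj_comm, hf.adj j i h' hi]; omega

theorem HoleSeq.congr {L : ℕ} {f g : ℕ → V} (hf : HoleSeq G L f) (h : ∀ i < L, g i = f i) :
    HoleSeq G L g where
  four_le := hf.four_le
  ne i j hij hj := by rw [h i (by omega), h j hj]; exact hf.ne i j hij hj
  adj i j hij hj := by rw [h i (by omega), h j hj]; exact hf.adj i j hij hj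

theorem HoleSeq.rot {L a : ℕ} {f : ℕ → V} (hf : HoleSeq G L f) (ha : a < L) :
    HoleSeq G L (rot L a f) where
  four_le := hf.four_le
  ne i j hij hj := by
    have h4 := hf.four_le
    unfold OddHole.rot
    intro h
    split_ifs at h <;> have := hf.eq_of_eq (by omega) (by omega) h <;> omega
  adj i j hij hj := by
    have h4 := hf.four_le
    unfold OddHole.rot
    split_ifs <;> rw [hf.adj_iff (by omega) (by omega)] <;> omega

theorem HoleSeq.flip {L a : ℕ} {f : ℕ → V} (hf : HoleSeq G L f) (ha : a < L) :
    HoleSeq G L (flip L a f) where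
  four_le := hf.four_le
  ne i j hij hj := by
    have h4 := hf.four_le
    unfold OddHole.flip
    intro h
    split_ifs at h <;> have := hf.eq_of_eq (by omega) (by omega) h <;> omega
  adj i j hij hj := by
    have h4 := hf.four_le
    unfold OddHole.flip
    split_ifs <;> rw [hf.adj_iff (by omega) (by omega)] <;> omega

theorem PathSeq.eq_of_eq {k : ℕ} {p : ℕ → V} (hp : PathSeq G k p) {i j : ℕ} (hi : i ≤ k)
    (hj : j ≤ k) (h : p i = p j) : i = j := by
  rcases lt_trichotomy i j with h' | h' | h'
  · exact absurd h (hp.ne i j h' hj)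
  · exact h'
  · exact absurd h.symm (hp.ne j i h' hi)

theorem PathSeq.adj_iff {k : ℕ} {p : ℕ → V} (hp : PathSeq G k p) {i j : ℕ} (hi : i ≤ k)
    (hj : j ≤ k) : G.Adj (p i) (p j) ↔ j = i + 1 ∨ i = j + 1 := by
  rcases lt_trichotomy i j with h' | h' | h'
  · rw [hp.adj i j h' hj]; omega
  · subst h'; simp
  · rw [G.adj_comm, hp.adj j i h' hi]; omega

theorem PathSeq.reverse {k : ℕ} {p : ℕ → V} (hp : PathSeq G k p) :
    PathSeq G k (fun t => p (k - t)) where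
  ne i j hij hj h := by have := hp.eq_of_eq (by omega) (by omega) h; omega
  adj i j hij hj := by rw [hp.adj_iff (by omega) (by omega)]; omega

theorem PathSeq.sub {k : ℕ} {p : ℕ → V} (hp : PathSeq G k p) (a l : ℕ) (h : a + l ≤ k) :
    PathSeq G l (fun t => p (a + t)) where
  ne i j hij hj h := by have := hp.eq_of_eq (by omega) (by omega) h; omega
  adj i j hij hj := by rw [hp.adj_iff (by omega) (by omega)]; omega

theorem HoleSeq.arc {L : ℕ} {f : ℕ → V} (hf : HoleSeq G L f) (a l : ℕ) (h : a + l < L)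
    (hl : l + 1 < L) : PathSeq G l (fun t => f (a + t)) where
  ne i j hij hj h := by have := hf.eq_of_eq (by omega) (by omega) h; omega
  adj i j hij hj := by rw [hf.adj_iff (by omega) (by omega)]; omega

theorem PathSeq.cons {k : ℕ} {p : ℕ → V} (hp : PathSeq G k p) (x : V) (hx : ∀ i ≤ k, x ≠ p i)
    (ha : ∀ i ≤ k, G.Adj x (p i) ↔ i = 0) :
    PathSeq G (k + 1) (fun t => if t = 0 then x else p (t - 1)) where
  ne i j hij hj := by
    have hj0 : j ≠ 0 := by omega
    simp only [hj0, if_false]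
    split_ifs
    · exact hx _ (by omega)
    · intro h; have := hp.eq_of_eq (by omega) (by omega) h; omega
  adj i j hij hj := by
    have hj0 : j ≠ 0 := by omega
    simp only [hj0, if_false]
    split_ifs
    · rw [ha _ (by omega)]; omega
    · rw [hp.adj_iff (by omega) (by omega)]; omega

/-- Two induced paths whose ends are joined by two edges form a hole. -/
theorem HoleSeq.of_paths {x y : ℕ} {p q : ℕ → V} (hp : PathSeq G x p) (hq : PathSeq G y q)
    (hne : ∀ i ≤ x, ∀ j ≤ y, p i ≠ q j)
    (hadj : ∀ i ≤ x, ∀ j ≤ y, G.Adj (p i) (q j) ↔ (i = x ∧ j = 0) ∨ (i = 0 ∧ j = y))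
    (h4 : 2 ≤ x + y) :
    HoleSeq G (x + y + 2) (fun t => if t ≤ x then p t else q (t - (x + 1))) where
  four_le := by omega
  ne i j hij hj := by
    split_ifs
    · exact hp.ne i j hij (by omega)
    · exact hne _ (by omega) _ (by omega)
    · omega
    · exact hq.ne _ _ (by omega) (by omega)
  adj i j hij hj := by
    split_ifs
    · rw [hp.adj i j hij (by omega)]; omega
    · rw [hadj _ (by omega) _ (by omega)]; omega
    · omega
    · rw [hq.adj _ _ (by omega) (by omega)]; omega

/-! ### Holes as vertex sets -/

theorem HoleSeq.isHole {L : ℕ} {f : ℕ → V} (hf : HoleSeq G L f) :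
    ∃ C : Set V, IsHole G C ∧ C.ncard = L := by
  obtain ⟨n, rfl⟩ : ∃ n, L = n + 1 := ⟨L - 1, by have := hf.four_le; omega⟩
  set g : Fin (n + 1) → V := fun i => f i with hg
  have hinj : Function.Injective g := fun i j h => Fin.ext (hf.eq_of_eq i.2 j.2 h)
  have hcard : (Set.range g).ncard = n + 1 := by
    rw [← Set.image_univ, Set.ncard_image_of_injective _ hinj, Set.ncard_univ]; simp
  refine ⟨Set.range g, ⟨?_, ?_⟩, hcard⟩
  · rw [hcard]; exact hf.four_le
  · rw [hcard]
    refine ⟨⟨Equiv.ofInjective g hinj, ?_⟩⟩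
    intro i j
    have h4 := hf.four_le
    have hi := i.2
    have hj := j.2
    simp only [SimpleGraph.comap_adj, Function.Embedding.subtype_apply, Equiv.ofInjective_apply,
      SimpleGraph.cycleGraph_adj', hg]
    rw [hf.adj_iff i.2 j.2, Fin.sub_def, Fin.sub_def]
    dsimp only
    rcases lt_trichotomy i.1 j.1 with h | h | h
    · rw [Nat.mod_eq_of_lt (show n + 1 - j.1 + i.1 < n + 1 by omega),
        show n + 1 - i.1 + j.1 = (j.1 - i.1) + (n + 1) by omega, Nat.add_mod_right,
        Nat.mod_eq_of_lt (show j.1 - i.1 < n + 1 by omega)]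
      omega
    · rw [h, show n + 1 - j.1 + j.1 = n + 1 by omega, Nat.mod_self]
      omega
    · rw [Nat.mod_eq_of_lt (show n + 1 - i.1 + j.1 < n + 1 by omega),
        show n + 1 - j.1 + i.1 = (i.1 - j.1) + (n + 1) by omega, Nat.add_mod_right,
        Nat.mod_eq_of_lt (show i.1 - j.1 < n + 1 by omega)]
      omega

theorem IsHole.exists_holeSeq {C : Set V} (hC : IsHole G C) :
    ∃ f : ℕ → V, HoleSeq G C.ncard f ∧ ∀ x, x ∈ C ↔ ∃ i < C.ncard, f i = x := by
  obtain ⟨h4, ⟨e⟩⟩ := hC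
  generalize hL : C.ncard = L at h4 e
  obtain ⟨n, rfl⟩ : ∃ n, L = n + 1 := ⟨L - 1, by omega⟩
  refine ⟨fun i => if h : i < n + 1 then e ⟨i, h⟩ else e 0, ⟨h4, ?_, ?_⟩, ?_⟩
  · intro i j hij hj
    simp only [show i < n + 1 by omega, hj, dif_pos]
    intro h
    have := e.injective (Subtype.ext h)
    simp only [Fin.mk.injEq] at this
    omega
  · intro i j hij hj
    simp only [show i < n + 1 by omega, hj, dif_pos]
    have : G.Adj (e ⟨i, by omega⟩ : V) (e ⟨j, hj⟩ : V) ↔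
        (SimpleGraph.cycleGraph (n + 1)).Adj ⟨i, by omega⟩ ⟨j, hj⟩ := by
      rw [← e.map_adj_iff]; rfl
    rw [this, SimpleGraph.cycleGraph_adj', Fin.sub_def, Fin.sub_def]
    dsimp only
    rw [Nat.mod_eq_of_lt (show n + 1 - j + i < n + 1 by omega),
        show n + 1 - i + j = (j - i) + (n + 1) by omega, Nat.add_mod_right,
        Nat.mod_eq_of_lt (show j - i < n + 1 by omega)]
    omega
  · intro x
    constructor
    · intro hx
      refine ⟨e.symm ⟨x, hx⟩, (e.symm ⟨x, hx⟩).2, ?_⟩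
      dsimp only
      rw [dif_pos (e.symm ⟨x, hx⟩).2]
      simp
    · rintro ⟨i, hi, rfl⟩
      simp only [hi, dif_pos]
      exact (e ⟨i, hi⟩).2

/-! ### Pyramids and jewels from sequences -/

theorem exists_walk_of_seq {u v : V} (p : ℕ → V) (k : ℕ) (h : ∀ i < k, G.Adj (p i) (p (i + 1)))
    (hu : p 0 = u) (hv : p k = v) :
    ∃ w : G.Walk u v, w.length = k ∧ (∀ x, x ∈ w.support ↔ ∃ i ≤ k, p i = x) ∧
      (∀ i < k, s(p i, p (i + 1)) ∈ w.edges) ∧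
      ((∀ i j, i < j → j ≤ k → p i ≠ p j) → w.IsPath) := by
  subst hu
  induction k generalizing v with
  | zero =>
    subst hv
    refine ⟨.nil, rfl, fun x => ?_, fun i hi => by omega, fun _ => .nil⟩
    simp [eq_comm]
  | succ k ih =>
    subst hv
    obtain ⟨w, hl, hs, he, hpath⟩ := ih (fun i hi => h i (by omega)) rfl
    refine ⟨w.concat (h k (by omega)), by simp [hl], fun x => ?_, fun i hi => ?_, fun hne => ?_⟩
    · simp only [SimpleGraph.Walk.support_concat, List.mem_append, hs,
        List.mem_singleton]
      constructor
      · rintro (⟨i, hi, rfl⟩ | rfl)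
        · exact ⟨i, by omega, rfl⟩
        · exact ⟨k + 1, le_rfl, rfl⟩
      · rintro ⟨i, hi, rfl⟩
        rcases Nat.lt_or_ge k i with h' | h'
        · right; rw [show i = k + 1 by omega]
        · exact Or.inl ⟨i, h', rfl⟩
    · simp only [SimpleGraph.Walk.edges_concat, List.concat_eq_append, List.mem_append,
        List.mem_singleton]
      rcases Nat.lt_or_ge i k with h' | h'
      · exact Or.inl (he i h')
      · right; rw [show i = k by omega]
    · refine (hpath fun i j hij hj => hne i j hij (by omega)).concat ?_ _
      rw [hs]
      rintro ⟨i, hi, heq⟩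
      exact hne i (k + 1) (by omega) le_rfl heq

theorem PathSeq.exists_walk {u v : V} {p : ℕ → V} {k : ℕ} (hp : PathSeq G k p)
    (hu : p 0 = u) (hv : p k = v) :
    ∃ w : G.Walk u v, w.length = k ∧ (∀ x, x ∈ w.support ↔ ∃ i ≤ k, p i = x) ∧
      IsInducedPath w := by
  obtain ⟨w, hl, hs, he, hpath⟩ := exists_walk_of_seq p k
    (fun i hi => (hp.adj i (i + 1) (by omega) (by omega)).2 rfl) hu hv
  refine ⟨w, hl, hs, hpath hp.ne, fun x hx y hy hxy => ?_⟩
  rw [hs] at hx hy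
  obtain ⟨i, hi, rfl⟩ := hx
  obtain ⟨j, hj, rfl⟩ := hy
  rcases (hp.adj_iff hi hj).1 hxy with rfl | rfl
  · exact he i (by omega)
  · rw [Sym2.eq_swap]; exact he j (by omega)

theorem hasPyramid_of_paths {q : Fin 3 → ℕ → V} {k : Fin 3 → ℕ} {v₀ : V}
    (hq : ∀ i, PathSeq G (k i) (q i)) (h0 : ∀ i, q i 0 = v₀) (hk : ∀ i, 1 ≤ k i)
    (hlong : ∃ i j, i ≠ j ∧ 2 ≤ k i ∧ 2 ≤ k j)
    (hcross : ∀ i j, i < j → ∀ s t, 1 ≤ s → s ≤ k i → 1 ≤ t → t ≤ k j →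
      q i s ≠ q j t ∧ (G.Adj (q i s) (q j t) ↔ s = k i ∧ t = k j)) : HasPyramid G := by
  have hcross' : ∀ i j, i ≠ j → ∀ s t, 1 ≤ s → s ≤ k i → 1 ≤ t → t ≤ k j →
      q i s ≠ q j t ∧ (G.Adj (q i s) (q j t) ↔ s = k i ∧ t = k j) := by
    intro i j hij s t h1 h2 h3 h4
    rcases lt_or_gt_of_ne hij with h | h
    · exact hcross i j h s t h1 h2 h3 h4
    · have := hcross j i h t s h3 h4 h1 h2
      exact ⟨this.1.symm, by rw [G.adj_comm, this.2, and_comm]⟩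
  choose w hl hs hind using fun i => (hq i).exists_walk (h0 i) rfl
  have hpos : ∀ i, ∀ s ≤ k i, q i s ≠ v₀ → 1 ≤ s := by
    intro i s _ hne
    rcases Nat.eq_zero_or_pos s with rfl | h
    · exact absurd (h0 i) hne
    · exact h
  refine ⟨v₀, fun i => q i (k i), w, hind, ?_, ?_, ?_, ?_, ?_⟩
  · intro i j hij x hxi hxj
    rw [hs] at hxi hxj
    obtain ⟨s, hsk, rfl⟩ := hxi
    obtain ⟨t, htk, hst⟩ := hxj
    by_contra hne
    exact (hcross' i j hij s t (hpos i s hsk hne) hsk (hpos j t htk (by rwa [hst])) htk).1 hst.symm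
  · intro i
    rw [← h0 i]
    exact ((hq i).ne 0 (k i) (hk i) le_rfl).symm
  · obtain ⟨i, j, hij, hi, hj⟩ := hlong
    exact ⟨i, j, hij, by rwa [hl], by rwa [hl]⟩
  · intro i j hij
    exact (hcross' i j hij _ _ (hk i) le_rfl (hk j) le_rfl).2.2 ⟨rfl, rfl⟩
  · intro i j hij x hx y hy hx0 hy0 hxy
    rw [hs] at hx hy
    obtain ⟨s, hsk, rfl⟩ := hx
    obtain ⟨t, htk, rfl⟩ := hy
    obtain ⟨rfl, rfl⟩ :=
      (hcross' i j hij s t (hpos i s hsk hx0) hsk (hpos j t htk hy0) htk).2.1 hxy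
    exact ⟨rfl, rfl⟩

/-! ### Paths attached to a shortest odd hole -/

/-- The path `r 0, …, r s` avoids the hole `f`, and is joined to it exactly by edges from `r 0` to
positions `0, …, α`, including both ends, and from `r s` to positions `b, …, b + β`, including both
ends. -/
structure Attached (G : SimpleGraph V) (L : ℕ) (f : ℕ → V) (s : ℕ) (r : ℕ → V) (α b β : ℕ) :
    Prop where
  path : PathSeq G s r
  ne : ∀ i ≤ s, ∀ j < L, r i ≠ f j
  lt : α < b
  lt' : b + β < L
  a0 : G.Adj (r 0) (f 0)
  a1 : G.Adj (r 0) (f α)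
  b0 : G.Adj (r s) (f b)
  b1 : G.Adj (r s) (f (b + β))
  only : ∀ i ≤ s, ∀ j < L, G.Adj (r i) (f j) → (i = 0 ∧ j ≤ α) ∨ (i = s ∧ b ≤ j ∧ j ≤ b + β)

/-- The path is closed up through the arc from `α` to `b`, which meets the two pieces only in its
ends; `Attached.hole₂` uses the complementary arc, from `b + β` round to `0`. -/
theorem Attached.hole₁ {L : ℕ} {f : ℕ → V} {s : ℕ} {r : ℕ → V} {α b β : ℕ}
    (h : Attached G L f s r α b β) (hf : HoleSeq G L f) (hL : b - α + 1 < L)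
    (h4 : 2 ≤ b - α + s) : ∃ g, HoleSeq G (b - α + s + 2) g := by
  have h1 := h.lt
  have h2 := h.lt'
  refine ⟨_, HoleSeq.of_paths (hf.arc α (b - α) (by omega) hL) h.path.reverse
    (fun i hi j hj => (h.ne _ (by omega) _ (by omega)).symm) (fun i hi j hj => ?_) h4⟩
  rw [G.adj_comm]
  constructor
  · intro hadj
    have := h.only _ (by omega) _ (by omega) hadj
    omega
  · rintro (⟨rfl, rfl⟩ | ⟨rfl, rfl⟩)
    · rw [show α + (b - α) = b by omega]; exact h.b0
    · simpa using h.a1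

theorem Attached.hole₂ {L : ℕ} {f : ℕ → V} {s : ℕ} {r : ℕ → V} {α b β : ℕ}
    (h : Attached G L f s r α b β) (hf : HoleSeq G L f)
    (h4 : 2 ≤ L - (b + β) + s) (hb : 2 ≤ b + β) : ∃ g, HoleSeq G (L - (b + β) + s + 2) g := by
  have h1 := h.lt
  have h2 := h.lt'
  have key : ∀ i ≤ L - (b + β), ∃ j < L, rot L (b + β) f (0 + i) = f j ∧
      (i < L - (b + β) ∧ j = b + β + i ∨ i = L - (b + β) ∧ j = 0) := by
    intro i hi
    unfold OddHole.rot
    split_ifs with hlt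
    · exact ⟨_, hlt, by simp, by omega⟩
    · exact ⟨_, by omega, rfl, by omega⟩
  refine ⟨_, HoleSeq.of_paths ((hf.rot h.lt').arc 0 (L - (b + β)) (by omega) (by omega))
    h.path (fun i hi j hj => ?_) (fun i hi j hj => ?_) h4⟩
  · obtain ⟨j', hj', he, -⟩ := key i hi
    rw [he]
    exact (h.ne _ (by omega) _ (by omega)).symm
  · obtain ⟨j', hj', he, hc⟩ := key i hi
    rw [he, G.adj_comm]
    constructor
    · intro hadj
      have := h.only _ (by omega) _ (by omega) hadj
      omega
    · rintro (⟨rfl, rfl⟩ | ⟨rfl, rfl⟩)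
      · rw [show j' = 0 by omega]; exact h.a0
      · rw [show j' = b + β by omega]; exact h.b1

/-- A path attached to two disjoint pieces of even total length gives two holes of different
parity. -/
theorem Attached.false_of_even {L : ℕ} {f : ℕ → V} {s : ℕ} {r : ℕ → V} {α b β : ℕ}
    (h : Attached G L f s r α b β) (hf : HoleSeq G L f) (hodd : Odd L)
    (hmin : ∀ L' g, HoleSeq G L' g → Odd L' → L ≤ L') (heven : Even (α + β))
    (h1 : 2 ≤ b - α + s) (h2 : 2 ≤ L - (b + β) + s) (h3 : b - α + s + 2 < L)
    (h4 : s + 2 < b + β) : False := by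
  have := h.lt
  have := h.lt'
  -- The two lengths add up to `L - (α + β) + 2 * s + 4`, which is odd, so one of the holes is odd;
  -- `h3` and `h4` make both shorter than `L`.
  obtain ⟨g₁, hg₁⟩ := h.hole₁ hf (by omega) h1
  obtain ⟨g₂, hg₂⟩ := h.hole₂ hf h2 (by omega)
  have e₁ : ¬ Odd (b - α + s + 2) := fun ho => by have := hmin _ _ hg₁ ho; omega
  have e₂ : ¬ Odd (L - (b + β) + s + 2) := fun ho => by have := hmin _ _ hg₂ ho; omega
  rw [Nat.odd_iff] at *
  rw [Nat.even_iff] at heven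
  omega

/-- The apex is `f 0` and the base is `r s`, `f b`, `f (b + 1)`. The three paths are `r` preceded by
`f 0`, the arc forwards to `b`, and the arc backwards to `b + 1`; the bounds on `b` make both arcs
of length at least two. -/
theorem Attached.hasPyramid {L : ℕ} {f : ℕ → V} {s : ℕ} {r : ℕ → V} {b : ℕ}
    (h : Attached G L f s r 0 b 1) (hf : HoleSeq G L f) (h1 : 2 ≤ b) (h2 : b + 3 ≤ L) :
    HasPyramid G := by
  have hr := h.path.cons (f 0) (fun i hi => (h.ne i hi 0 (by omega)).symm) (fun i hi => by
    rw [G.adj_comm]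
    constructor
    · intro hadj
      have := h.only i hi 0 (by omega) hadj
      omega
    · rintro rfl
      exact h.a0)
  have hfl := (hf.flip (a := 0) (by omega)).arc 0 (L - (b + 1)) (by omega) (by omega)
  have hadj : ∀ i, 1 ≤ i → i ≤ s + 1 → ∀ j, 1 ≤ j → j < L →
      (G.Adj (r (i - 1)) (f j) ↔ i = s + 1 ∧ (j = b ∨ j = b + 1)) := by
    intro i hi hi' j hj hj'
    constructor
    · intro hadj
      have := h.only (i - 1) (by omega) j hj' hadj
      omega
    · rintro ⟨rfl, rfl | rfl⟩
      · simpa using h.b0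
      · simpa using h.b1
  refine hasPyramid_of_paths (v₀ := f 0)
    (q := ![fun t => if t = 0 then f 0 else r (t - 1), fun t => f (0 + t),
      fun t => flip L 0 f (0 + t)]) (k := ![s + 1, b, L - (b + 1)]) ?_ ?_ ?_ ?_ ?_
  · intro i
    fin_cases i
    · exact hr
    · exact hf.arc 0 b (by omega) (by omega)
    · exact hfl
  · intro i
    fin_cases i <;> simp [OddHole.flip]
  · intro i
    fin_cases i <;> simp <;> omega
  · exact ⟨1, 2, by decide, by simpa using h1, by simp; omega⟩
  · have hflip : ∀ t, 1 ≤ t → flip L 0 f (0 + t) = f (L - t) := by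
      intro t ht
      simp only [OddHole.flip]
      rw [if_neg (by omega)]
      congr 1
      omega
    intro i j hij σ t hs1 hs2 ht1 ht2
    fin_cases i <;> fin_cases j <;>
      first
      | exact absurd hij (by decide)
      | skip
    · simp only [Fin.zero_eta, Fin.mk_one, Matrix.cons_val_zero, Matrix.cons_val_one] at *
      rw [if_neg (by omega), hadj σ hs1 hs2 _ (by omega) (by omega)]
      exact ⟨h.ne _ (by omega) _ (by omega), by omega⟩
    · simp only [Fin.zero_eta, Fin.reduceFinMk, Matrix.cons_val_zero, Matrix.cons_val] at *
      rw [if_neg (by omega), hflip t ht1, hadj σ hs1 hs2 _ (by omega) (by omega)]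
      exact ⟨h.ne _ (by omega) _ (by omega), by omega⟩
    · simp only [Fin.mk_one, Fin.reduceFinMk, Matrix.cons_val_one, Matrix.cons_val] at *
      rw [hflip t ht1, hf.adj_iff (by omega) (by omega)]
      refine ⟨hf.ne _ _ (by omega) (by omega), by omega⟩

theorem rot_apply {L a i j : ℕ} (f : ℕ → V) (hj : j < L) (h : a + i = j ∨ a + i = L + j) :
    rot L a f i = f j := by
  unfold OddHole.rot
  split_ifs <;> (congr 1; omega)

theorem flip_apply {L a i j : ℕ} (f : ℕ → V) (hj : j < L) (h : i + j = a ∨ i + j = a + L) :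
    flip L a f i = f j := by
  unfold OddHole.flip
  split_ifs <;> (congr 1; omega)

theorem exists_rot_eq {L a i : ℕ} (f : ℕ → V) (ha : a < L) (hi : i < L) :
    ∃ j < L, (a + i = j ∨ a + i = L + j) ∧ rot L a f i = f j := by
  have : ∃ j < L, a + i = j ∨ a + i = L + j := by
    rcases Nat.lt_or_ge (a + i) L with h | h
    · exact ⟨a + i, h, Or.inl rfl⟩
    · exact ⟨a + i - L, by omega, by omega⟩
  obtain ⟨j, hj, h⟩ := this
  exact ⟨j, hj, h, rot_apply f hj h⟩

theorem exists_flip_eq {L a i : ℕ} (f : ℕ → V) (ha : a < L) (hi : i < L) :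
    ∃ j < L, (i + j = a ∨ i + j = a + L) ∧ flip L a f i = f j := by
  have : ∃ j < L, i + j = a ∨ i + j = a + L := by
    rcases Nat.lt_or_ge a i with h | h
    · exact ⟨a + L - i, by omega, by omega⟩
    · exact ⟨a - i, by omega, by omega⟩
  obtain ⟨j, hj, h⟩ := this
  exact ⟨j, hj, h, flip_apply f hj h⟩

/-- Exchanging the two ends of the path brings the case of an edge first and a vertex second into
the form required by `Attached.hasPyramid`. -/
theorem Attached.symm {L : ℕ} {f : ℕ → V} {s : ℕ} {r : ℕ → V} {α b β : ℕ}
    (h : Attached G L f s r α b β) :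
    Attached G L (rot L b f) s (fun t => r (s - t)) β (L - b) α where
  path := h.path.reverse
  ne i hi j hj := by
    have := h.lt'
    obtain ⟨j', hj', -, he⟩ := exists_rot_eq f (show b < L by omega) hj
    rw [he]; exact h.ne _ (by omega) _ hj'
  lt := by have := h.lt'; omega
  lt' := by have := h.lt; have := h.lt'; omega
  a0 := by
    have := h.lt'
    rw [rot_apply f (show b < L by omega) (by omega)]; exact h.b0
  a1 := by
    rw [rot_apply f h.lt' (by omega)]; exact h.b1
  b0 := by
    have := h.lt'
    rw [rot_apply f (show 0 < L by omega) (by omega), Nat.sub_self]; exact h.a0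
  b1 := by
    have := h.lt'
    have := h.lt
    rw [rot_apply f (show α < L by omega) (by omega), Nat.sub_self]; exact h.a1
  only i hi j hj hadj := by
    have := h.lt'
    have := h.lt
    obtain ⟨j', hj', hjj, he⟩ := exists_rot_eq f (show b < L by omega) hj
    rw [he] at hadj
    have := h.only _ (by omega) _ hj' hadj
    omega

end Sequences
end OddHole

namespace OddHole

/-! ### Clean holes, routes, and replacing an arc by a route. -/

section Swapping

variable {V : Type*} {G : SimpleGraph V}

/-- The neighbours of `x` on the hole `f` lie on a three-vertex path of the hole. -/
def Minor (G : SimpleGraph V) (L : ℕ) (f : ℕ → V) (x : V) : Prop :=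
  ∃ c < L, ∀ j < L, G.Adj x (f j) →
    j = c ∨ j = c + 1 ∨ c = j + 1 ∨ (c = 0 ∧ j + 1 = L) ∨ (j = 0 ∧ c + 1 = L)

theorem Minor.congr {L : ℕ} {f g : ℕ → V} {x : V} (h : Minor G L f x)
    (hfg : ∀ i < L, g i = f i) : Minor G L g x := by
  obtain ⟨c, hc, h⟩ := h
  exact ⟨c, hc, fun j hj hadj => h j hj (by rwa [← hfg j hj])⟩

theorem Minor.rot {L a : ℕ} {f : ℕ → V} {x : V} (h : Minor G L f x) (ha : a < L) :
    Minor G L (rot L a f) x := by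
  obtain ⟨c, hc, h⟩ := h
  refine ⟨if a ≤ c then c - a else c + L - a, by split_ifs <;> omega, fun j hj hadj => ?_⟩
  obtain ⟨j', hj', hjj, he⟩ := exists_rot_eq f ha hj
  rw [he] at hadj
  have := h j' hj' hadj
  split_ifs <;> omega

theorem Minor.flip {L a : ℕ} {f : ℕ → V} {x : V} (h : Minor G L f x) (ha : a < L) :
    Minor G L (flip L a f) x := by
  obtain ⟨c, hc, h⟩ := h
  refine ⟨if c ≤ a then a - c else a + L - c, by split_ifs <;> omega, fun j hj hadj => ?_⟩
  obtain ⟨j', hj', hjj, he⟩ := exists_flip_eq f ha hj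
  rw [he] at hadj
  have := h j' hj' hadj
  split_ifs <;> omega

theorem HoleSeq.minor {L i : ℕ} {f : ℕ → V} (hf : HoleSeq G L f) (hi : i < L) :
    Minor G L f (f i) :=
  ⟨i, hi, fun j hj hadj => by rw [hf.adj_iff hi hj] at hadj; omega⟩

/-- A hole inside `O` none of whose major vertices lie in `O`. -/
structure Clean (G : SimpleGraph V) (O : Set V) (L : ℕ) (f : ℕ → V) : Prop where
  hole : HoleSeq G L f
  mem : ∀ i < L, f i ∈ O
  minor : ∀ x ∈ O, Minor G L f x

variable {O : Set V}

theorem Clean.congr {L : ℕ} {f g : ℕ → V} (hf : Clean G O L f) (h : ∀ i < L, g i = f i) :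
    Clean G O L g where
  hole := hf.hole.congr h
  mem i hi := by rw [h i hi]; exact hf.mem i hi
  minor x hx := (hf.minor x hx).congr h

theorem Clean.rot {L a : ℕ} {f : ℕ → V} (hf : Clean G O L f) (ha : a < L) :
    Clean G O L (rot L a f) where
  hole := hf.hole.rot ha
  mem i hi := by
    obtain ⟨j, hj, -, he⟩ := exists_rot_eq f ha hi
    rw [he]; exact hf.mem j hj
  minor x hx := (hf.minor x hx).rot ha

theorem Clean.flip {L a : ℕ} {f : ℕ → V} (hf : Clean G O L f) (ha : a < L) :
    Clean G O L (flip L a f) where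
  hole := hf.hole.flip ha
  mem i hi := by
    obtain ⟨j, hj, -, he⟩ := exists_flip_eq f ha hi
    rw [he]; exact hf.mem j hj
  minor x hx := (hf.minor x hx).flip ha

/-- A graph without pyramids and jewels all of whose odd holes have length at least `L`. -/
structure Setting (G : SimpleGraph V) (L : ℕ) : Prop where
  odd : Odd L
  min : ∀ L' g, HoleSeq G L' g → Odd L' → L ≤ L'
  noPyramid : ¬ HasPyramid G
  noJewel : ¬ HasJewel G

/-- A walk `p 0, …, p k` inside `O`. -/
structure Route (G : SimpleGraph V) (O : Set V) (k : ℕ) (p : ℕ → V) : Prop where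
  adj : ∀ i < k, G.Adj (p i) (p (i + 1))
  mem : ∀ i ≤ k, p i ∈ O

theorem Route.sub {k : ℕ} {p : ℕ → V} (hp : Route G O k p) (a l : ℕ) (h : a + l ≤ k) :
    Route G O l (fun t => p (a + t)) where
  adj i hi := hp.adj (a + i) (by omega)
  mem i hi := hp.mem (a + i) (by omega)

theorem Route.reverse {k : ℕ} {p : ℕ → V} (hp : Route G O k p) :
    Route G O k (fun t => p (k - t)) where
  adj i hi := by
    have := (hp.adj (k - (i + 1)) (by omega)).symm
    rwa [show k - (i + 1) + 1 = k - i by omega] at this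
  mem i hi := hp.mem (k - i) (by omega)

theorem Route.append {k l : ℕ} {p q : ℕ → V} (hp : Route G O k p) (hq : Route G O l q)
    (h : G.Adj (p k) (q 0)) :
    Route G O (k + 1 + l) (fun t => if t ≤ k then p t else q (t - (k + 1))) where
  adj i hi := by
    rcases lt_trichotomy i k with h' | h' | h'
    · rw [if_pos (by omega), if_pos (by omega)]; exact hp.adj i h'
    · subst h'; rw [if_pos (by omega), if_neg (by omega), Nat.sub_self]; exact h
    · rw [if_neg (by omega), if_neg (by omega), show i + 1 - (k + 1) = i - (k + 1) + 1 by omega]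
      exact hq.adj _ (by omega)
  mem i hi := by
    split_ifs
    · exact hp.mem i (by assumption)
    · exact hq.mem _ (by omega)

theorem Route.single {x : V} (hx : x ∈ O) : Route G O 0 (fun _ => x) :=
  ⟨fun i hi => by omega, fun _ _ => hx⟩

/-- A route of length at most the distance of its ends on a clean hole is as long as that distance,
and may replace the corresponding part of the hole. -/
def Swap (G : SimpleGraph V) (O : Set V) (L k : ℕ) : Prop :=
  ∀ (f p : ℕ → V) (K : ℕ), Clean G O L f → Route G O k p → p 0 = f 0 → p k = f K → 2 * K < L →
    k ≤ K → k = K ∧ Clean G O L (splice k p f)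

/-- The weakening of `Swap` that does not say that the new hole is clean. -/
def HoleSwap (G : SimpleGraph V) (O : Set V) (L k : ℕ) : Prop :=
  ∀ (f p : ℕ → V) (K : ℕ), Clean G O L f → Route G O k p → p 0 = f 0 → p k = f K → 2 * K < L →
    k ≤ K → k = K ∧ HoleSeq G L (splice k p f)

/-- The vertex `y` is a path of length zero attached to the hole at two pieces. If `α + β` is even,
there is a shorter odd hole; if it is odd, one piece is a vertex and the other an edge, and there is
a pyramid. The only way out is that both pieces are single vertices at distance two, and then `y` is
minor. -/
theorem Setting.minor_of_clusters {L : ℕ} {f : ℕ → V} {y : V} {a α b β : ℕ} (hG : Setting G L)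
    (hf : HoleSeq G L f) (hy : ∀ j < L, y ≠ f j) (gap₁ : a + α + 2 ≤ b)
    (gap₂ : b + β + 2 ≤ L + a) (hb : b + β < L) (ha0 : G.Adj y (f a)) (ha1 : G.Adj y (f (a + α)))
    (hb0 : G.Adj y (f b)) (hb1 : G.Adj y (f (b + β)))
    (hno : ∀ j < L, G.Adj y (f j) → (a ≤ j ∧ j ≤ a + α) ∨ (b ≤ j ∧ j ≤ b + β))
    (hαβ : (α ≤ 1 ∧ β ≤ 1) ∨ (α = 0 ∧ β = 2)) : Minor G L f y := by
  have haL : a < L := by omega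
  have hatt : Attached G L (OddHole.rot L a f) 0 (fun _ => y) α (b - a) β :=
    { path := ⟨fun i j _ _ => by omega, fun i j _ _ => by omega⟩
      ne := fun i _ j hj => by
        obtain ⟨j', hj', -, he⟩ := exists_rot_eq f haL hj
        rw [he]; exact hy j' hj'
      lt := by omega
      lt' := by omega
      a0 := by rw [rot_apply f haL (by omega)]; exact ha0
      a1 := by rw [rot_apply f (show a + α < L by omega) (by omega)]; exact ha1
      b0 := by rw [rot_apply f (show b < L by omega) (by omega)]; exact hb0
      b1 := by rw [rot_apply f (show b + β < L by omega) (by omega)]; exact hb1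
      only := fun i hi j hj hadj => by
        obtain ⟨j', hj', hjj, he⟩ := exists_rot_eq f haL hj
        rw [he] at hadj
        have := hno j' hj' hadj
        omega }
  by_cases hc : α = 0 ∧ β = 0 ∧ (b = a + 2 ∨ b + 2 = L + a)
  · obtain ⟨rfl, rfl, h | h⟩ := hc
    · exact ⟨a + 1, by omega, fun j hj hadj => by have := hno j hj hadj; omega⟩
    · rcases Nat.eq_zero_or_pos a with rfl | ha
      · exact ⟨L - 1, by omega, fun j hj hadj => by have := hno j hj hadj; omega⟩
      · exact ⟨0, by omega, fun j hj hadj => by have := hno j hj hadj; omega⟩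
  exfalso
  by_cases heven : Even (α + β)
  · rw [Nat.even_iff] at heven
    exact hatt.false_of_even (hf.rot haL) hG.odd hG.min (Nat.even_iff.2 heven) (by omega) (by omega)
      (by omega) (by omega)
  · rw [Nat.even_iff] at heven
    have : (α = 0 ∧ β = 1) ∨ (α = 1 ∧ β = 0) := by omega
    rcases this with ⟨rfl, rfl⟩ | ⟨rfl, rfl⟩
    · exact hG.noPyramid (hatt.hasPyramid (hf.rot haL) (by omega) (by omega))
    · exact hG.noPyramid (hatt.symm.hasPyramid ((hf.rot haL).rot (by omega)) (by omega) (by omega))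

/-! ### Routes and distances -/

section Induction

variable {L k : ℕ}

/-- The conclusion says that the cyclic distance of `a` and `b` is at most `i`. Were it larger,
`Swap` along the shorter arc, forwards by `rot` or backwards by `flip`, would force equality. -/
theorem Swap.dist_le {i a b : ℕ} {f p : ℕ → V} (hodd : Odd L) (hS : Swap G O L i)
    (hf : Clean G O L f) (hp : Route G O i p) (ha : a < L) (hb : b < L) (h0 : p 0 = f a)
    (hi : p i = f b) : (a ≤ b + i ∧ b ≤ a + i) ∨ L + a ≤ b + i ∨ L + b ≤ a + i := by
  by_contra hcon
  rw [Nat.odd_iff] at hodd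
  have h4 := hf.hole.four_le
  obtain ⟨d, hd, hd'⟩ : ∃ d < L, a + d = b ∨ a + d = L + b := by
    rcases Nat.lt_or_ge b a with h | h
    · exact ⟨L + b - a, by omega, by omega⟩
    · exact ⟨b - a, by omega, by omega⟩
  rcases Nat.lt_or_ge (2 * d) L with h | h
  · have := (hS (OddHole.rot L a f) p d (hf.rot ha) hp (by rw [h0, rot_apply f ha (by omega)])
      (by rw [hi, rot_apply f hb hd']) h (by omega)).1
    omega
  · have := (hS (OddHole.flip L a f) p (L - d) (hf.flip ha) hp
      (by rw [h0, flip_apply f ha (by omega)])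
      (by rw [hi, flip_apply f hb (by omega)]) (by omega) (by omega)).1
    omega

/-- All shortcut arguments end here: by induction a route shorter than `k` between the same ends
would have length exactly `K`, but `k ≤ K`. -/
theorem Route.false_of_lt {k' K : ℕ} {f p : ℕ → V} (hp : Route G O k' p)
    (IH : ∀ k' < k, Swap G O L k') (hf : Clean G O L f) (h0 : p 0 = f 0) (hK : p k' = f K)
    (hK2 : 2 * K < L) (hkK : k ≤ K) (hlt : k' < k) : False := by
  have := (IH k' hlt f p K hf hp h0 hK hK2 (by omega)).1
  omega

theorem Route.pathSeq {K : ℕ} {f p : ℕ → V} (hp : Route G O k p)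
    (IH : ∀ k' < k, Swap G O L k') (hf : Clean G O L f) (h0 : p 0 = f 0) (hK : p k = f K)
    (hK2 : 2 * K < L) (hkK : k ≤ K) : PathSeq G k p where
  ne i j hij hj heq := by
    rcases Nat.eq_or_lt_of_le hj with rfl | hjk
    · exact (hp.sub 0 i (by omega)).false_of_lt IH hf (by simpa using h0)
        (by rw [Nat.zero_add, heq, hK]) hK2 hkK hij
    · have hadj : G.Adj (p (0 + i)) (p (j + 1 + 0)) := by
        rw [Nat.zero_add, heq]; exact hp.adj j hjk
      refine ((hp.sub 0 i (by omega)).append (hp.sub (j + 1) (k - (j + 1)) (by omega))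
        hadj).false_of_lt IH hf (by simpa using h0) (K := K) ?_ hK2 hkK (by omega)
      rw [if_neg (by omega), ← hK]
      congr 1
      omega
  adj i j hij hj := by
    constructor
    · intro hadj
      by_contra hne
      refine ((hp.sub 0 i (by omega)).append (hp.sub j (k - j) (by omega))
        (by simpa using hadj)).false_of_lt IH hf (by simpa using h0) (K := K) ?_ hK2 hkK (by omega)
      rw [if_neg (by omega), ← hK]
      congr 1
      omega
    · rintro rfl
      exact hp.adj i (by omega)

/-- The detour from `p a` through `y` to `p b` has length two, so it is a shortcut as soon as `b > a
+ 2`. -/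
theorem Route.near {K a b : ℕ} {f p : ℕ → V} {y : V} (hp : Route G O k p)
    (IH : ∀ k' < k, Swap G O L k') (hf : Clean G O L f) (h0 : p 0 = f 0) (hK : p k = f K)
    (hK2 : 2 * K < L) (hkK : k ≤ K) (hy : y ∈ O) (ha : G.Adj y (p a)) (hb : G.Adj y (p b))
    (hbk : b ≤ k) : b ≤ a + 2 := by
  by_contra hlt
  have h1 := (hp.sub 0 a (by omega)).append (Route.single (G := G) hy) (by simpa using ha.symm)
  refine (h1.append (hp.sub b (k - b) (by omega)) ?_).false_of_lt IH hf ?_ (K := K) ?_ hK2 hkK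
    (by omega)
  · rw [if_neg (by omega)]; exact hb
  · simpa using h0
  · rw [if_neg (by omega), ← hK]
    congr 1
    omega

theorem clean_splice_of_flip {K : ℕ} {f p : ℕ → V} (hKL : K < L)
    (h : Clean G O L (splice K (fun t => p (K - t)) (OddHole.flip L K f))) :
    Clean G O L (splice K p f) := by
  refine (h.flip hKL).congr fun i hi => ?_
  rcases Nat.lt_or_ge K i with hlt | hge
  · rw [splice_of_lt _ _ hlt, flip_apply (j := K + L - i) _ (by omega) (by omega),
      splice_of_lt _ _ (by omega), flip_apply (j := i) _ hi (by omega)]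
  · rw [splice_of_le _ _ hge, flip_apply (j := K - i) _ (by omega) (by omega),
      splice_of_le _ _ (by omega)]
    congr 1
    omega

/-- A route through an interior vertex that lies on the hole splits into two shorter ones. -/
theorem Route.swap_of_mem {K i j : ℕ} {f p : ℕ → V} (hp : Route G O k p) (hodd : Odd L)
    (IH : ∀ k' < k, Swap G O L k') (hf : Clean G O L f) (h0 : p 0 = f 0) (hK : p k = f K)
    (hK2 : 2 * K < L) (hkK : k ≤ K) (hi0 : 0 < i) (hik : i < k) (hj : j < L) (hij : p i = f j) :
    j = i ∧ k = K ∧ Clean G O L (splice k p f) := by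
  have d1 := (IH i hik).dist_le hodd hf (hp.sub 0 i (by omega)) (show 0 < L by omega) hj
    (by simpa using h0) (by simpa using hij)
  have d2 := (IH (k - i) (by omega)).dist_le hodd hf (hp.sub i (k - i) (by omega)) hj
    (show K < L by omega) (by simpa using hij) (by
      rw [show i + (k - i) = k by omega]; exact hK)
  -- The distances of `f j` from `f 0` and from `f K` are at most `i` and `k - i`, which add up to
  -- `k ≤ K`; so both bounds are tight and `f j` lies on the short arc.
  have hji : j = i := by omega
  have hkK' : k = K := by omega
  subst hji hkK'
  refine ⟨rfl, rfl, ?_⟩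
  -- The two pieces of the route are swapped in one after the other; the second is treated after
  -- rotating the hole to start at position `j`.
  have c1 := (IH j hik f p j hf (by simpa using hp.sub 0 j (by omega)) h0 hij (by omega) le_rfl).2
  have c2 := (IH (k - j) (by omega) (OddHole.rot L j (splice j p f)) (fun t => p (j + t)) (k - j)
    (c1.rot hj) (hp.sub j (k - j) (by omega)) (by
      rw [rot_apply (j := j) _ hj (by omega)]; simp [splice]) (by
      rw [rot_apply (j := k) _ (by omega) (by omega)]
      rw [splice_of_lt _ _ hik, ← hK]
      congr 1
      omega) (by omega) le_rfl).2
  refine (c2.rot (a := L - j) (by omega)).congr fun i hi => ?_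
  rcases Nat.lt_or_ge i j with h | h
  · rw [rot_apply (j := L - j + i) _ (by omega) (by omega),
      splice_of_le (i := i) _ _ (by omega), splice_of_lt _ _ (by omega),
      rot_apply (j := i) _ (by omega) (by omega), splice_of_le _ _ (by omega)]
  · rw [rot_apply (j := i - j) _ (by omega) (by omega)]
    rcases Nat.lt_or_ge k i with h' | h'
    · rw [splice_of_lt _ _ h', splice_of_lt _ _ (by omega),
        rot_apply (j := i) _ (by omega) (by omega), splice_of_lt _ _ (by omega)]
    · rw [splice_of_le _ _ h', splice_of_le _ _ (by omega)]
      congr 1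
      omega

end Induction
end Swapping
end OddHole

namespace OddHole

/-! ### The inductive step: a route of length at least three still gives a hole. -/

section SwapStep

variable {V : Type*} {G : SimpleGraph V} {O : Set V} {L k K : ℕ} {f p : ℕ → V}

/-- A route between two positions of a clean hole for which the conclusion of `Swap` fails. -/
structure Defect (G : SimpleGraph V) (O : Set V) (L k K : ℕ) (f p : ℕ → V) : Prop where
  clean : Clean G O L f
  route : Route G O k p
  first : p 0 = f 0
  last : p k = f K
  lt : 2 * K < L
  le : k ≤ K
  three_le : 3 ≤ k
  not_swap : ¬ (k = K ∧ Clean G O L (splice k p f))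

theorem Defect.reverse (h : Defect G O L k K f p) :
    Defect G O L k K (flip L K f) (fun t => p (k - t)) where
  clean := h.clean.flip (by have := h.lt; omega)
  route := h.route.reverse
  first := by
    have := h.lt
    rw [flip_apply (j := K) _ (by omega) (by omega), ← h.last]; rfl
  last := by
    have := h.lt
    rw [flip_apply (j := 0) _ (by omega) (by omega), ← h.first, Nat.sub_self]
  lt := h.lt
  le := h.le
  three_le := h.three_le
  not_swap := by
    rintro ⟨rfl, hc⟩
    exact h.not_swap ⟨rfl, clean_splice_of_flip (by have := h.lt; omega) hc⟩

theorem Defect.pathSeq (h : Defect G O L k K f p) (IH : ∀ k' < k, Swap G O L k') :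
    PathSeq G k p :=
  h.route.pathSeq IH h.clean h.first h.last h.lt h.le

theorem Defect.ne (h : Defect G O L k K f p) (hodd : Odd L) (IH : ∀ k' < k, Swap G O L k')
    {i j : ℕ} (hi0 : 0 < i) (hik : i < k) (hj : j < L) : p i ≠ f j := fun hij =>
  h.not_swap
    (h.route.swap_of_mem hodd IH h.clean h.first h.last h.lt h.le hi0 hik hj hij).2

/-- Following `p` to `p i` and stepping to `f j` gives a route of length `i + 1 < k`, so `f j` is
within `i + 1` of `f 0` along the hole. If the distance is exactly `i + 1`, swapping this route in
puts `p i` on a clean hole through both ends of `p`. Then `Route.swap_of_mem` swaps in all of `p`,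
or, if the route went round the other side, gives `p i` a wrong position. -/
theorem Defect.adj_left (h : Defect G O L k K f p) (hodd : Odd L)
    (IH : ∀ k' < k, Swap G O L k') {i j : ℕ} (hi0 : 0 < i) (hik : i + 1 < k) (hj : j < L)
    (hij : G.Adj (p i) (f j)) : j ≤ i ∨ L ≤ j + i := by
  have hlt := h.lt
  have hle := h.le
  by_contra hcon
  set q : ℕ → V := fun t => if t ≤ i then p t else f j with hq
  have hr : Route G O (i + 1) q := by
    have := (h.route.sub 0 i (by omega)).append (Route.single (G := G) (h.clean.mem j hj))
      (by simpa using hij)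
    simpa using this
  have hq0 : q 0 = f 0 := by simp [hq, h.first]
  have hq1 : q (i + 1) = f j := by simp [hq]
  have d := (IH (i + 1) hik).dist_le hodd h.clean hr (show 0 < L by omega) hj hq0 hq1
  have hj' : j = i + 1 ∨ j + (i + 1) = L := by omega
  rcases hj' with rfl | hj'
  · have c := (IH (i + 1) hik f q (i + 1) h.clean hr hq0 hq1 (by omega) le_rfl).2
    refine h.not_swap ?_
    obtain ⟨-, h1, h2⟩ := h.route.swap_of_mem hodd IH c (i := i) (j := i) (K := K)
      (by rw [splice_of_le _ _ (by omega), hq0, h.first])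
      (by rw [splice_of_lt _ _ (by omega), h.last]) hlt hle hi0 (by omega) (by omega)
      (by rw [splice_of_le _ _ (by omega)]; simp [hq])
    refine ⟨h1, h2.congr fun t ht => ?_⟩
    rcases Nat.lt_or_ge k t with hkt | hkt
    · rw [splice_of_lt _ _ hkt, splice_of_lt _ _ hkt, splice_of_lt _ _ (by omega)]
    · rw [splice_of_le _ _ hkt, splice_of_le _ _ hkt]
  · have c := (IH (i + 1) hik (OddHole.flip L 0 f) q (i + 1) (h.clean.flip (by omega)) hr
      (by rw [flip_apply (j := 0) _ (by omega) (by omega), hq0])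
      (by rw [flip_apply (j := j) _ (by omega) (by omega), hq1]) (by omega) le_rfl).2
    have c' := c.flip (a := 0) (by omega)
    obtain ⟨h1, -⟩ := h.route.swap_of_mem hodd IH c' (i := i) (j := L - i) (K := K)
      (by rw [flip_apply (j := 0) _ (by omega) (by omega), splice_of_le _ _ (by omega), hq0,
            h.first])
      (by rw [flip_apply (j := L - K) _ (by omega) (by omega), splice_of_lt _ _ (by omega),
            flip_apply (j := K) _ (by omega) (by omega), h.last]) hlt hle hi0 (by omega) (by omega)
      (by rw [flip_apply (j := i) _ (by omega) (by omega), splice_of_le _ _ (by omega)]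
          simp [hq])
    omega

theorem Defect.adj_right (h : Defect G O L k K f p) (hodd : Odd L)
    (IH : ∀ k' < k, Swap G O L k') {i j : ℕ} (hi0 : 1 < i) (hik : i < k) (hj : j < L)
    (hij : G.Adj (p i) (f j)) : j ≤ K + (k - i) ∧ K ≤ j + (k - i) := by
  have hlt := h.lt
  have hle := h.le
  obtain ⟨j', hj', hjj, he⟩ := exists_flip_eq (i := if j ≤ K then K - j else K + L - j) f
    (show K < L by omega) (by split_ifs <;> omega)
  have hj'j : j' = j := by split_ifs at hjj <;> omega
  subst hj'j
  have := h.reverse.adj_left hodd IH (i := k - i)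
    (j := if j' ≤ K then K - j' else K + L - j') (by omega) (by omega)
    (by split_ifs <;> omega) (by rw [he, show k - (k - i) = i by omega]; exact hij)
  split_ifs at this <;> omega

/-- Otherwise `p 1` could replace `f 0` on the hole, and the rest of `p` would be too short a route
from the new vertex to `f K`. -/
theorem Defect.not_both (h : Defect G O L k K f p) (IH : ∀ k' < k, Swap G O L k')
    (h1 : G.Adj (p 1) (f 1)) (h2 : G.Adj (p 1) (f (L - 1))) : False := by
  have hlt := h.lt
  have hle := h.le
  have h3 := h.three_le
  set q : ℕ → V := fun t => if t = 0 then f (L - 1) else if t = 1 then p 1 else f 1 with hq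
  have hr : Route G O 2 q :=
    ⟨fun i hi => by
      interval_cases i
      · simpa [hq] using h2.symm
      · simpa [hq] using h1,
     fun i hi => by
      interval_cases i
      · simpa [hq] using h.clean.mem _ (by omega)
      · simpa [hq] using h.route.mem 1 (by omega)
      · simpa [hq] using h.clean.mem 1 (by omega)⟩
  have c := ((IH 2 (by omega) (OddHole.rot L (L - 1) f) q 2 (h.clean.rot (by omega)) hr
    (by rw [rot_apply (j := L - 1) _ (by omega) (by omega)]; simp [hq])
    (by rw [rot_apply (j := 1) _ (by omega) (by omega)]; simp [hq]) (by omega) le_rfl).2).rot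
      (a := 1) (by omega)
  refine (h.route.sub 1 (k - 1) (by omega)).false_of_lt IH c (K := K) ?_ ?_ hlt hle (by omega)
  · rw [rot_apply (j := 1) _ (by omega) (by omega), splice_of_le _ _ (by omega)]
    simp [hq]
  · rw [rot_apply (j := K + 1) _ (by omega) (by omega), splice_of_lt _ _ (by omega),
      rot_apply (j := K) _ (by omega) (by omega), ← h.last]
    congr 1
    omega

/-- If `p 1` sees the edge `f (L - 1)`, `f 0`, follow `p` to the next vertex `p i` that has a
neighbour on the hole. The neighbours of `p i` are one vertex, which gives a pyramid with that edge
in its base, or two consecutive vertices, which give a shorter odd hole. -/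
theorem Defect.not_adj_left (h : Defect G O L k K f p) (hG : Setting G L)
    (IH : ∀ k' < k, Swap G O L k') : ¬ G.Adj (p 1) (f (L - 1)) := by
  classical
  intro hadj
  have hlt := h.lt
  have hle := h.le
  have h3 := h.three_le
  have hex : ∃ i, 2 ≤ i ∧ ∃ j < L, G.Adj (p i) (f j) := by
    refine ⟨k - 1, by omega, K, by omega, ?_⟩
    rw [← h.last]
    have := h.route.adj (k - 1) (by omega)
    rwa [show k - 1 + 1 = k by omega] at this
  obtain ⟨h2i, j₀, hj₀, hadj₀⟩ := Nat.find_spec hex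
  have hmin : ∀ t, 2 ≤ t → t < Nat.find hex → ∀ j < L, ¬ G.Adj (p t) (f j) := by
    intro t ht ht' j hj hc
    exact Nat.find_min hex ht' ⟨ht, j, hj, hc⟩
  have hik : Nat.find hex ≤ k - 1 := Nat.find_min' hex (by
    refine ⟨by omega, K, by omega, ?_⟩
    rw [← h.last]
    have := h.route.adj (k - 1) (by omega)
    rwa [show k - 1 + 1 = k by omega] at this)
  generalize Nat.find hex = i at *
  have hL1 : L - 1 < L := by omega
  have hp := h.pathSeq IH
  have h10 : G.Adj (p 1) (f 0) := by rw [← h.first]; exact (h.route.adj 0 (by omega)).symm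
  -- Rotating by `L - 1` moves the edge seen by `p 1` to positions `0` and `1`, so `α = 1`, and
  -- shifts the other positions up by one.
  have hatt : ∀ b β, 1 < b → b + β < L → G.Adj (p i) (OddHole.rot L (L - 1) f b) →
      G.Adj (p i) (OddHole.rot L (L - 1) f (b + β)) →
      (∀ j < L, G.Adj (p i) (f j) → b ≤ j + 1 ∧ j + 1 ≤ b + β) →
      Attached G L (OddHole.rot L (L - 1) f) (i - 1) (fun t => p (1 + t)) 1 b β := by
    intro b β hb hbL hb0 hb1 honly
    refine ⟨hp.sub 1 (i - 1) (by omega), fun t ht j hj => ?_, hb, hbL, ?_, ?_, ?_, ?_,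
      fun t ht j hj ha => ?_⟩
    · obtain ⟨j', hj', -, he⟩ := exists_rot_eq f hL1 hj
      rw [he]; exact h.ne hG.odd IH (by omega) (by omega) hj'
    · rw [rot_apply (j := L - 1) _ hL1 (by omega)]; exact hadj
    · rw [rot_apply (j := 0) _ (by omega) (by omega)]; exact h10
    · rwa [show 1 + (i - 1) = i by omega]
    · rwa [show 1 + (i - 1) = i by omega]
    · obtain ⟨j', hj', hjj, he⟩ := exists_rot_eq f hL1 hj
      rw [he] at ha
      rcases Nat.eq_zero_or_pos t with rfl | ht0
      · left
        have := h.adj_left hG.odd IH (by omega) (by omega) hj' ha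
        by_cases hj1 : j' = 1
        · subst hj1; exact (h.not_both IH ha hadj).elim
        · omega
      · right
        by_cases hti : t = i - 1
        · subst hti
          rw [show 1 + (i - 1) = i by omega] at ha
          have := honly j' hj' ha
          omega
        · exact absurd ha (hmin _ (by omega) (by omega) _ hj')
  have hpyr : ∀ b, 2 < b → b ≤ K + 1 → ¬ Attached G L (OddHole.rot L (L - 1) f) (i - 1)
      (fun t => p (1 + t)) 1 b 0 := by
    intro b hb hbL ha
    exact hG.noPyramid (ha.symm.hasPyramid ((h.clean.hole.rot hL1).rot (by omega)) (by omega)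
      (by omega))
  rcases Nat.lt_or_ge i (k - 1) with hi | hi
  -- Away from both ends of `p`, the bounds `Defect.adj_left` and `Defect.adj_right` leave position
  -- `i` as the only possibility.
  · have huniq : ∀ j < L, G.Adj (p i) (f j) → j = i := by
      intro j hj ha
      have := h.adj_left hG.odd IH (by omega) (by omega) hj ha
      have := h.adj_right hG.odd IH (by omega) (by omega) hj ha
      omega
    have hji := huniq j₀ hj₀ hadj₀
    subst hji
    have hr : OddHole.rot L (L - 1) f (j₀ + 1) = f j₀ := rot_apply _ hj₀ (by omega)
    exact hpyr (j₀ + 1) (by omega) (by omega) (hatt (j₀ + 1) 0 (by omega) (by omega)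
      (by rwa [hr]) (by rwa [Nat.add_zero, hr])
      (fun j hj ha => by have := huniq j hj ha; omega))
  · have hi' : i = k - 1 := by omega
    have hK : G.Adj (p i) (f K) := by
      rw [← h.last, hi']
      have := h.route.adj (k - 1) (by omega)
      rwa [show k - 1 + 1 = k by omega] at this
    have hnear : ∀ j < L, G.Adj (p i) (f j) → j ≤ K + 1 ∧ K ≤ j + 1 := by
      intro j hj ha
      have := h.adj_right hG.odd IH (by omega) (by omega) hj ha
      omega
    have hnb : G.Adj (p i) (f (K - 1)) → ¬ G.Adj (p i) (f (K + 1)) := by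
      intro ha hb
      refine h.reverse.not_both IH ?_ ?_
      · rw [flip_apply (j := K - 1) _ (by omega) (by omega), ← hi']; exact ha
      · rw [flip_apply (j := K + 1) _ (by omega) (by omega), ← hi']; exact hb
    have hr : ∀ j, j + 1 < L → OddHole.rot L (L - 1) f (j + 1) = f j := fun j hj =>
      rot_apply _ (by omega) (by omega)
    have heven : ∀ b, K ≤ b → b ≤ K + 1 → ¬ Attached G L (OddHole.rot L (L - 1) f) (i - 1)
        (fun t => p (1 + t)) 1 b 1 := by
      intro b hb hb' ha
      exact ha.false_of_even (h.clean.hole.rot hL1) hG.odd hG.min (by decide) (by omega)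
        (by omega) (by omega) (by omega)
    by_cases hc1 : G.Adj (p i) (f (K - 1))
    · have := hnb hc1
      have hr' := hr (K - 1) (by omega)
      rw [show K - 1 + 1 = K by omega] at hr'
      refine heven K le_rfl (by omega) (hatt K 1 (by omega) (by omega) (by rwa [hr'])
        (by rwa [hr K (by omega)]) fun j hj ha => ?_)
      have hn := hnear j hj ha
      by_cases hjK : j = K + 1
      · subst hjK; contradiction
      · omega
    by_cases hc2 : G.Adj (p i) (f (K + 1))
    · refine heven (K + 1) (by omega) le_rfl (hatt (K + 1) 1 (by omega) (by omega)
        (by rwa [hr K (by omega)]) (by rwa [hr (K + 1) (by omega)]) fun j hj ha => ?_)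
      have hn := hnear j hj ha
      by_cases hjK : j = K - 1
      · subst hjK; contradiction
      · omega
    · refine hpyr (K + 1) (by omega) (by omega) (hatt (K + 1) 0 (by omega) (by omega)
        (by rwa [hr K (by omega)]) (by rwa [Nat.add_zero, hr K (by omega)]) fun j hj ha => ?_)
      have hn := hnear j hj ha
      by_cases hjK : j = K - 1
      · subst hjK; contradiction
      by_cases hjK : j = K + 1
      · subst hjK; contradiction
      omega

theorem Defect.not_adj_right (h : Defect G O L k K f p) (hG : Setting G L)
    (IH : ∀ k' < k, Swap G O L k') : ¬ G.Adj (p (k - 1)) (f (K + 1)) := by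
  have hlt := h.lt
  have hle := h.le
  have h3 := h.three_le
  have := h.reverse.not_adj_left hG IH
  rwa [flip_apply (j := K + 1) _ (by omega) (by omega)] at this

/-- The hole formed by a route and the longer arc of a clean hole. -/
theorem Defect.far_hole (h : Defect G O L k K f p) (hG : Setting G L)
    (IH : ∀ k' < k, Swap G O L k') :
    HoleSeq G (k + (L - K - 2) + 2) (fun t => if t ≤ k then p t else f (K + 1 + (t - (k + 1)))) := by
  have hlt := h.lt
  have hle := h.le
  have h3 := h.three_le
  have hf := h.clean.hole
  refine HoleSeq.of_paths (q := fun t => f (K + 1 + t)) (h.pathSeq IH)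
    (hf.arc (K + 1) (L - K - 2) (by omega) (by omega)) (fun i hi j hj => ?_) (fun i hi j hj => ?_)
    (by omega)
  · rcases Nat.eq_zero_or_pos i with rfl | hi0
    · rw [h.first]; exact hf.ne _ _ (by omega) (by omega)
    rcases Nat.eq_or_lt_of_le hi with rfl | hik
    · rw [h.last]; exact hf.ne _ _ (by omega) (by omega)
    · exact h.ne hG.odd IH hi0 hik (by omega)
  · rcases Nat.eq_zero_or_pos i with rfl | hi0
    · rw [h.first, hf.adj_iff (by omega) (by omega)]; omega
    rcases Nat.eq_or_lt_of_le hi with rfl | hik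
    · rw [h.last, hf.adj_iff (by omega) (by omega)]; omega
    constructor
    · intro hadj
      exfalso
      have hL : i + 1 < k → K + 1 + j ≤ i ∨ L ≤ K + 1 + j + i := fun hc =>
        h.adj_left hG.odd IH hi0 hc (by omega) hadj
      have hR : 1 < i → K + 1 + j ≤ K + (k - i) ∧ K ≤ K + 1 + j + (k - i) := fun hc =>
        h.adj_right hG.odd IH hc hik (by omega) hadj
      by_cases hi1 : i = 1
      · subst hi1
        have := h.not_adj_left hG IH
        have := hL (by omega)
        rw [show K + 1 + j = L - 1 by omega] at hadj
        contradiction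
      by_cases hi2 : i = k - 1
      · subst hi2
        have := h.not_adj_right hG IH
        have := hR (by omega)
        rw [show K + 1 + j = K + 1 by omega] at hadj
        contradiction
      have := hL (by omega)
      have := hR (by omega)
      omega
    · omega

/-- If `k = K`, the hole of `Defect.far_hole` is the spliced one. If `k < K`, the interior of `p` is
a path attached to the short arc only at its ends: `p 1` sees `f 0` and perhaps `f 1`, and `p (k -
1)` sees `f K` and perhaps `f (K - 1)`. Pieces of equal size give a shorter odd hole, unequal ones a
pyramid. -/
theorem Defect.hole (h : Defect G O L k K f p) (hG : Setting G L)
    (IH : ∀ k' < k, Swap G O L k') : k = K ∧ HoleSeq G L (splice k p f) := by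
  classical
  have hlt := h.lt
  have hle := h.le
  have h3 := h.three_le
  have hf := h.clean.hole
  have hhole := h.far_hole hG IH
  by_cases hkK : k = K
  · subst hkK
    refine ⟨rfl, ?_⟩
    rw [show k + (L - k - 2) + 2 = L by omega] at hhole
    refine hhole.congr fun i hi => ?_
    unfold splice
    split_ifs
    · rfl
    · congr 1; omega
  exfalso
  have hpar : ¬ Odd (k + (L - K - 2) + 2) := fun ho => by
    have := hG.min _ _ hhole ho
    omega
  have hodd := hG.odd
  rw [Nat.odd_iff] at hpar hodd
  have h10 : G.Adj (p 1) (f 0) := by rw [← h.first]; exact (h.route.adj 0 (by omega)).symm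
  have hkK1 : G.Adj (p (k - 1)) (f K) := by
    rw [← h.last]
    have := h.route.adj (k - 1) (by omega)
    rwa [show k - 1 + 1 = k by omega] at this
  obtain ⟨α, hα, hα1, hα2⟩ : ∃ α ≤ 1, G.Adj (p 1) (f α) ∧
      ∀ j < L, G.Adj (p 1) (f j) → j ≤ α := by
    have hn : ∀ j < L, G.Adj (p 1) (f j) → j ≤ 1 := by
      intro j hj ha
      have := h.adj_left hG.odd IH (by omega) (by omega) hj ha
      by_cases hjL : j = L - 1
      · subst hjL; exact absurd ha (h.not_adj_left hG IH)
      · omega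
    by_cases hc : G.Adj (p 1) (f 1)
    · exact ⟨1, le_rfl, hc, hn⟩
    · refine ⟨0, by omega, h10, fun j hj ha => ?_⟩
      have := hn j hj ha
      by_cases hj1 : j = 1
      · subst hj1; contradiction
      · omega
  obtain ⟨β, hβ, hβ1, hβ2⟩ : ∃ β ≤ 1, G.Adj (p (k - 1)) (f (K - β)) ∧
      ∀ j < L, G.Adj (p (k - 1)) (f j) → K ≤ j + β ∧ j ≤ K := by
    have hn : ∀ j < L, G.Adj (p (k - 1)) (f j) → K ≤ j + 1 ∧ j ≤ K := by
      intro j hj ha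
      have := h.adj_right hG.odd IH (by omega) (by omega) hj ha
      by_cases hjL : j = K + 1
      · subst hjL; exact absurd ha (h.not_adj_right hG IH)
      · omega
    by_cases hc : G.Adj (p (k - 1)) (f (K - 1))
    · exact ⟨1, le_rfl, hc, hn⟩
    · refine ⟨0, by omega, hkK1, fun j hj ha => ?_⟩
      have := hn j hj ha
      by_cases hj1 : j = K - 1
      · subst hj1; contradiction
      · omega
  have hatt : Attached G L f (k - 2) (fun t => p (1 + t)) α (K - β) β := by
    refine ⟨(h.pathSeq IH).sub 1 (k - 2) (by omega),
      fun i hi j hj => h.ne hG.odd IH (by omega) (by omega) hj, by omega, by omega, h10, hα1,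
      ?_, ?_, fun i hi j hj ha => ?_⟩
    · rwa [show 1 + (k - 2) = k - 1 by omega]
    · rwa [show 1 + (k - 2) = k - 1 by omega, show K - β + β = K by omega]
    · rcases Nat.eq_zero_or_pos i with rfl | hi0
      · exact Or.inl ⟨rfl, hα2 j hj ha⟩
      by_cases hik : i = k - 2
      · subst hik
        rw [show 1 + (k - 2) = k - 1 by omega] at ha
        have := hβ2 j hj ha
        omega
      -- For an interior vertex of this path the two bounds would need `K - k + i ≤ j ≤ i`,
      -- impossible for `k < K`.
      · have := h.adj_left hG.odd IH (by omega) (by omega) hj ha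
        have := h.adj_right hG.odd IH (by omega) (by omega) hj ha
        omega
  have hcases : (α = 0 ∧ β = 1) ∨ (α = 1 ∧ β = 0) ∨ α = β := by omega
  rcases hcases with ⟨rfl, rfl⟩ | ⟨rfl, rfl⟩ | rfl
  · exact hG.noPyramid (hatt.hasPyramid hf (by omega) (by omega))
  · exact hG.noPyramid (hatt.symm.hasPyramid (hf.rot (by omega)) (by omega) (by omega))
  · exact hatt.false_of_even hf hG.odd hG.min ⟨α, rfl⟩ (by omega) (by omega) (by omega) (by omega)

end SwapStep
end OddHole

namespace OddHole

/-! ### The new hole is clean; completing the induction. -/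

section Cleaning

variable {V : Type*} {G : SimpleGraph V} {O : Set V} {L k : ℕ} {f p : ℕ → V}

theorem swap_zero : Swap G O L 0 := by
  intro f p K hf _ h0 hK hK2 _
  have hK0 : (0 : ℕ) = K := hf.hole.eq_of_eq (by omega) (by omega) (by rw [← h0, hK])
  refine ⟨hK0, hf.congr fun i hi => ?_⟩
  rcases Nat.eq_zero_or_pos i with rfl | h
  · rw [splice_of_le _ _ le_rfl, h0]
  · rw [splice_of_lt _ _ h]

theorem swap_one : Swap G O L 1 := by
  intro f p K hf hp h0 hK hK2 hkK
  have h4 := hf.hole.four_le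
  have hadj := hp.adj 0 (by omega)
  rw [h0, hK, hf.hole.adj_iff (by omega) (by omega)] at hadj
  have hK1 : K = 1 := by omega
  subst hK1
  refine ⟨rfl, hf.congr fun i hi => ?_⟩
  rcases Nat.lt_or_ge 1 i with h | h
  · rw [splice_of_lt _ _ h]
  · rw [splice_of_le _ _ h]
    interval_cases i
    · exact h0
    · exact hK

/-- The middle vertex `p 1` is minor and sees `f 0` and `f K`, so `K = 2` and its neighbours on the
hole lie among `f 0`, `f 1`, `f 2`. It can therefore take the place of `f 1`. -/
theorem holeSwap_two (hodd : Odd L) (IH : ∀ k' < 2, Swap G O L k') : HoleSwap G O L 2 := by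
  intro f p K hf hp h0 hK hK2 hkK
  by_cases hmem : ∃ j < L, p 1 = f j
  · obtain ⟨j, hj, hpj⟩ := hmem
    obtain ⟨-, h1, h2⟩ := hp.swap_of_mem hodd IH hf h0 hK hK2 hkK one_pos one_lt_two hj hpj
    exact ⟨h1, h2.hole⟩
  have hne : ∀ j < L, p 1 ≠ f j := fun j hj h => hmem ⟨j, hj, h⟩
  obtain ⟨c, hc, hmin⟩ := hf.minor (p 1) (hp.mem 1 (by omega))
  have a0 := hp.adj 0 (by omega)
  have a1 := hp.adj 1 (by omega)
  rw [h0] at a0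
  rw [hK] at a1
  have m0 := hmin 0 (by omega) a0.symm
  have m1 := hmin K (by omega) a1
  have hK2' : K = 2 := by omega
  subst hK2'
  have hc1 : c = 1 := by omega
  subst hc1
  refine ⟨rfl, ?_⟩
  have hhole := HoleSeq.of_paths (q := fun t => f (3 + t)) (hp.pathSeq IH hf h0 hK hK2 hkK)
    (hf.hole.arc 3 (L - 4) (by omega) (by omega)) (fun i hi j hj => ?_) (fun i hi j hj => ?_)
    (by omega)
  · rw [show 2 + (L - 4) + 2 = L by omega] at hhole
    refine hhole.congr fun i hi => ?_
    unfold splice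
    split_ifs
    · rfl
    · congr 1; omega
  · interval_cases i
    · rw [h0]; exact hf.hole.ne _ _ (by omega) (by omega)
    · exact hne _ (by omega)
    · rw [hK]; exact hf.hole.ne _ _ (by omega) (by omega)
  · interval_cases i
    · rw [h0, hf.hole.adj_iff (by omega) (by omega)]; omega
    · constructor
      · intro hadj
        have := hmin (3 + j) (by omega) hadj
        omega
      · omega
    · rw [hK, hf.hole.adj_iff (by omega) (by omega)]; omega

/-- If a vertex sees no vertex of the longer arc, it is minor for the new hole. -/
theorem Route.minor_splice_of_far {y : V} (hp : Route G O k p) (IH : ∀ k' < k, Swap G O L k')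
    (hf : Clean G O L f) (h0 : p 0 = f 0) (hK : p k = f k) (hk2 : 2 * k < L) (hk : 1 ≤ k)
    (hy : y ∈ O) (hfar : ∀ j, k < j → j < L → ¬ G.Adj y (f j)) :
    Minor G L (splice k p f) y := by
  classical
  by_cases hex : ∃ a, a ≤ k ∧ G.Adj y (p a)
  · obtain ⟨hak, hay⟩ := Nat.find_spec hex
    refine ⟨Nat.find hex + 1, by omega, fun j hj hadj => ?_⟩
    rcases Nat.lt_or_ge k j with h | h
    · rw [splice_of_lt _ _ h] at hadj
      exact absurd hadj (hfar j h hj)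
    · rw [splice_of_le _ _ h] at hadj
      have := hp.near IH hf h0 hK hk2 le_rfl hy hay hadj h
      have := Nat.find_min' hex ⟨h, hadj⟩
      omega
  · refine ⟨0, by omega, fun j hj hadj => ?_⟩
    rcases Nat.lt_or_ge k j with h | h
    · rw [splice_of_lt _ _ h] at hadj
      exact absurd hadj (hfar j h hj)
    · rw [splice_of_le _ _ h] at hadj
      exact absurd ⟨j, h, hadj⟩ hex

/-- If a vertex sees no interior vertex of the route, it is minor for the new hole. -/
theorem Clean.minor_splice_of_interior {y : V} (hf : Clean G O L f) (h0 : p 0 = f 0)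
    (hK : p k = f k) (hy : y ∈ O) (hint : ∀ i, 0 < i → i < k → ¬ G.Adj y (p i)) :
    Minor G L (splice k p f) y := by
  obtain ⟨c, hc, hmin⟩ := hf.minor y hy
  refine ⟨c, hc, fun j hj hadj => hmin j hj ?_⟩
  rcases Nat.lt_or_ge k j with h | h
  · rwa [splice_of_lt _ _ h] at hadj
  · rw [splice_of_le _ _ h] at hadj
    rcases Nat.eq_zero_or_pos j with rfl | hj0
    · rwa [← h0]
    rcases Nat.eq_or_lt_of_le h with rfl | hjk
    · rwa [← hK]
    · exact absurd hadj (hint j hj0 hjk)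

theorem Route.mem_splice {j : ℕ} (hp : Route G O k p) (hf : Clean G O L f) (hj : j < L) :
    splice k p f j ∈ O := by
  rcases Nat.lt_or_ge k j with h | h
  · rw [splice_of_lt _ _ h]; exact hf.mem j hj
  · rw [splice_of_le _ _ h]; exact hp.mem j h

/-- The jewel is formed by `f 0`, `f 1`, `f 2`, `y`, `x`, with the path from `f 0` backwards along
the hole to `f 4` and then to `y`. -/
theorem HoleSeq.hasJewel {x y : V} (hf : HoleSeq G L f) (hL : 5 ≤ L) (hx : ∀ j < L, x ≠ f j)
    (hy : ∀ j < L, y ≠ f j) (hx0 : G.Adj x (f 0)) (hx2 : ∀ j, 2 < j → j < L → ¬ G.Adj x (f j))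
    (hxy : G.Adj x y) (hy0 : ¬ G.Adj y (f 0)) (hy1 : ¬ G.Adj y (f 1)) (hy2 : G.Adj y (f 2))
    (hy4 : G.Adj y (f 4)) : HasJewel G := by
  obtain ⟨w, -, hs, -, hpath⟩ := exists_walk_of_seq (G := G) (u := f 0) (v := y)
    (fun t => if t = 0 then f 0 else if t ≤ L - 4 then f (L - t) else y) (L - 3)
    (fun i hi => by
      rw [if_neg (by omega : ¬ i + 1 = 0)]
      by_cases h0 : i = 0
      · rw [if_pos h0, if_pos (by omega), hf.adj_iff (by omega) (by omega)]; omega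
      · rw [if_neg h0, if_pos (by omega : i ≤ L - 4)]
        by_cases hi4 : i + 1 ≤ L - 4
        · rw [if_pos hi4, hf.adj_iff (by omega) (by omega)]; omega
        · rw [if_neg hi4, show L - i = 4 by omega]; exact hy4.symm)
    (by simp) (by rw [if_neg (by omega), if_neg (by omega)])
  have hsupp : ∀ z ∈ w.support, z = f 0 ∨ z = y ∨ ∃ j, 4 ≤ j ∧ j < L ∧ z = f j := by
    intro z hz
    obtain ⟨t, ht, rfl⟩ := (hs z).1 hz
    split_ifs
    · exact Or.inl rfl
    · exact Or.inr (Or.inr ⟨L - t, by omega, by omega, rfl⟩)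
    · exact Or.inr (Or.inl rfl)
  have hadj : ∀ i j, i < L → j < L → (G.Adj (f i) (f j) ↔
      j = i + 1 ∨ i = j + 1 ∨ (i = 0 ∧ j + 1 = L) ∨ (j = 0 ∧ i + 1 = L)) :=
    fun i j hi hj => hf.adj_iff hi hj
  refine ⟨f 0, f 1, f 2, y, x, w, ?_, ?_, ?_, hy2.symm, hxy.symm, hx0, ?_, ?_, ?_, ?_, ?_, ?_⟩
  · simp only [List.nodup_cons, List.mem_cons, List.not_mem_nil, or_false, not_or,
      not_false_eq_true, List.nodup_nil, and_true]
    exact ⟨⟨hf.ne _ _ (by omega) (by omega), hf.ne _ _ (by omega) (by omega),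
      (hy _ (by omega)).symm, (hx _ (by omega)).symm⟩, ⟨hf.ne _ _ (by omega) (by omega),
      (hy _ (by omega)).symm, (hx _ (by omega)).symm⟩, ⟨(hy _ (by omega)).symm,
      (hx _ (by omega)).symm⟩, hxy.ne.symm⟩
  · rw [hadj _ _ (by omega) (by omega)]; omega
  · rw [hadj _ _ (by omega) (by omega)]; omega
  · rw [hadj _ _ (by omega) (by omega)]; omega
  · rwa [G.adj_comm]
  · rwa [G.adj_comm]
  · refine hpath fun i j hij hj => ?_
    rw [if_neg (by omega : ¬ j = 0)]
    split_ifs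
    · exact hf.ne _ _ (by omega) (by omega)
    · exact (hy _ (by omega)).symm
    · intro h
      have := hf.eq_of_eq (by omega) (by omega) h
      omega
    · exact (hy _ (by omega)).symm
    · omega
    · omega
  · intro hc
    rcases hsupp x hc with h | h | ⟨j, -, hj, h⟩
    · exact hx 0 (by omega) h
    · exact hxy.ne h
    · exact hx j hj h
  · intro z hz hz0 hzy
    rcases hsupp z hz with h | h | ⟨j, hj4, hj, rfl⟩
    · exact absurd h hz0
    · exact absurd h hzy
    · rw [hadj _ _ (by omega) hj, hadj _ _ (by omega) hj]
      exact ⟨by omega, by omega, hx2 j (by omega) hj⟩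

/-- Only a vertex `y` that sees both `p 1` and the long arc could be major for the new hole. If `y`
also sees `f 0` or `f 2`, its old neighbours span only three vertices; either the new ones still do,
or there is a jewel. Otherwise its neighbours on the new hole are `p 1` and a cluster on the long
arc, and `Setting.minor_of_clusters` applies. -/
theorem Setting.swap_two (hG : Setting G L) : Swap G O L 2 := by
  classical
  have IH : ∀ k' < 2, Swap G O L k' := by
    intro k' hk'
    interval_cases k'
    · exact swap_zero
    · exact swap_one
  intro f p K hf hp h0 hK hK2 hkK
  by_cases hmem : ∃ j < L, p 1 = f j
  · obtain ⟨j, hj, hpj⟩ := hmem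
    exact (hp.swap_of_mem hG.odd IH hf h0 hK hK2 hkK one_pos one_lt_two hj hpj).2
  have hne : ∀ j < L, p 1 ≠ f j := fun j hj h => hmem ⟨j, hj, h⟩
  obtain ⟨rfl, hh⟩ := holeSwap_two hG.odd IH f p K hf hp h0 hK hK2 hkK
  refine ⟨rfl, hh, fun i hi => hp.mem_splice hf hi, fun y hy => ?_⟩
  by_cases hyh : ∃ j < L, splice 2 p f j = y
  · obtain ⟨j, hj, rfl⟩ := hyh
    exact hh.minor hj
  have hys : ∀ j < L, y ≠ splice 2 p f j := fun j hj h => hyh ⟨j, hj, h.symm⟩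
  by_cases hfar : ∀ j, 2 < j → j < L → ¬ G.Adj y (f j)
  · exact hp.minor_splice_of_far IH hf h0 hK hK2 (by omega) hy hfar
  by_cases hint : ∀ i, 0 < i → i < 2 → ¬ G.Adj y (p i)
  · exact hf.minor_splice_of_interior h0 hK hy hint
  have hyx : G.Adj y (p 1) := by
    by_contra hc
    refine hint fun i hi hi2 => ?_
    rwa [show i = 1 by omega]
  have hex : ∃ w, 2 < w ∧ w < L ∧ G.Adj y (f w) := by
    by_contra hc
    exact hfar fun j h1 h2 h3 => hc ⟨j, h1, h2, h3⟩
  have hsp : ∀ j < L, j ≠ 1 → splice 2 p f j = f j := by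
    intro j hj hj1
    rcases Nat.lt_or_ge 2 j with h | h
    · rw [splice_of_lt _ _ h]
    · rw [splice_of_le _ _ h]
      interval_cases j
      · exact h0
      · contradiction
      · exact hK
  have hsp1 : splice 2 p f 1 = p 1 := splice_of_le _ _ (by omega)
  have hxadj : ∀ j, 2 < j → j < L → ¬ G.Adj (p 1) (f j) := by
    intro j hj hjL ha
    have := (hh.adj_iff (i := 1) (by omega) hjL).1 (by rwa [hsp1, hsp j hjL (by omega)])
    omega
  have hx0 : G.Adj (p 1) (f 0) := by rw [← h0]; exact (hp.adj 0 (by omega)).symm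
  have hx2 : G.Adj (p 1) (f 2) := by rw [← hK]; exact hp.adj 1 (by omega)
  have hyf : ∀ j < L, y ≠ f j := by
    intro j hj
    by_cases hj1 : j = 1
    · rintro rfl
      obtain ⟨w, h1, h2, h3⟩ := hex
      rw [hf.hole.adj_iff hj h2] at h3
      omega
    · rw [← hsp j hj hj1]; exact hys j hj
  obtain ⟨c, hc, hmin⟩ := hf.minor y hy
  by_cases hy0 : G.Adj y (f 0)
  · have m0 := hmin 0 (by omega) hy0
    obtain ⟨w, h1, h2, h3⟩ := hex
    have m1 := hmin w h2 h3
    have hy2 : ¬ G.Adj y (f 2) := fun ha => by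
      have := hmin 2 (by omega) ha
      omega
    by_cases hy4 : G.Adj y (f (L - 2))
    · have m2 := hmin _ (by omega) hy4
      have hy1 : ¬ G.Adj y (f 1) := fun ha => by
        have := hmin 1 (by omega) ha
        omega
      -- Reading the hole backwards from `f 2` sends positions `0`, `2`, `4` to `f 2`, `f 0`, `f (L
      -- - 2)`, as needed for the jewel.
      refine absurd ((hf.hole.flip (a := 2) (by omega)).hasJewel (x := p 1) (y := y) (by omega)
        (fun j hj => ?_) (fun j hj => ?_) ?_ (fun j hj hjL => ?_) hyx.symm ?_ ?_ ?_ ?_) hG.noJewel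
      · obtain ⟨j', hj', -, he⟩ := exists_flip_eq f (show 2 < L by omega) hj
        rw [he]; exact hne j' hj'
      · obtain ⟨j', hj', -, he⟩ := exists_flip_eq f (show 2 < L by omega) hj
        rw [he]; exact hyf j' hj'
      · rwa [flip_apply (j := 2) _ (by omega) (by omega)]
      · obtain ⟨j', hj', hjj, he⟩ := exists_flip_eq f (show 2 < L by omega) hjL
        rw [he]; exact hxadj j' (by omega) hj'
      · rwa [flip_apply (j := 2) _ (by omega) (by omega)]
      · rwa [flip_apply (j := 1) _ (by omega) (by omega)]
      · rwa [flip_apply (j := 0) _ (by omega) (by omega)]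
      · rwa [flip_apply (j := L - 2) _ (by omega) (by omega)]
    · refine ⟨0, by omega, fun j hj ha => ?_⟩
      by_cases hj1 : j = 1
      · omega
      rw [hsp j hj hj1] at ha
      have := hmin j hj ha
      by_cases hj2 : j = 2
      · subst hj2; contradiction
      by_cases hj2 : j = L - 2
      · subst hj2; contradiction
      omega
  by_cases hy2 : G.Adj y (f 2)
  · have m0 := hmin 2 (by omega) hy2
    obtain ⟨w, h1, h2, h3⟩ := hex
    have m1 := hmin w h2 h3
    by_cases hy4 : G.Adj y (f 4)
    · have m2 := hmin _ (by omega) hy4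
      have hy1 : ¬ G.Adj y (f 1) := fun ha => by
        have := hmin 1 (by omega) ha
        omega
      exact absurd (hf.hole.hasJewel (by omega) hne hyf hx0 hxadj hyx.symm hy0 hy1 hy2 hy4)
        hG.noJewel
    · refine ⟨2, by omega, fun j hj ha => ?_⟩
      by_cases hj1 : j = 1
      · omega
      rw [hsp j hj hj1] at ha
      have := hmin j hj ha
      by_cases hj2 : j = 0
      · subst hj2; contradiction
      by_cases hj2 : j = 4
      · subst hj2; contradiction
      omega
  obtain ⟨hb2, hbL, hyb⟩ := Nat.find_spec hex
  have hbmin : ∀ j, 2 < j → j < L → G.Adj y (f j) → Nat.find hex ≤ j := fun j h1 h2 h3 =>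
    Nat.find_min' hex ⟨h1, h2, h3⟩
  generalize Nat.find hex = b at *
  have mb := hmin b hbL hyb
  have hrange : ∀ j, 2 < j → j < L → G.Adj y (f j) → b ≤ j ∧ j ≤ b + 2 := by
    intro j h1 h2 h3
    have := hmin j h2 h3
    have := hbmin j h1 h2 h3
    omega
  obtain ⟨β, hβ, hβL, hyβ, hβmax⟩ : ∃ β ≤ 2, b + β < L ∧ G.Adj y (f (b + β)) ∧
      ∀ j, 2 < j → j < L → G.Adj y (f j) → b ≤ j ∧ j ≤ b + β := by
    by_cases c2 : b + 2 < L ∧ G.Adj y (f (b + 2))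
    · exact ⟨2, le_rfl, c2.1, c2.2, hrange⟩
    by_cases c1 : b + 1 < L ∧ G.Adj y (f (b + 1))
    · refine ⟨1, by omega, c1.1, c1.2, fun j h1 h2 h3 => ?_⟩
      have := hrange j h1 h2 h3
      by_cases hj : j = b + 2
      · subst hj; exact absurd ⟨h2, h3⟩ c2
      · omega
    · refine ⟨0, by omega, hbL, hyb, fun j h1 h2 h3 => ?_⟩
      have := hrange j h1 h2 h3
      by_cases hj : j = b + 2
      · subst hj; exact absurd ⟨h2, h3⟩ c2
      by_cases hj : j = b + 1
      · subst hj; exact absurd ⟨h2, h3⟩ c1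
      · omega
  refine hG.minor_of_clusters (a := 1) (α := 0) (b := b) (β := β) hh hys (by omega) (by omega) hβL
    (by rwa [hsp1]) (by rwa [Nat.add_zero, hsp1]) (by rwa [hsp b hbL (by omega)])
    (by rwa [hsp _ hβL (by omega)]) (fun j hj ha => ?_) (by omega)
  by_cases hj1 : j = 1
  · omega
  rw [hsp j hj hj1] at ha
  by_cases hj0 : j = 0
  · subst hj0; contradiction
  by_cases hj2 : j = 2
  · subst hj2; contradiction
  have := hβmax j (by omega) hj ha
  omega

/-- The hole is given, and only a vertex `y` seeing both the interior of the route and the long arc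
could be major. Replacing a vertex of the route, or of the long arc, by `y` shows that `y` has no
two neighbours at distance two on either side. So its neighbours on each side are at most two
consecutive vertices. If `y` sees an end of the route, it is minor with that end as centre; if not,
the two clusters are handled by `Setting.minor_of_clusters`. -/
theorem Setting.swap_of_holeSwap (hG : Setting G L) (hk : 3 ≤ k) (IH : ∀ k' < k, Swap G O L k')
    (H : HoleSwap G O L k) : Swap G O L k := by
  classical
  intro f p K hf hp h0 hK hK2 hkK
  obtain ⟨rfl, hh⟩ := H f p K hf hp h0 hK hK2 hkK
  refine ⟨rfl, hh, fun i hi => hp.mem_splice hf hi, fun y hy => ?_⟩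
  by_cases hyh : ∃ j < L, splice k p f j = y
  · obtain ⟨j, hj, rfl⟩ := hyh
    exact hh.minor hj
  have hys : ∀ j < L, y ≠ splice k p f j := fun j hj h => hyh ⟨j, hj, h.symm⟩
  by_cases hfar : ∀ j, k < j → j < L → ¬ G.Adj y (f j)
  · exact hp.minor_splice_of_far IH hf h0 hK hK2 (by omega) hy hfar
  by_cases hint : ∀ i, 0 < i → i < k → ¬ G.Adj y (p i)
  · exact hf.minor_splice_of_interior h0 hK hy hint
  push Not at hfar hint
  obtain ⟨w₀, hkw₀, hw₀L, hyw₀⟩ := hfar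
  obtain ⟨i₀, hi₀, hi₀k, hyi₀⟩ := hint
  -- With `y` in place of `p (a + 1)` there is another route of length `k`; its spliced hole would
  -- have the chord from `y` to `f w₀`.
  have hA2 : ∀ a, a + 2 ≤ k → G.Adj y (p a) → ¬ G.Adj y (p (a + 2)) := by
    intro a ha h1 h2
    have hr : Route G O k (fun t => if t = a + 1 then y else p t) := by
      refine ⟨fun i hi => ?_, fun i hi => ?_⟩
      · by_cases c1 : i = a
        · subst c1
          simpa using h1.symm
        by_cases c2 : i = a + 1
        · subst c2
          simpa using h2
        · rw [if_neg c2, if_neg (by omega)]; exact hp.adj i hi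
      · split_ifs
        · exact hy
        · exact hp.mem i hi
    have hq := (H f _ k hf hr (by simpa using h0)
      (by rw [if_neg (by omega)]; exact hK) hK2 le_rfl).2
    have := (hq.adj_iff (i := a + 1) (j := w₀) (by omega) hw₀L).1 (by
      rw [splice_of_le _ _ (by omega), splice_of_lt _ _ hkw₀, if_pos rfl]; exact hyw₀)
    omega
  -- With `y` in place of the vertex after `f w`, the old hole stays clean by the induction
  -- hypothesis for `2 < k`. Splicing `p` into it would leave the chord from `y` to `p i₀`. Stating
  -- this with `rot` includes the case `w + 2 = L`, where the second neighbour is `f 0`.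
  have hB2 : ∀ w, k ≤ w → w + 2 ≤ L → G.Adj y (f w) → ¬ G.Adj y (rot L w f 2) := by
    intro w hkw hwL h1 h2
    set q : ℕ → V := fun t => if t = 0 then f w else if t = 1 then y else rot L w f 2 with hq
    have hr : Route G O 2 q :=
      ⟨fun i hi => by
        interval_cases i
        · simpa [hq] using h1.symm
        · simpa [hq] using h2,
       fun i hi => by
        interval_cases i
        · simpa [hq] using hf.mem _ (by omega)
        · simpa [hq] using hy
        · simpa [hq] using (hf.rot (a := w) (by omega)).mem 2 (by omega)⟩
    have c := ((IH 2 (by omega) (OddHole.rot L w f) q 2 (hf.rot (by omega)) hr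
      (by rw [rot_apply (j := w) _ (by omega) (by omega)]; simp [hq])
      (by simp [hq]) (by omega) le_rfl).2).rot (a := L - w) (by omega)
    have hc0 : p 0 = OddHole.rot L (L - w) (splice 2 q (OddHole.rot L w f)) 0 := by
      rw [rot_apply (j := L - w) _ (by omega) (by omega)]
      by_cases hw2 : L - w = 2
      · rw [hw2, splice_of_le _ _ le_rfl]
        simp only [hq]
        rw [rot_apply (j := 0) _ (by omega) (by omega), ← h0]
        rfl
      · rw [splice_of_lt _ _ (by omega), rot_apply (j := 0) _ (by omega) (by omega), h0]
    have hck : p k = OddHole.rot L (L - w) (splice 2 q (OddHole.rot L w f)) k := by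
      rcases Nat.eq_or_lt_of_le hkw with rfl | hlt
      · rw [rot_apply (j := 0) _ (by omega) (by omega), splice_of_le _ _ (by omega), hK]
        rfl
      · rw [rot_apply (j := L - w + k) _ (by omega) (by omega), splice_of_lt _ _ (by omega),
          rot_apply (j := k) _ (by omega) (by omega), hK]
    have hh' := (H _ p k c hp hc0 hck hK2 le_rfl).2
    have := (hh'.adj_iff (i := w + 1) (j := i₀) (by omega) (by omega)).1 (by
      rw [splice_of_lt _ _ (by omega), splice_of_le _ _ (by omega),
        rot_apply (j := 1) _ (by omega) (by omega), splice_of_le _ _ (by omega)]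
      exact hyi₀)
    omega
  have hnear : ∀ a b, a < b → b ≤ k → G.Adj y (p a) → G.Adj y (p b) → b = a + 1 := by
    intro a b hab hbk h1 h2
    have := hp.near IH hf h0 hK hK2 hkK hy h1 h2 hbk
    by_contra hc
    have hb : b = a + 2 := by omega
    subst hb
    exact hA2 a hbk h1 h2
  obtain ⟨c, hc, hmin⟩ := hf.minor y hy
  have hnear' : ∀ a b, k < a → a < b → b < L → G.Adj y (f a) → G.Adj y (f b) → b = a + 1 := by
    intro a b hka hab hbL h1 h2
    have m1 := hmin a (by omega) h1
    have m2 := hmin b hbL h2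
    by_contra hc
    have hb : b = a + 2 := by omega
    subst hb
    refine hB2 a (by omega) (by omega) h1 ?_
    rwa [rot_apply (j := a + 2) _ (by omega) (by omega)]
  by_cases hy0 : G.Adj y (p 0)
  · have hi1 := hnear 0 i₀ hi₀ (by omega) hy0 hyi₀
    refine ⟨0, by omega, fun j hj ha => ?_⟩
    rcases Nat.lt_or_ge k j with h | h
    · rw [splice_of_lt _ _ h] at ha
      have m1 := hmin 0 (by omega) (by rwa [← h0])
      have m2 := hmin j hj ha
      by_cases hj2 : j + 2 = L
      · refine absurd ?_ (hB2 j (by omega) (by omega) ha)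
        rwa [rot_apply (j := 0) _ (by omega) (by omega), ← h0]
      · omega
    · rw [splice_of_le _ _ h] at ha
      rcases Nat.eq_zero_or_pos j with rfl | hj0
      · omega
      · have := hnear 0 j hj0 h hy0 ha
        omega
  by_cases hyk : G.Adj y (p k)
  · have hi1 := hnear i₀ k hi₀k le_rfl hyi₀ hyk
    refine ⟨k, by omega, fun j hj ha => ?_⟩
    rcases Nat.lt_or_ge k j with h | h
    · rw [splice_of_lt _ _ h] at ha
      rw [hK] at hyk
      have m1 := hmin k (by omega) hyk
      have m2 := hmin j hj ha
      by_cases hj2 : j = k + 2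
      · refine absurd ?_ (hB2 k le_rfl (by omega) hyk)
        rwa [rot_apply (j := k + 2) _ (by omega) (by omega), ← hj2]
      · omega
    · rw [splice_of_le _ _ h] at ha
      rcases Nat.eq_or_lt_of_le h with rfl | hjk
      · omega
      · have := hnear j k hjk le_rfl ha hyk
        omega
  obtain ⟨a, α, ha1, hα, haα, hya, hyα, honlyA⟩ : ∃ a α, 0 < a ∧ α ≤ 1 ∧ a + α < k ∧
      G.Adj y (p a) ∧ G.Adj y (p (a + α)) ∧ ∀ j ≤ k, G.Adj y (p j) → a ≤ j ∧ j ≤ a + α := by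
    have hend : ∀ j ≤ k, G.Adj y (p j) → 0 < j ∧ j < k := by
      intro j hj ha
      constructor
      · rcases Nat.eq_zero_or_pos j with rfl | h
        · contradiction
        · exact h
      · rcases Nat.eq_or_lt_of_le hj with rfl | h
        · contradiction
        · exact h
    have hex : ∃ a, a ≤ k ∧ G.Adj y (p a) := ⟨i₀, by omega, hyi₀⟩
    obtain ⟨hak, hya⟩ := Nat.find_spec hex
    have hmn : ∀ j ≤ k, G.Adj y (p j) → Nat.find hex ≤ j := fun j h1 h2 =>
      Nat.find_min' hex ⟨h1, h2⟩
    generalize Nat.find hex = a at *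
    have hae := hend a hak hya
    have hr : ∀ j ≤ k, G.Adj y (p j) → a ≤ j ∧ j ≤ a + 1 := by
      intro j hj ha
      have h1 := hmn j hj ha
      rcases Nat.eq_or_lt_of_le h1 with rfl | h
      · omega
      · have := hnear a j h hj hya ha
        omega
    by_cases hc1 : a + 1 ≤ k ∧ G.Adj y (p (a + 1))
    · exact ⟨a, 1, hae.1, le_rfl, (hend _ hc1.1 hc1.2).2, hya, hc1.2, hr⟩
    · refine ⟨a, 0, hae.1, by omega, hae.2, hya, hya, fun j hj ha => ?_⟩
      have := hr j hj ha
      by_cases hja : j = a + 1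
      · subst hja; exact absurd ⟨hj, ha⟩ hc1
      · omega
  obtain ⟨b, β, hkb, hβ, hbL, hyb, hyβ, honlyB⟩ : ∃ b β, k < b ∧ β ≤ 1 ∧ b + β < L ∧
      G.Adj y (f b) ∧ G.Adj y (f (b + β)) ∧
      ∀ j, k < j → j < L → G.Adj y (f j) → b ≤ j ∧ j ≤ b + β := by
    have hex : ∃ b, k < b ∧ b < L ∧ G.Adj y (f b) := ⟨w₀, hkw₀, hw₀L, hyw₀⟩
    obtain ⟨hkb, hbL, hyb⟩ := Nat.find_spec hex
    have hmn : ∀ j, k < j → j < L → G.Adj y (f j) → Nat.find hex ≤ j := fun j h1 h2 h3 =>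
      Nat.find_min' hex ⟨h1, h2, h3⟩
    generalize Nat.find hex = b at *
    have hr : ∀ j, k < j → j < L → G.Adj y (f j) → b ≤ j ∧ j ≤ b + 1 := by
      intro j hkj hj ha
      have h1 := hmn j hkj hj ha
      rcases Nat.eq_or_lt_of_le h1 with rfl | h
      · omega
      · have := hnear' b j hkb h hj hyb ha
        omega
    by_cases hc1 : b + 1 < L ∧ G.Adj y (f (b + 1))
    · exact ⟨b, 1, hkb, le_rfl, hc1.1, hyb, hc1.2, hr⟩
    · refine ⟨b, 0, hkb, by omega, hbL, hyb, hyb, fun j hkj hj ha => ?_⟩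
      have := hr j hkj hj ha
      by_cases hja : j = b + 1
      · subst hja; exact absurd ⟨hj, ha⟩ hc1
      · omega
  refine hG.minor_of_clusters (a := a) (α := α) (b := b) (β := β) hh hys (by omega) (by omega) hbL
    (by rwa [splice_of_le _ _ (by omega)]) (by rwa [splice_of_le _ _ (by omega)])
    (by rwa [splice_of_lt _ _ (by omega)]) (by rwa [splice_of_lt _ _ (by omega)])
    (fun j hj hadj => ?_) (Or.inl ⟨hα, hβ⟩)
  rcases Nat.lt_or_ge k j with h | h
  · rw [splice_of_lt _ _ h] at hadj
    exact Or.inr (honlyB j h hj hadj)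
  · rw [splice_of_le _ _ h] at hadj
    exact Or.inl (honlyA j h hadj)

/-- In a graph without pyramids and jewels, shortest routes may be swapped into clean shortest odd
holes. -/
theorem Setting.swap (hG : Setting G L) (k : ℕ) : Swap G O L k := by
  induction k using Nat.strong_induction_on with
  | _ k IH =>
    rcases Nat.lt_or_ge k 3 with h | h
    · interval_cases k
      · exact swap_zero
      · exact swap_one
      · exact hG.swap_two
    · refine hG.swap_of_holeSwap h IH fun f p K hf hp h0 hK hK2 hkK => ?_
      by_cases hs : k = K ∧ Clean G O L (splice k p f)
      · exact ⟨hs.1, hs.2.hole⟩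
      · exact Defect.hole ⟨hf, hp, h0, hK, hK2, hkK, h, hs⟩ hG IH

end Cleaning
end OddHole

namespace OddHole

/-! ### From a heavy-cleanable hole to a guess whose shortest paths give a hole. -/

section Completeness

variable {V : Type*} {G : SimpleGraph V}

/-- The vertices that stay after deleting the neighbours of `c₂` and `c₃` other than `c₁`, …,
`c₄`. -/
def Kept (G : SimpleGraph V) (c₁ c₂ c₃ c₄ : V) : Set V :=
  {x | x = c₁ ∨ x = c₄ ∨ x = c₂ ∨ x = c₃ ∨ (¬ G.Adj x c₂ ∧ ¬ G.Adj x c₃)}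

theorem HoleSeq.minor_of_not_isMajor {C : Set V} {L : ℕ} {f : ℕ → V} {x : V}
    (hf : HoleSeq G L f) (hC : ∀ y, y ∈ C ↔ ∃ i < L, f i = y) (hx : ¬ IsMajor G C x) :
    Minor G L f x := by
  simp only [IsMajor, not_not] at hx
  obtain ⟨a, ha, b, hb, c, hc, -, hab, hbc, hall⟩ := hx
  obtain ⟨i, hi, rfl⟩ := (hC a).1 ha
  obtain ⟨t, ht, rfl⟩ := (hC b).1 hb
  obtain ⟨j, hj, rfl⟩ := (hC c).1 hc
  rw [hf.adj_iff hi ht] at hab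
  rw [hf.adj_iff ht hj] at hbc
  refine ⟨t, ht, fun l hl hadj => ?_⟩
  rcases hall (f l) ((hC _).2 ⟨l, hl, rfl⟩) hadj with h | h | h
  · have := hf.eq_of_eq hl hi h; omega
  · have := hf.eq_of_eq hl ht h; omega
  · have := hf.eq_of_eq hl hj h; omega

/-- The hole is rotated so that the heavy edge occupies positions `2 * m - 1` and `2 * m`. Every
major vertex sees an end of that edge and is thus deleted, unless it is one of the four exceptions,
which lie on the hole and so are minor. -/
theorem IsHeavyCleanable.exists_clean {C : Set V} (hP : ¬ HasPyramid G) (hJ : ¬ HasJewel G)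
    (hC : IsShortestOddHole G C) (hH : IsHeavyCleanable G C) :
    ∃ (m : ℕ) (f : ℕ → V), 2 ≤ m ∧ Setting G (2 * m + 1) ∧
      Clean G (Kept G (f 0) (f (2 * m)) (f (2 * m - 1)) (f (2 * m - 2))) (2 * m + 1) f := by
  obtain ⟨⟨hhole, hodd⟩, hmin⟩ := hC
  obtain ⟨u, hu, v, hv, huv, hall⟩ := hH
  obtain ⟨f, hf, hfC⟩ := hhole.exists_holeSeq
  obtain ⟨m, hm⟩ := hodd
  rw [hm] at hf hfC
  have h4 := hf.four_le
  have hG : Setting G (2 * m + 1) := by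
    refine ⟨⟨m, rfl⟩, fun L' g hg hL' => ?_, hP, hJ⟩
    obtain ⟨C', hC', hcard⟩ := hg.isHole
    have := hmin C' ⟨hC', by rwa [hcard]⟩
    omega
  obtain ⟨i, hi, rfl⟩ := (hfC u).1 hu
  obtain ⟨j, hj, rfl⟩ := (hfC v).1 hv
  rw [hf.adj_iff hi hj] at huv
  -- The new start `a` is the position following the later end of the edge, cyclically.
  have key : ∃ a < 2 * m + 1,
      (∀ x, G.Adj x (f i) ∨ G.Adj x (f j) → G.Adj x (rot (2 * m + 1) a f (2 * m)) ∨
        G.Adj x (rot (2 * m + 1) a f (2 * m - 1))) := by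
    by_cases hji : j = i + 1 ∨ (j = 0 ∧ i = 2 * m)
    · obtain ⟨a, ha, haj⟩ : ∃ a < 2 * m + 1, a = j + 1 ∨ (a = 0 ∧ j = 2 * m) := by
        rcases Nat.lt_or_ge (j + 1) (2 * m + 1) with h | h
        · exact ⟨j + 1, h, Or.inl rfl⟩
        · exact ⟨0, by omega, by omega⟩
      refine ⟨a, ha, fun x hx => ?_⟩
      rw [rot_apply (j := j) f hj (by omega), rot_apply (j := i) f hi (by omega)]
      exact hx.symm
    · obtain ⟨a, ha, haj⟩ : ∃ a < 2 * m + 1, a = i + 1 ∨ (a = 0 ∧ i = 2 * m) := by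
        rcases Nat.lt_or_ge (i + 1) (2 * m + 1) with h | h
        · exact ⟨i + 1, h, Or.inl rfl⟩
        · exact ⟨0, by omega, by omega⟩
      refine ⟨a, ha, fun x hx => ?_⟩
      rw [rot_apply (j := i) f hi (by omega), rot_apply (j := j) f hj (by omega)]
      exact hx
  obtain ⟨a, ha, hmaj⟩ := key
  have hg := hf.rot ha
  have hgC : ∀ y, y ∈ C ↔ ∃ i < 2 * m + 1, rot (2 * m + 1) a f i = y := by
    intro y
    rw [hfC]
    constructor
    · rintro ⟨l, hl, rfl⟩
      rcases Nat.lt_or_ge l a with h | h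
      · exact ⟨l + (2 * m + 1) - a, by omega, rot_apply f hl (by omega)⟩
      · exact ⟨l - a, by omega, rot_apply f hl (by omega)⟩
    · rintro ⟨l, hl, rfl⟩
      obtain ⟨l', hl', -, he⟩ := exists_rot_eq f ha hl
      exact ⟨l', hl', he.symm⟩
  refine ⟨m, rot (2 * m + 1) a f, by omega, hG, hg, fun l hl => ?_, fun x hx => ?_⟩
  · by_cases hc : l = 0 ∨ l = 2 * m ∨ l = 2 * m - 1 ∨ l = 2 * m - 2
    · rcases hc with rfl | rfl | rfl | rfl <;> simp [Kept]
    · refine Or.inr (Or.inr (Or.inr (Or.inr ⟨?_, ?_⟩)))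
      · rw [hg.adj_iff hl (by omega)]; omega
      · rw [hg.adj_iff hl (by omega)]; omega
  · rcases hx with rfl | rfl | rfl | rfl | ⟨h1, h2⟩
    · exact hg.minor (by omega)
    · exact hg.minor (by omega)
    · exact hg.minor (by omega)
    · exact hg.minor (by omega)
    · refine hg.minor_of_not_isMajor hgC fun hx => ?_
      rcases hmaj x (hall x hx) with h | h
      · exact h1 h
      · exact h2 h

/-- Both routes end at `f (m - 1)`, halfway between `f 0` and `f (2 * m - 2)`. The first swap leaves
a clean hole with the far half intact, so the second applies to it, read backwards from `f (2 * m -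
2)`. -/
theorem Setting.swap_twice {O : Set V} {m k l : ℕ} {f p q : ℕ → V} (hG : Setting G (2 * m + 1))
    (hf : Clean G O (2 * m + 1) f) (hm : 2 ≤ m) (hp : Route G O k p) (hq : Route G O l q)
    (hp0 : p 0 = f 0) (hpk : p k = f (m - 1)) (hq0 : q 0 = f (2 * m - 2)) (hql : q l = f (m - 1))
    (hk : k < m) (hl : l < m) :
    k + 1 = m ∧ l + 1 = m ∧ HoleSeq G (2 * m + 1) (fun i =>
      if i + 1 < m then p i else if i ≤ 2 * m - 2 then q (2 * m - 2 - i) else f i) := by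
  obtain ⟨hk', c1⟩ := hG.swap k f p (m - 1) hf hp hp0 hpk (by omega) (by omega)
  have hlast : splice k p f (m - 1) = f (m - 1) := by
    rw [splice_of_le _ _ (by omega)]
    rwa [hk'] at hpk
  obtain ⟨hl', c2⟩ := hG.swap l _ q (m - 1) (c1.flip (a := 2 * m - 2) (by omega)) hq
    (by rw [flip_apply (j := 2 * m - 2) _ (by omega) (by omega), hq0,
          splice_of_lt _ _ (by omega)])
    (by rw [flip_apply (j := m - 1) _ (by omega) (by omega), hlast, hql]) (by omega) (by omega)
  refine ⟨by omega, by omega, (c2.flip (a := 2 * m - 2) (by omega)).hole.congr fun i hi => ?_⟩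
  split_ifs with h1 h2
  · rw [flip_apply (j := 2 * m - 2 - i) _ (by omega) (by omega), splice_of_lt _ _ (by omega),
      flip_apply (j := i) _ (by omega) (by omega), splice_of_le _ _ (by omega)]
  · rw [flip_apply (j := 2 * m - 2 - i) _ (by omega) (by omega), splice_of_le _ _ (by omega)]
  · rw [flip_apply (j := 2 * m - 2 + (2 * m + 1) - i) _ (by omega) (by omega),
      splice_of_lt _ _ (by omega), flip_apply (j := i) _ (by omega) (by omega),
      splice_of_lt _ _ (by omega)]

end Completeness
end OddHole

namespace OddHole

/-! ### Rules for total correctness with a time bound. -/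

section Machine

@[simp] theorem Memory.reg_setReg (m : Memory) (x v y : ℕ) :
    (m.setReg x v).reg y = if y = x then v else m.reg y := by
  simp [Memory.setReg, Function.update_apply]

@[simp] theorem Memory.arr_setReg (m : Memory) (x v : ℕ) : (m.setReg x v).arr = m.arr := rfl

@[simp] theorem Memory.reg_setArr (m : Memory) (a i v : ℕ) : (m.setArr a i v).reg = m.reg := rfl

@[simp] theorem Memory.arr_setArr (m : Memory) (a i v b : ℕ) :
    (m.setArr a i v).arr b = if b = a then Function.update (m.arr a) i v else m.arr b := by
  simp [Memory.setArr, Function.update_apply]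

/-- Started in `m`, the program `p` halts after at most `T` steps in a memory that satisfies `Q`. -/
def Run (W : ℕ) (p : Program) (m : Memory) (T : ℕ) (Q : Memory → Prop) : Prop :=
  ∃ m' t, Exec W p m m' t ∧ t ≤ T ∧ Q m'

variable {W T T' : ℕ} {p q : Program} {m : Memory} {Q Q' : Memory → Prop} {e : Expr}

theorem Run.mono (h : Run W p m T Q) (hT : T ≤ T') (hQ : ∀ m', Q m' → Q' m') :
    Run W p m T' Q' := by
  obtain ⟨m', t, h1, h2, h3⟩ := h
  exact ⟨m', t, h1, h2.trans hT, hQ m' h3⟩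

theorem Run.assign {x : ℕ} (he : e.Fits W m) (hQ : Q (m.setReg x (e.val m))) :
    Run W (.assign x e) m (e.cost + 1) Q :=
  ⟨_, _, .assign m x e he, le_rfl, hQ⟩

theorem Run.store {a : ℕ} {i : Expr} (hi : i.Fits W m) (he : e.Fits W m)
    (hQ : Q (m.setArr a (i.val m) (e.val m))) :
    Run W (.store a i e) m (i.cost + e.cost + 1) Q :=
  ⟨_, _, .store m a i e hi he, le_rfl, hQ⟩

theorem Run.seq (h : Run W p m T (fun m' => Run W q m' T' Q)) :
    Run W (.seq p q) m (T + T') Q := by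
  obtain ⟨m', t, h1, h2, m'', t', h3, h4, h5⟩ := h
  exact ⟨m'', t + t', .seq h1 h3, by omega, h5⟩

/-- Run `p` if the value of `e` is not zero. -/
def Program.when (e : Expr) (p : Program) : Program := .ite e p .skip

theorem Run.when (he : e.Fits W m) (h1 : e.val m ≠ 0 → Run W p m T Q) (h0 : e.val m = 0 → Q m) :
    Run W (.when e p) m (e.cost + 2 + T) Q := by
  by_cases h : e.val m = 0
  · exact ⟨m, _, .iteFalse he h (.skip m), by omega, h0 h⟩
  · obtain ⟨m', t, h2, h3, h4⟩ := h1 h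
    exact ⟨m', _, .iteTrue he h h2, by omega, h4⟩

/-- Run `p` with register `x` counting from zero up to the value of `e`. -/
def Program.forLoop (x : ℕ) (e : Expr) (p : Program) : Program :=
  .seq (.assign x (.const 0)) (.loop (.op .lt (.reg x) e)
    (.seq p (.assign x (.op .add (.reg x) (.const 1)))))

/-- The counter is written outside the body, so the invariant has to survive any write to it. The
bound `e` is evaluated anew at every test, so it must keep the value `N`. -/
theorem Run.forLoop {x N : ℕ} (I : ℕ → Memory → Prop) (hW : N + 1 < W)
    (hset : ∀ i m v, I i m → I i (m.setReg x v)) (h0 : I 0 m)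
    (he : ∀ i m v, v ≤ N → I i m → e.Fits W (m.setReg x v) ∧ e.val (m.setReg x v) = N)
    (hbody : ∀ i < N, ∀ m, m.reg x = i → I i m →
      Run W p m T (fun m' => m'.reg x = i ∧ I (i + 1) m'))
    (hQ : ∀ m, I N m → Q m) :
    Run W (.forLoop x e p) m ((N + 1) * (T + e.cost + 8)) Q := by
  have he' : ∀ i m, m.reg x ≤ N → I i m → e.Fits W m ∧ e.val m = N := by
    intro i m hx hI
    have : m.setReg x (m.reg x) = m := by
      simp [Memory.setReg]
    have h := he i m (m.reg x) hx hI
    rwa [this] at h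
  have key : ∀ d i m, i + d = N → m.reg x = i → I i m →
      Run W (.loop (.op .lt (.reg x) e) (.seq p (.assign x (.op .add (.reg x) (.const 1))))) m
        (d * (T + e.cost + 7) + e.cost + 3) Q := by
    intro d
    induction d with
    | zero =>
      intro i m hi hx hI
      obtain ⟨h1, h2⟩ := he' i m (by omega) hI
      refine ⟨m, _, .loopFalse ⟨?_, h1, ?_⟩ ?_, ?_, hQ m ?_⟩
      · change m.reg x < W; omega
      · simp only [Op.apply]; split_ifs <;> omega
      · simp only [Expr.val, Op.apply, h2, hx]; rw [if_neg (by omega)]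
      · simp only [Expr.cost]; omega
      · rwa [show N = i by omega]
    | succ d ih =>
      intro i m hi hx hI
      obtain ⟨h1, h2⟩ := he' i m (by omega) hI
      obtain ⟨m₁, t₁, hb1, hb2, hb3, hb4⟩ := hbody i (by omega) m hx hI
      obtain ⟨m₂, t₂, hc1, hc2, hc3⟩ := ih (i + 1) (m₁.setReg x (i + 1)) (by omega) (by simp)
        (hset _ _ _ hb4)
      have hs : Exec W (.assign x (.op .add (.reg x) (.const 1))) m₁ (m₁.setReg x (i + 1)) 4 := by
        have := Exec.assign (W := W) m₁ x (.op .add (.reg x) (.const 1))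
          ⟨by change m₁.reg x < W; omega, by change 1 < W; omega, by
            simp only [Op.apply, Expr.val, hb3]; omega⟩
        simpa only [Op.apply, Expr.val, hb3, Expr.cost] using this
      refine ⟨m₂, _, .loopTrue ⟨?_, h1, ?_⟩ ?_ (.seq hb1 hs) hc1, ?_, hc3⟩
      · change m.reg x < W; omega
      · simp only [Op.apply]; split_ifs <;> omega
      · simp only [Expr.val, Op.apply, h2, hx]; rw [if_pos (by omega)]; simp
      · simp only [Expr.cost]
        have : (d + 1) * (T + e.cost + 7) = d * (T + e.cost + 7) + (T + e.cost + 7) := by ring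
        omega
  obtain ⟨m', t, h1, h2, h3⟩ := key N 0 (m.setReg x 0) (by omega) (by simp) (hset _ _ _ h0)
  refine ⟨m', _, .seq (.assign m x (.const 0) (by change 0 < W; omega)) h1, ?_, h3⟩
  have : (N + 1) * (T + e.cost + 8) = N * (T + e.cost + 7) + N + (T + e.cost + 8) := by ring
  simp only [Expr.cost]
  omega

theorem Expr.val_eq_le (a b : Expr) : (Expr.op .eq a b).val m ≤ 1 := by
  simp only [Expr.val, Op.apply]
  split_ifs <;> omega

theorem Expr.fits_eq {a b : Expr} (ha : a.Fits W m) (hb : b.Fits W m) (hW : 1 < W) :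
    (Expr.op .eq a b).Fits W m :=
  ⟨ha, hb, (Expr.val_eq_le a b).trans_lt hW⟩

end Machine

/-! ### Layered search -/

section Layers

/-- The state of a breadth-first search from `d`: labels `D` (one more than the distance, zero for
vertices not reached) and parents `P`. All vertices with labels below `r` have been processed, and
of those with label `r` the vertices before `a`, and `a` itself for neighbours before `b`. -/
structure Layers (n : ℕ) (A : ℕ → ℕ → Prop) (S : ℕ → Prop) (d r a b : ℕ) (D P : ℕ → ℕ) :
    Prop where
  root : D d = 1
  eq_root : ∀ x < n, D x = 1 → x = d
  le : ∀ x < n, D x ≤ r + 1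
  parent : ∀ y < n, 2 ≤ D y → S y ∧ P y < n ∧ A (P y) y ∧ D (P y) + 1 = D y
  closed : ∀ x < n, D x ≠ 0 → D x < r → ∀ y < n, S y → A x y → D y ≠ 0 ∧ D y ≤ D x + 1
  current : ∀ x < n, D x = r → ∀ y < n, (x < a ∨ (x = a ∧ y < b)) → S y → A x y → D y ≠ 0

variable {n d r a b : ℕ} {A : ℕ → ℕ → Prop} {S : ℕ → Prop} {D P : ℕ → ℕ}

theorem Layers.init (h0 : ∀ x < n, x ≠ d → D x = 0) (h1 : D d = 1) :
    Layers n A S d 1 0 0 D P where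
  root := h1
  eq_root x hx h := by
    by_contra hne
    have := h0 x hx hne
    omega
  le x hx := by
    by_cases h : x = d
    · subst h; omega
    · have := h0 x hx h; omega
  parent y hy h := by
    by_cases h' : y = d
    · subst h'; omega
    · have := h0 y hy h'; omega
  closed x hx h h' := by omega
  current x hx h y hy h' := by omega

theorem Layers.next_row (h : Layers n A S d r a n D P) : Layers n A S d r (a + 1) 0 D P :=
  { h with current := fun x hx hr y hy hc => h.current x hx hr y hy (by omega) }

theorem Layers.next_round (h : Layers n A S d r n 0 D P) : Layers n A S d (r + 1) 0 0 D P where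
  root := h.root
  eq_root := h.eq_root
  le x hx := by have := h.le x hx; omega
  parent := h.parent
  closed x hx h0 hr y hy hS hA := by
    rcases Nat.lt_or_ge (D x) r with hlt | hge
    · exact h.closed x hx h0 hlt y hy hS hA
    · have := h.current x hx (by omega) y hy (by omega) hS hA
      have := h.le y hy
      exact ⟨by assumption, by omega⟩
  current x hx hr y hy hc := by omega

theorem Layers.skip (h : Layers n A S d r a b D P)
    (hno : ¬ (D a = r ∧ D b = 0 ∧ S b ∧ A a b)) : Layers n A S d r a (b + 1) D P :=
  { h with
    current := fun x hx hr y hy hc hS hA => by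
      by_cases hc' : x < a ∨ (x = a ∧ y < b)
      · exact h.current x hx hr y hy hc' hS hA
      · have hxa : x = a := by omega
        have hyb : y = b := by omega
        subst hxa hyb
        exact fun h0 => hno ⟨hr, h0, hS, hA⟩ }

/-- Since `b` has label zero, it is neither the root nor the parent of a reached vertex, so its new
label and parent disturb nothing else. With `r ≥ 1` the new label is at least two, so `b` is not
mistaken for the root. -/
theorem Layers.update (h : Layers n A S d r a b D P) (hr : 1 ≤ r) (ha : a < n) (hb : b < n)
    (hDa : D a = r) (hDb : D b = 0) (hS : S b) (hA : A a b) :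
    Layers n A S d r a (b + 1) (Function.update D b (r + 1)) (Function.update P b a) := by
  have hab : a ≠ b := by rintro rfl; omega
  have hdb : d ≠ b := by rintro rfl; have := h.root; omega
  refine ⟨?_, fun x hx h1 => ?_, fun x hx => ?_, fun y hy h2 => ?_, fun x hx h0 hlt y hy hSy hAxy => ?_,
    fun x hx hxr y hy hc hSy hAxy => ?_⟩
  · rw [Function.update_of_ne hdb]; exact h.root
  · by_cases hxb : x = b
    · subst hxb; rw [Function.update_self] at h1; omega
    · rw [Function.update_of_ne hxb] at h1; exact h.eq_root x hx h1
  · by_cases hxb : x = b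
    · subst hxb; rw [Function.update_self]
    · rw [Function.update_of_ne hxb]; exact h.le x hx
  · by_cases hyb : y = b
    · subst hyb
      rw [Function.update_self, Function.update_self, Function.update_of_ne hab]
      exact ⟨hS, ha, hA, by omega⟩
    · rw [Function.update_of_ne hyb] at h2 ⊢
      rw [Function.update_of_ne hyb]
      obtain ⟨h3, h4, h5, h6⟩ := h.parent y hy h2
      have hPb : P y ≠ b := by intro hc; rw [hc] at h6; omega
      rw [Function.update_of_ne hPb]
      exact ⟨h3, h4, h5, h6⟩
  · have hxb : x ≠ b := by rintro rfl; rw [Function.update_self] at hlt; omega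
    rw [Function.update_of_ne hxb] at h0 hlt ⊢
    have := h.closed x hx h0 hlt y hy hSy hAxy
    have hyb : y ≠ b := by rintro rfl; omega
    rwa [Function.update_of_ne hyb]
  · have hxb : x ≠ b := by rintro rfl; rw [Function.update_self] at hxr; omega
    rw [Function.update_of_ne hxb] at hxr
    by_cases hyb : y = b
    · subst hyb; rw [Function.update_self]; omega
    · rw [Function.update_of_ne hyb]
      exact h.current x hx hxr y hy (by omega) hSy hAxy

/-- Following parents from a reached vertex leads to the root in the number of steps given by its
label. -/
theorem Layers.iterate_parent (h : Layers n A S d r a b D P) {x : ℕ} (hx : x < n)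
    (t : ℕ) (ht : t < D x) : (P^[t]) x < n ∧ D ((P^[t]) x) + t = D x := by
  induction t with
  | zero => exact ⟨hx, rfl⟩
  | succ t ih =>
    obtain ⟨h1, h2⟩ := ih (by omega)
    obtain ⟨-, h4, -, h6⟩ := h.parent _ h1 (by omega)
    rw [Function.iterate_succ_apply']
    exact ⟨h4, by omega⟩

/-- Labels are bounded by the length of any path to the root. -/
theorem Layers.label_le (h : Layers n A S d r a b D P) (q : ℕ → ℕ) (k : ℕ) (hkr : k < r)
    (h0 : q 0 = d) (hq : ∀ i ≤ k, q i < n) (hS : ∀ i ≤ k, S (q i))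
    (hA : ∀ i < k, A (q i) (q (i + 1))) : D (q k) ≠ 0 ∧ D (q k) ≤ k + 1 := by
  induction k with
  | zero => rw [h0, h.root]; omega
  | succ k ih =>
    obtain ⟨h1, h2⟩ := ih (by omega) (fun i hi => hq i (by omega)) (fun i hi => hS i (by omega))
      (fun i hi => hA i (by omega))
    have := h.closed _ (hq k (by omega)) h1 (by omega) _ (hq (k + 1) le_rfl) (hS (k + 1) le_rfl)
      (hA k (by omega))
    exact ⟨this.1, by omega⟩

end Layers
end OddHole

namespace OddHole

/-! ### Reading the graph from memory. -/

section Environment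

variable {n : ℕ} {G : SimpleGraph (Fin n)} {W T : ℕ} {m₀ m : Memory}

/-- Adjacency of vertices given by numbers. -/
def NAdj [NeZero n] (G : SimpleGraph (Fin n)) (u v : ℕ) : Prop := G.Adj (Fin.ofNat n u) (Fin.ofNat n v)

theorem ofNat_inj [NeZero n] {u v : ℕ} (hu : u < n) (hv : v < n) : Fin.ofNat n u = Fin.ofNat n v ↔ u = v := by
  rw [Fin.ext_iff]
  simp [Fin.ofNat, Nat.mod_eq_of_lt hu, Nat.mod_eq_of_lt hv]

/-- The memory `m` holds the graph, its scratch arrays hold legal values, and registers `0` and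
`2, …, 6` have the same contents as in `m₀`. -/
structure Env (G : SimpleGraph (Fin n)) (m₀ m : Memory) : Prop where
  size : m.reg 1 = n
  adj : m.arr 0 = (inputMemory G).arr 0
  arg : ∀ x, x ≤ 6 → m.reg x = m₀.reg x
  label_le : ∀ i, m.arr 1 i ≤ n + 2
  parent_lt : ∀ i, m.arr 2 i < n
  list_lt : ∀ i, m.arr 3 i < n

theorem Env.setReg (h : Env G m₀ m) {x : ℕ} (v : ℕ) (hx : 7 ≤ x) : Env G m₀ (m.setReg x v) where
  size := by rw [Memory.reg_setReg, if_neg (by omega)]; exact h.size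
  adj := h.adj
  arg y hy := by rw [Memory.reg_setReg, if_neg (by omega)]; exact h.arg y hy
  label_le := h.label_le
  parent_lt := h.parent_lt
  list_lt := h.list_lt

theorem Env.setArr (h : Env G m₀ m) {a i v : ℕ} (ha : a ≠ 0) (h1 : a = 1 → v ≤ n + 2)
    (h2 : a = 2 ∨ a = 3 → v < n) : Env G m₀ (m.setArr a i v) where
  size := h.size
  adj := by rw [Memory.arr_setArr, if_neg (Ne.symm ha)]; exact h.adj
  arg := h.arg
  label_le j := by
    rw [Memory.arr_setArr]
    split_ifs with hc
    · subst hc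
      rw [Function.update_apply]
      split_ifs
      · exact h1 rfl
      · exact h.label_le j
    · exact h.label_le j
  parent_lt j := by
    rw [Memory.arr_setArr]
    split_ifs with hc
    · subst hc
      rw [Function.update_apply]
      split_ifs
      · exact h2 (Or.inl rfl)
      · exact h.parent_lt j
    · exact h.parent_lt j
  list_lt j := by
    rw [Memory.arr_setArr]
    split_ifs with hc
    · subst hc
      rw [Function.update_apply]
      split_ifs
      · exact h2 (Or.inr rfl)
      · exact h.list_lt j
    · exact h.list_lt j

open Classical in
theorem Env.adj_val [NeZero n] (h : Env G m₀ m) {u v : ℕ} (hu : u < n) (hv : v < n) :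
    m.arr 0 (u * n + v) = if NAdj G u v then 1 else 0 := by
  rw [h.adj]
  simp only [inputMemory, true_and]
  congr 1
  rw [eq_iff_iff]
  constructor
  · rintro ⟨u', v', ha, he⟩
    have hv' := v'.2
    have e1 : u = u'.1 := by
      have := congrArg (· / n) he
      simpa [Nat.add_div_of_dvd_right, Nat.mul_add_div, mul_comm, Nat.pos_of_neZero,
        Nat.div_eq_of_lt hv, Nat.div_eq_of_lt hv'] using this
    have e2 : v = v'.1 := by subst e1; omega
    subst e1 e2
    simpa [NAdj] using ha
  · intro ha
    refine ⟨_, _, ha, ?_⟩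
    simp [Fin.ofNat, Nat.mod_eq_of_lt hu, Nat.mod_eq_of_lt hv]

/-- The entry of the adjacency matrix for two vertices. -/
def adjExpr (a b : Expr) : Expr := .get 0 (.op .add (.op .mul a (.reg 1)) b)

open Classical in
theorem Env.val_adjExpr [NeZero n] (h : Env G m₀ m) {a b : Expr} (ha : a.val m < n) (hb : b.val m < n) :
    (adjExpr a b).val m = if NAdj G (a.val m) (b.val m) then 1 else 0 := by
  simp only [adjExpr, Expr.val, Op.apply, h.size]
  exact h.adj_val ha hb

theorem Env.fits_adjExpr [NeZero n] (h : Env G m₀ m) (hW : n * n + 2 * n + 10 ≤ W) {a b : Expr}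
    (ha : a.val m < n) (hb : b.val m < n) (fa : a.Fits W m) (fb : b.Fits W m) :
    (adjExpr a b).Fits W m := by
  classical
  have hlt : a.val m * n + b.val m < n * n := by nlinarith
  refine ⟨⟨⟨fa, ?_, ?_⟩, fb, ?_⟩, ?_⟩
  · change m.reg 1 < W; rw [h.size]; omega
  · simp only [Expr.val, Op.apply, h.size]; omega
  · simp only [Expr.val, Op.apply, h.size]; omega
  · have := h.val_adjExpr ha hb
    simp only [adjExpr, Expr.val] at this ⊢
    rw [this]
    split_ifs <;> omega

end Environment

/-! ### The program -/

/-- Sets all labels to zero. -/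
def clearLabels : Program := .forLoop 7 (.reg 1) (.store 1 (.reg 7) (.const 0))

/-- Whether the vertex in register `x` is kept when the neighbours of the vertices in registers `3`
and `4` are deleted, except for those in registers `2` and `5`. -/
def keptExpr (x : ℕ) : Expr :=
  .op .add (.op .add (.op .eq (.reg x) (.reg 2)) (.op .eq (.reg x) (.reg 5)))
    (.op .eq (.op .add (adjExpr (.reg x) (.reg 3)) (adjExpr (.reg x) (.reg 4))) (.const 0))

/-- Reaches the vertex in register `9` from that in register `8`, if it is new. -/
def searchStep : Program :=
  .when (.op .eq (.get 1 (.reg 8)) (.op .add (.reg 7) (.const 1)))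
    (.when (.op .eq (.get 1 (.reg 9)) (.const 0))
      (.when (keptExpr 9)
        (.when (adjExpr (.reg 8) (.reg 9))
          (.seq (.store 1 (.reg 9) (.op .add (.reg 7) (.const 2))) (.store 2 (.reg 9) (.reg 8))))))

/-- Breadth-first search from the vertex in register `6`. -/
def search : Program :=
  .seq clearLabels (.seq (.store 1 (.reg 6) (.const 1))
    (.forLoop 7 (.reg 1) (.forLoop 8 (.reg 1) (.forLoop 9 (.reg 1) searchStep))))

/-! ### Correctness and running time of the search. -/

section Search

variable {n : ℕ} {G : SimpleGraph (Fin n)} {W T : ℕ} {m₀ m : Memory}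

theorem run_clearLabels (hW : n * n + 2 * n + 10 ≤ W) (h : Env G m₀ m) :
    Run W clearLabels m ((n + 1) * 12) (fun m' => Env G m₀ m' ∧ ∀ i < n, m'.arr 1 i = 0) := by
  refine (Run.forLoop (N := n) (T := 3) (fun i m => Env G m₀ m ∧ ∀ j < i, m.arr 1 j = 0) (by omega)
    (fun i m v hI => ⟨hI.1.setReg v (by omega), hI.2⟩) ⟨h, by omega⟩
    (fun i m v hv hI => ?_) (fun i hi m hx hI => ?_) (fun m hI => hI)).mono
    (by simp [Expr.cost]) (fun _ h => h)
  · have := hI.1.size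
    simp only [Expr.Fits, Expr.val, Memory.reg_setReg]
    simp [this]
    omega
  · refine Run.mono (Run.store ?_ ?_ (Q := fun m' => m'.reg 7 = i ∧ Env G m₀ m' ∧
      ∀ j < i + 1, m'.arr 1 j = 0) ?_) (by simp [Expr.cost]) (fun _ h => h)
    · change m.reg 7 < W; omega
    · change 0 < W; omega
    · refine ⟨by simpa using hx, hI.1.setArr (by omega) (by simp [Expr.val]) (by omega),
        fun j hj => ?_⟩
      simp only [Expr.val, hx, Memory.arr_setArr, if_true, Function.update_apply]
      split_ifs
      · rfl
      · exact hI.2 j (by omega)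

variable [NeZero n]

/-- The vertices kept by `keptExpr`. -/
def NKept (G : SimpleGraph (Fin n)) (m₀ : Memory) (x : ℕ) : Prop :=
  x = m₀.reg 2 ∨ x = m₀.reg 5 ∨ (¬ NAdj G x (m₀.reg 3) ∧ ¬ NAdj G x (m₀.reg 4))

/-- On zero-one values, addition serves as disjunction, and a sum is zero exactly if both terms are;
no intermediate sum exceeds three. -/
theorem keptExpr_spec (hW : n * n + 2 * n + 10 ≤ W) (h : Env G m₀ m)
    (harg : ∀ x, 2 ≤ x → x ≤ 6 → m₀.reg x < n) {x : ℕ} (hx : m.reg x < n) :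
    (keptExpr x).Fits W m ∧ ((keptExpr x).val m ≠ 0 ↔ NKept G m₀ (m.reg x)) := by
  classical
  have h2 := h.arg 2 (by omega)
  have h3 := h.arg 3 (by omega)
  have h4 := h.arg 4 (by omega)
  have h5 := h.arg 5 (by omega)
  have a2 := harg 2 (by omega) (by omega)
  have a3 := harg 3 (by omega) (by omega)
  have a4 := harg 4 (by omega) (by omega)
  have a5 := harg 5 (by omega) (by omega)
  have fx : (Expr.reg x).Fits W m := by change m.reg x < W; omega
  have f3 : (Expr.reg 3).Fits W m := by change m.reg 3 < W; omega
  have f4 : (Expr.reg 4).Fits W m := by change m.reg 4 < W; omega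
  have v3 := h.val_adjExpr (a := .reg x) (b := .reg 3) hx (by change m.reg 3 < n; omega)
  have v4 := h.val_adjExpr (a := .reg x) (b := .reg 4) hx (by change m.reg 4 < n; omega)
  have g3 := h.fits_adjExpr hW (a := .reg x) (b := .reg 3) hx (by change m.reg 3 < n; omega) fx f3
  have g4 := h.fits_adjExpr hW (a := .reg x) (b := .reg 4) hx (by change m.reg 4 < n; omega) fx f4
  simp only [Expr.val] at v3 v4
  constructor
  · have e1 := Expr.val_eq_le (m := m) (.reg x) (.reg 2)
    have e2 := Expr.val_eq_le (m := m) (.reg x) (.reg 5)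
    have e3 := Expr.val_eq_le (m := m)
      (.op .add (adjExpr (.reg x) (.reg 3)) (adjExpr (.reg x) (.reg 4))) (.const 0)
    have e4 : (adjExpr (.reg x) (.reg 3)).val m ≤ 1 := by
      by_cases c : NAdj G (m.reg x) (m.reg 3) <;> simp [v3, c]
    have e5 : (adjExpr (.reg x) (.reg 4)).val m ≤ 1 := by
      by_cases c : NAdj G (m.reg x) (m.reg 4) <;> simp [v4, c]
    refine ⟨⟨Expr.fits_eq fx ?_ (by omega), Expr.fits_eq fx ?_ (by omega), ?_⟩,
      Expr.fits_eq ⟨g3, g4, ?_⟩ ?_ (by omega), ?_⟩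
    · change m.reg 2 < W; omega
    · change m.reg 5 < W; omega
    · change _ + _ < W; omega
    · change _ + _ < W; omega
    · change 0 < W; omega
    · change (_ + _) + _ < W; omega
  · simp only [keptExpr, Expr.val, Op.apply, v3, v4, NKept, h2, h3, h4, h5]
    by_cases c1 : m.reg x = m₀.reg 2 <;> by_cases c2 : m.reg x = m₀.reg 5 <;>
      by_cases c3 : NAdj G (m.reg x) (m₀.reg 3) <;>
      by_cases c4 : NAdj G (m.reg x) (m₀.reg 4) <;> simp [c1, c2, c3, c4]

theorem run_searchStep (hW : n * n + 2 * n + 10 ≤ W) {r a b : ℕ}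
    (harg : ∀ x, 2 ≤ x → x ≤ 6 → m₀.reg x < n) (h : Env G m₀ m) (hr : r < n) (ha : a < n)
    (hb : b < n) (h7 : m.reg 7 = r) (h8 : m.reg 8 = a) (h9 : m.reg 9 = b)
    (hI : Layers n (NAdj G) (NKept G m₀) (m₀.reg 6) (r + 1) a b (m.arr 1) (m.arr 2)) :
    Run W searchStep m 55 (fun m' => m'.reg 9 = b ∧ m'.reg 8 = a ∧ m'.reg 7 = r ∧ Env G m₀ m' ∧
      Layers n (NAdj G) (NKept G m₀) (m₀.reg 6) (r + 1) a (b + 1) (m'.arr 1) (m'.arr 2)) := by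
  classical
  have hl8 := h.label_le a
  have hl9 := h.label_le b
  obtain ⟨fk, vk⟩ := keptExpr_spec hW h harg (x := 9) (by omega)
  have va := h.val_adjExpr (a := .reg 8) (b := .reg 9) (by change m.reg 8 < n; omega)
    (by change m.reg 9 < n; omega)
  have fa := h.fits_adjExpr hW (a := .reg 8) (b := .reg 9) (by change m.reg 8 < n; omega)
    (by change m.reg 9 < n; omega) (by change m.reg 8 < W; omega) (by change m.reg 9 < W; omega)
  simp only [Expr.val, h8, h9] at va
  rw [h9] at vk
  have hskip : ¬ (m.arr 1 a = r + 1 ∧ m.arr 1 b = 0 ∧ NKept G m₀ b ∧ NAdj G a b) →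
      m.reg 9 = b ∧ m.reg 8 = a ∧ m.reg 7 = r ∧ Env G m₀ m ∧
      Layers n (NAdj G) (NKept G m₀) (m₀.reg 6) (r + 1) a (b + 1) (m.arr 1) (m.arr 2) :=
    fun hno => ⟨h9, h8, h7, h, hI.skip hno⟩
  refine Run.mono (Run.when ?_ (fun c1 => Run.when ?_ (fun c2 => Run.when fk (fun c3 =>
    Run.when fa (fun c4 => Run.seq (Run.store ?_ ?_ (Run.store ?_ ?_ ?_)))
    fun c4 => ?_) fun c3 => ?_) fun c2 => ?_) fun c1 => ?_) ?_ (fun _ h => h)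
  · simp only [Expr.Fits, Expr.val, Op.apply, h7, h8]
    split_ifs <;> omega
  · simp only [Expr.Fits, Expr.val, Op.apply, h9]
    split_ifs <;> omega
  · simp only [Expr.Fits, h9]; omega
  · simp only [Expr.Fits, Expr.val, Op.apply, h7]; omega
  · simp only [Expr.Fits, Memory.reg_setArr, h9]; omega
  · simp only [Expr.Fits, Memory.reg_setArr, h8]; omega
  · simp only [Expr.val, Op.apply, h7, h8, h9] at c1 c2
    have c1' : m.arr 1 a = r + 1 := by by_contra hc; simp [hc] at c1
    have c2' : m.arr 1 b = 0 := by by_contra hc; simp [hc] at c2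
    have c4' : NAdj G a b := by by_contra hc; rw [va, if_neg hc] at c4; exact c4 rfl
    refine ⟨by simpa using h9, by simpa using h8, by simpa using h7, ?_, ?_⟩
    · refine (h.setArr (by omega) (fun _ => ?_) (by omega)).setArr (by omega) (by omega)
        (fun _ => ?_)
      · simp only [Expr.val, Op.apply, h7]; omega
      · simp only [Expr.val, Memory.reg_setArr, h8]; omega
    · have := hI.update (by omega) ha hb c1' c2' (vk.1 c3) c4'
      simpa [Expr.val, Op.apply, h7, h8, h9] using this
  · refine hskip fun hc => ?_
    rw [va, if_pos hc.2.2.2] at c4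
    exact absurd c4 one_ne_zero
  · exact hskip fun hc => vk.2 hc.2.2.1 c3
  · refine hskip fun hc => ?_
    simp [Expr.val, Op.apply, h9, hc.2.1] at c2
  · refine hskip fun hc => ?_
    simp [Expr.val, Op.apply, h7, h8, hc.1] at c1
  · simp [Expr.cost, keptExpr, adjExpr]

/-- Each of `n` rounds scans the whole adjacency matrix, which accounts for the cubic bound. Round
`r` processes the vertices with label `r + 1`, since labels start at one. -/
theorem run_search (hW : n * n + 2 * n + 10 ≤ W)
    (harg : ∀ x, 2 ≤ x → x ≤ 6 → m₀.reg x < n) (h : Env G m₀ m) :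
    Run W search m ((n + 1) ^ 3 * 100) (fun m' => Env G m₀ m' ∧
      Layers n (NAdj G) (NKept G m₀) (m₀.reg 6) (n + 1) 0 0 (m'.arr 1) (m'.arr 2)) := by
  have hreg : ∀ x v, ∀ m : Memory, m.reg 1 = n → x ≠ 1 → v ≤ n →
      (Expr.reg 1).Fits W (m.setReg x v) ∧ (Expr.reg 1).val (m.setReg x v) = n := by
    intro x v m hm hx hv
    have e : (m.setReg x v).reg 1 = n := by rw [Memory.reg_setReg, if_neg (Ne.symm hx), hm]
    exact ⟨by change (m.setReg x v).reg 1 < W; rw [e]; omega, e⟩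
  have hloop : ∀ m, Env G m₀ m →
      Layers n (NAdj G) (NKept G m₀) (m₀.reg 6) 1 0 0 (m.arr 1) (m.arr 2) →
      Run W (.forLoop 7 (.reg 1) (.forLoop 8 (.reg 1) (.forLoop 9 (.reg 1) searchStep))) m
        ((n + 1) * ((n + 1) * ((n + 1) * (55 + 1 + 8) + 1 + 8) + 1 + 8)) (fun m' => Env G m₀ m' ∧
        Layers n (NAdj G) (NKept G m₀) (m₀.reg 6) (n + 1) 0 0 (m'.arr 1) (m'.arr 2)) := by
    intro m hE hI
    refine Run.forLoop (N := n) (fun r m => Env G m₀ m ∧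
      Layers n (NAdj G) (NKept G m₀) (m₀.reg 6) (r + 1) 0 0 (m.arr 1) (m.arr 2)) (by omega)
      (fun i m v hI => ⟨hI.1.setReg v (by omega), hI.2⟩) ⟨hE, hI⟩
      (fun i m v hv hI => hreg 7 v m hI.1.size (by omega) hv) (fun r hr m h7 hI => ?_)
      (fun m hI => hI)
    refine Run.forLoop (N := n) (fun a m => m.reg 7 = r ∧ Env G m₀ m ∧
      Layers n (NAdj G) (NKept G m₀) (m₀.reg 6) (r + 1) a 0 (m.arr 1) (m.arr 2)) (by omega)
      (fun i m v hI => ⟨by simpa using hI.1, hI.2.1.setReg v (by omega), hI.2.2⟩)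
      ⟨h7, hI.1, hI.2⟩ (fun i m v hv hI => hreg 8 v m hI.2.1.size (by omega) hv)
      (fun a ha m h8 hI => ?_) (fun m hI => ⟨hI.1, hI.2.1, hI.2.2.next_round⟩)
    refine Run.forLoop (N := n) (fun b m => m.reg 8 = a ∧ m.reg 7 = r ∧ Env G m₀ m ∧
      Layers n (NAdj G) (NKept G m₀) (m₀.reg 6) (r + 1) a b (m.arr 1) (m.arr 2)) (by omega)
      (fun i m v hI => ⟨by simpa using hI.1, by simpa using hI.2.1, hI.2.2.1.setReg v (by omega),
        hI.2.2.2⟩)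
      ⟨h8, hI.1, hI.2.1, hI.2.2⟩ (fun i m v hv hI => hreg 9 v m hI.2.2.1.size (by omega) hv)
      (fun b hb m h9 hI => ?_) (fun m hI => ⟨hI.1, hI.2.1, hI.2.2.1, hI.2.2.2.next_row⟩)
    exact run_searchStep hW harg hI.2.2.1 hr ha hb hI.2.1 hI.1 h9 hI.2.2.2
  have h6 := harg 6 (by omega) (by omega)
  refine Run.mono (Run.seq ((run_clearLabels hW h).mono le_rfl fun m₁ h₁ =>
    Run.seq (Run.store ?_ ?_ (hloop _ ?_ ?_)))) ?_ (fun _ h => h)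
  · have := h₁.1.arg 6 (by omega)
    change m₁.reg 6 < W; omega
  · change 1 < W; omega
  · exact h₁.1.setArr (by omega) (fun _ => by change 1 ≤ n + 2; omega) (by omega)
  · have := h₁.1.arg 6 (by omega)
    refine Layers.init (fun x hx hne => ?_) ?_
    · simp [Expr.val, this, hne, h₁.2 x hx]
    · simp [Expr.val, this]
  · have hn : 1 ≤ n + 1 := by omega
    generalize n + 1 = N at *
    simp only [Expr.cost]
    have e1 : N ≤ N ^ 3 := Nat.le_self_pow (by omega) N
    have e2 : N ^ 2 ≤ N ^ 3 := Nat.pow_le_pow_right hn (by omega)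
    have e3 : 1 ≤ N ^ 3 := Nat.one_le_pow _ _ hn
    have e4 : N * (N * (N * (55 + 1 + 8) + 1 + 8) + 1 + 8) = 64 * N ^ 3 + 9 * N ^ 2 + 9 * N := by
      ring
    rw [e4]
    omega

end Search
end OddHole

namespace OddHole

/-! ### Candidate holes -/

/-- Writes the candidate hole to array `3`: the path of parents from the vertex in register `2`, the
reverse of that from the vertex in register `5`, and the vertices in registers `4` and `3`. -/
def extract : Program :=
  .seq (.assign 12 (.get 1 (.reg 2))) (.seq (.assign 10 (.reg 2)) (.seq (.assign 11 (.reg 5))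
    (.seq (.forLoop 7 (.reg 12)
      (.seq (.store 3 (.reg 7) (.reg 10))
        (.seq (.store 3 (.op .sub (.op .add (.reg 12) (.reg 12)) (.op .add (.reg 7) (.const 2)))
          (.reg 11))
          (.seq (.assign 10 (.get 2 (.reg 10))) (.assign 11 (.get 2 (.reg 11)))))))
      (.seq (.store 3 (.op .sub (.op .add (.reg 12) (.reg 12)) (.const 1)) (.reg 4))
        (.store 3 (.op .add (.reg 12) (.reg 12)) (.reg 3))))))

/-- Whether the entries at the positions in registers `8` and `7` of the candidate hole violate the
definition of a hole. -/
def badExpr : Expr :=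
  .op .add (.op .eq (.get 3 (.reg 8)) (.get 3 (.reg 7)))
    (.op .eq (.op .eq (adjExpr (.get 3 (.reg 8)) (.get 3 (.reg 7)))
      (.op .add (.op .eq (.reg 7) (.op .add (.reg 8) (.const 1)))
        (.op .mul (.op .eq (.reg 8) (.const 0))
          (.op .eq (.reg 7) (.op .add (.reg 12) (.reg 12)))))) (.const 0))

/-- Sets register `14` to `1` or `0`, according as the candidate hole is a hole or not. -/
def check : Program :=
  .seq (.assign 14 (.const 1))
    (.forLoop 7 (.op .add (.op .add (.reg 12) (.reg 12)) (.const 1))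
      (.forLoop 8 (.reg 7) (.when badExpr (.assign 14 (.const 0)))))

/-- Tests one choice of five vertices. -/
def tryVertices : Program :=
  .seq search (.when (.op .lt (.const 1) (.get 1 (.reg 2)))
    (.when (.op .eq (.get 1 (.reg 2)) (.get 1 (.reg 5)))
      (.seq extract (.seq check (.when (.reg 14) (.assign 0 (.const 1)))))))

/-- The algorithm. -/
def algorithm : Program :=
  .seq (.assign 1 (.reg 0)) (.seq (.assign 0 (.const 2))
    (.forLoop 2 (.reg 1) (.forLoop 3 (.reg 1) (.forLoop 4 (.reg 1) (.forLoop 5 (.reg 1)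
      (.forLoop 6 (.reg 1) tryVertices))))))

/-- The entries of the candidate hole. -/
def candidate (M : ℕ) (P c : ℕ → ℕ) (i : ℕ) : ℕ :=
  if i + 1 < M then (P^[i]) (c 2) else if i ≤ 2 * M - 2 then (P^[2 * M - 2 - i]) (c 5)
  else if i = 2 * M - 1 then c 4 else c 3

/-! ### Assembling the candidate hole. -/

section Extract

variable {n : ℕ} {G : SimpleGraph (Fin n)} {W T : ℕ} {m₀ m : Memory}

theorem run_extract (hW : n * n + 2 * n + 10 ≤ W) {M : ℕ}
    (harg : ∀ x, 2 ≤ x → x ≤ 6 → m₀.reg x < n) (h : Env G m₀ m)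
    (hM : m.arr 1 (m₀.reg 2) = M) (h2M : 2 ≤ M) :
    Run W extract m ((n + 3) * 40) (fun m' => Env G m₀ m' ∧ m'.reg 12 = M ∧
      ∀ i < 2 * M + 1, m'.arr 3 i = candidate M (m.arr 2) m₀.reg i) := by
  have hMn : M ≤ n + 2 := hM ▸ h.label_le _
  have a2 := harg 2 (by omega) (by omega)
  have a3 := harg 3 (by omega) (by omega)
  have a4 := harg 4 (by omega) (by omega)
  have a5 := harg 5 (by omega) (by omega)
  have r2 := h.arg 2 (by omega)
  have r5 := h.arg 5 (by omega)
  set P := m.arr 2 with hP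
  have hPn : ∀ i, P i < n := h.parent_lt
  -- In the last iteration both stores hit entry `M - 1`, and the second one wins; hence the
  -- restriction `j + 1 < M` on the first half.
  set I : ℕ → Memory → Prop := fun i m' => Env G m₀ m' ∧ m'.reg 12 = M ∧ m'.arr 2 = P ∧
    m'.reg 10 = (P^[i]) (m₀.reg 2) ∧ m'.reg 11 = (P^[i]) (m₀.reg 5) ∧ m'.reg 10 < n ∧
    m'.reg 11 < n ∧ (∀ j < i, j + 1 < M → m'.arr 3 j = (P^[j]) (m₀.reg 2)) ∧
    (∀ j < i, m'.arr 3 (2 * M - 2 - j) = (P^[j]) (m₀.reg 5)) with hI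
  have hbody : ∀ i < M, ∀ m, m.reg 7 = i → I i m → Run W
      (.seq (.store 3 (.reg 7) (.reg 10))
        (.seq (.store 3 (.op .sub (.op .add (.reg 12) (.reg 12)) (.op .add (.reg 7) (.const 2)))
          (.reg 11))
          (.seq (.assign 10 (.get 2 (.reg 10))) (.assign 11 (.get 2 (.reg 11)))))) m 18
      (fun m' => m'.reg 7 = i ∧ I (i + 1) m') := by
    rintro i hi m h7 ⟨hE, h12, hm2, h10, h11, h10n, h11n, hl, hr⟩
    have e1 := hPn (m.reg 10)
    have e2 := hPn (m.reg 11)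
    have hidx : M + M - (i + 2) = 2 * M - 2 - i := by omega
    refine Run.mono (Run.seq (Run.store ?_ ?_ (Run.seq (Run.store ?_ ?_ (Run.seq (Run.assign ?_
      (Run.assign ?_ ?_))))))) (by simp [Expr.cost]) (fun _ h => h)
    · change m.reg 7 < W; omega
    · change m.reg 10 < W; omega
    · simp only [Expr.Fits, Expr.val, Op.apply, Memory.reg_setArr, h7, h12]; omega
    · change m.reg 11 < W; omega
    · simp [Expr.Fits, Expr.val, hm2]; omega
    · simp [Expr.Fits, Expr.val, hm2]; omega
    · refine ⟨by simpa using h7, ?_⟩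
      simp only [hI, Expr.val, Op.apply, Memory.reg_setReg, Memory.reg_setArr, Memory.arr_setReg,
        Memory.arr_setArr, h7, h12, hm2, hidx]
      refine ⟨((((hE.setArr (by omega) (by omega) (fun _ => h10n)).setArr (by omega) (by omega)
        (fun _ => h11n)).setReg _ (by omega)).setReg _ (by omega)), by simp, by simp, ?_, ?_,
        by simpa using e1, by simpa using e2, fun j hj hjM => ?_, fun j hj => ?_⟩
      · simp [Function.iterate_succ_apply', h10]
      · simp [Function.iterate_succ_apply', h11]
      · simp only [if_true]
        rw [Function.update_of_ne (by omega)]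
        by_cases hji : j = i
        · subst hji; rw [Function.update_self, h10]
        · rw [Function.update_of_ne hji]; exact hl j (by omega) hjM
      · simp only [if_true]
        by_cases hji : j = i
        · subst hji; rw [Function.update_self, h11]
        · rw [Function.update_of_ne (by omega)]
          by_cases hji' : 2 * M - 2 - j = i
          · omega
          · rw [Function.update_of_ne hji']; exact hr j (by omega)
  have hfinal : ∀ m, I M m → Run W
      (.seq (.store 3 (.op .sub (.op .add (.reg 12) (.reg 12)) (.const 1)) (.reg 4))
        (.store 3 (.op .add (.reg 12) (.reg 12)) (.reg 3))) m 12 (fun m' => Env G m₀ m' ∧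
        m'.reg 12 = M ∧ ∀ i < 2 * M + 1, m'.arr 3 i = candidate M P m₀.reg i) := by
    rintro m ⟨hE, h12, hm2, h10, h11, h10n, h11n, hl, hr⟩
    have s3 := hE.arg 3 (by omega)
    have s4 := hE.arg 4 (by omega)
    refine Run.mono (Run.seq (Run.store ?_ ?_ (Run.store ?_ ?_ ?_))) (by simp [Expr.cost])
      (fun _ h => h)
    · simp only [Expr.Fits, Expr.val, Op.apply, h12]; omega
    · simp only [Expr.Fits, s4]; omega
    · simp only [Expr.Fits, Expr.val, Op.apply, Memory.reg_setArr, h12]; omega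
    · simp only [Expr.Fits, Memory.reg_setArr, s3]; omega
    refine ⟨(hE.setArr (by omega) (by omega) fun _ => ?_).setArr (by omega) (by omega)
      fun _ => ?_, by simpa using h12, fun i hi => ?_⟩
    · change m.reg 4 < n; omega
    · change m.reg 3 < n; omega
    · simp only [Expr.val, Op.apply, Memory.arr_setArr, Memory.reg_setArr, if_true, h12, s3, s4]
      unfold candidate
      by_cases c1 : i + 1 < M
      · rw [if_pos c1, Function.update_of_ne (by omega), Function.update_of_ne (by omega)]
        exact hl i (by omega) c1
      rw [if_neg c1]
      by_cases c2 : i ≤ 2 * M - 2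
      · rw [if_pos c2, Function.update_of_ne (by omega), Function.update_of_ne (by omega)]
        have := hr (2 * M - 2 - i) (by omega)
        rwa [show 2 * M - 2 - (2 * M - 2 - i) = i by omega] at this
      rw [if_neg c2]
      by_cases c3 : i = 2 * M - 1
      · rw [if_pos c3, Function.update_of_ne (by omega), c3, show M + M - 1 = 2 * M - 1 by omega,
          Function.update_self]
      · rw [if_neg c3, show M + M = i by omega, Function.update_self]
  refine Run.mono (Run.seq (Run.assign ?_ (Run.seq (Run.assign ?_ (Run.seq (Run.assign ?_
    (Run.seq (Run.forLoop (N := M) I (by omega) ?_ ?_ ?_ hbody hfinal))))))))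
    ?_ (fun _ h => h)
  · simp only [Expr.Fits, Expr.val, r2, hM]; omega
  · simp only [Expr.Fits, Memory.reg_setReg, r2]; simp; omega
  · simp only [Expr.Fits, Memory.reg_setReg, r5]; simp; omega
  · rintro i m v ⟨hE, h12, hm2, h10, h11, h10n, h11n, hl, hr⟩
    exact ⟨hE.setReg v (by omega), by simpa using h12, hm2, by simpa using h10, by simpa using h11,
      by simpa using h10n, by simpa using h11n, hl, hr⟩
  · refine ⟨(((h.setReg _ (by omega)).setReg _ (by omega)).setReg _ (by omega)), ?_, rfl, ?_, ?_, ?_,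
      ?_, by omega, by omega⟩
    · simp [Expr.val, r2, hM]
    · simp [Expr.val, r2]
    · simp [Expr.val, r5]
    · simpa [Expr.val, r2] using a2
    · simpa [Expr.val, r5] using a5
  · rintro i m v hv ⟨hE, h12, -⟩
    simp only [Expr.Fits, Expr.val, Memory.reg_setReg]
    simp [h12]
    omega
  · simp only [Expr.cost]
    have : (M + 1) * (18 + 1 + 8) ≤ (n + 3) * (18 + 1 + 8) := Nat.mul_le_mul_right _ (by omega)
    omega

end Extract

/-! ### Testing a candidate; soundness and completeness for one guess. -/

section Check

variable {n : ℕ} [NeZero n] {G : SimpleGraph (Fin n)} {W T : ℕ} {m₀ m : Memory}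

/-- The condition on positions `j < i` of a candidate hole `l` of length `2 * M + 1`. -/
def PairOk (G : SimpleGraph (Fin n)) (M : ℕ) (l : ℕ → ℕ) (j i : ℕ) : Prop :=
  l j ≠ l i ∧ (NAdj G (l j) (l i) ↔ i = j + 1 ∨ (j = 0 ∧ i = 2 * M))

/-- Excluding `C ∧ D ∧ E` keeps the inner sum at most one, so comparing it with the adjacency bit
expresses the equivalence. In use this holds because `1 ≠ 2 * M`. -/
theorem bad_iff {A B C D E : Prop} [Decidable A] [Decidable B] [Decidable C] [Decidable D]
    [Decidable E] (h : ¬ (C ∧ D ∧ E)) :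
    ((if A then 1 else 0) + (if (if (if B then 1 else 0) =
      (if C then 1 else 0) + (if D then 1 else 0) * (if E then 1 else 0) then 1 else 0) = 0
        then 1 else 0)) = 0 ↔ (¬ A ∧ (B ↔ C ∨ (D ∧ E))) := by
  by_cases hA : A <;> by_cases hB : B <;> by_cases hC : C <;> by_cases hD : D <;>
    by_cases hE : E <;> simp_all

theorem badExpr_spec (hW : n * n + 2 * n + 10 ≤ W) {M i j : ℕ} (h : Env G m₀ m)
    (hM2 : 2 ≤ M) (hMn : M ≤ n + 2) (h12 : m.reg 12 = M) (h7 : m.reg 7 = i) (h8 : m.reg 8 = j)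
    (hi : i < 2 * M + 1) (hji : j < i) :
    badExpr.Fits W m ∧ (badExpr.val m = 0 ↔ PairOk G M (m.arr 3) j i) := by
  classical
  have li := h.list_lt i
  have lj := h.list_lt j
  have f7 : (Expr.reg 7).Fits W m := by change m.reg 7 < W; omega
  have f8 : (Expr.reg 8).Fits W m := by change m.reg 8 < W; omega
  have f12 : (Expr.reg 12).Fits W m := by change m.reg 12 < W; omega
  have fc : ∀ k ≤ 2, (Expr.const k).Fits W m := fun k hk => by change k < W; omega
  have fi : (Expr.get 3 (.reg 7)).Fits W m := ⟨f7, by simp only [Expr.val, h7]; omega⟩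
  have fj : (Expr.get 3 (.reg 8)).Fits W m := ⟨f8, by simp only [Expr.val, h8]; omega⟩
  have va := h.val_adjExpr (a := .get 3 (.reg 8)) (b := .get 3 (.reg 7))
    (by simpa only [Expr.val, h8] using lj) (by simpa only [Expr.val, h7] using li)
  have fa := h.fits_adjExpr hW (a := .get 3 (.reg 8)) (b := .get 3 (.reg 7))
    (by simpa only [Expr.val, h8] using lj) (by simpa only [Expr.val, h7] using li) fj fi
  simp only [Expr.val, h7, h8] at va
  constructor
  · have e1 := Expr.val_eq_le (m := m) (.reg 7) (.op .add (.reg 8) (.const 1))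
    have e2 := Expr.val_eq_le (m := m) (.reg 8) (.const 0)
    have e3 := Expr.val_eq_le (m := m) (.reg 7) (.op .add (.reg 12) (.reg 12))
    have e4 := Nat.mul_le_mul e2 e3
    refine ⟨Expr.fits_eq fj fi (by omega), Expr.fits_eq (Expr.fits_eq fa ⟨Expr.fits_eq f7
      ⟨f8, fc 1 (by omega), ?_⟩ (by omega), ⟨Expr.fits_eq f8 (fc 0 (by omega)) (by omega),
      Expr.fits_eq f7 ⟨f12, f12, ?_⟩ (by omega), ?_⟩, ?_⟩ (by omega)) (fc 0 (by omega)) (by omega),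
      ?_⟩
    · simp only [Expr.val, Op.apply, h8]; omega
    · simp only [Expr.val, Op.apply, h12]; omega
    · change _ * _ < W; omega
    · change _ + _ * _ < W; omega
    · have e5 := Expr.val_eq_le (m := m) (.get 3 (.reg 8)) (.get 3 (.reg 7))
      have e6 := Expr.val_eq_le (m := m)
        (.op .eq (adjExpr (.get 3 (.reg 8)) (.get 3 (.reg 7)))
      (.op .add (.op .eq (.reg 7) (.op .add (.reg 8) (.const 1)))
        (.op .mul (.op .eq (.reg 8) (.const 0))
          (.op .eq (.reg 7) (.op .add (.reg 12) (.reg 12)))))) (.const 0)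
      change _ + _ < W; omega
  · simp only [badExpr, Expr.val, Op.apply, va, h7, h8, h12, PairOk, ← two_mul]
    exact bad_iff (by omega)

theorem run_check (hW : n * n + 2 * n + 10 ≤ W) {M : ℕ} (h : Env G m₀ m)
    (hM2 : 2 ≤ M) (hMn : M ≤ n + 2) (h12 : m.reg 12 = M) :
    Run W check m ((n + 3) ^ 2 * 300) (fun m' => Env G m₀ m' ∧ m'.arr 3 = m.arr 3 ∧
      m'.reg 14 ≤ 1 ∧
      (m'.reg 14 ≠ 0 ↔ ∀ i < 2 * M + 1, ∀ j < i, PairOk G M (m.arr 3) j i)) := by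
  set l := m.arr 3 with hl
  set J : Memory → Prop := fun m' => Env G m₀ m' ∧ m'.arr 3 = l ∧ m'.reg 14 ≤ 1 ∧ m'.reg 12 = M
    with hJ
  have hJset : ∀ m x v, 7 ≤ x → x ≤ 8 → J m → J (m.setReg x v) := by
    rintro m x v h7 h8 ⟨hE, h3, h14, h12⟩
    exact ⟨hE.setReg v h7, h3, by rwa [Memory.reg_setReg, if_neg (by omega)],
      by rwa [Memory.reg_setReg, if_neg (by omega)]⟩
  have hinner : ∀ i < 2 * M + 1, ∀ j < i, ∀ m, J m → m.reg 7 = i → m.reg 8 = j →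
      (m.reg 14 ≠ 0 ↔ (∀ a < i, ∀ b < a, PairOk G M l b a) ∧ ∀ b < j, PairOk G M l b i) →
      Run W (.when badExpr (.assign 14 (.const 0))) m 40 (fun m' => m'.reg 8 = j ∧ J m' ∧
        m'.reg 7 = i ∧ (m'.reg 14 ≠ 0 ↔ (∀ a < i, ∀ b < a, PairOk G M l b a) ∧
          ∀ b < j + 1, PairOk G M l b i)) := by
    rintro i hi j hji m ⟨hE, h3, h14, h12⟩ h7 h8 hI
    obtain ⟨hf, hv⟩ := badExpr_spec hW hE hM2 hMn h12 h7 h8 hi hji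
    rw [h3] at hv
    refine Run.mono (Run.when hf (fun c => Run.assign ?_ ?_) fun c => ?_)
      (by simp [Expr.cost, badExpr, adjExpr]) (fun _ h => h)
    · change 0 < W; omega
    · refine ⟨by simpa using h8, ⟨hE.setReg _ (by omega), h3, by simp [Expr.val], by simpa using h12⟩,
        by simpa using h7, ?_⟩
      simp only [Expr.val, Memory.reg_setReg, if_true, ne_eq, not_true_eq_false, false_iff]
      exact fun hc => c (hv.2 (hc.2 j (by omega)))
    · refine ⟨h8, ⟨hE, h3, h14, h12⟩, h7, hI.trans ?_⟩
      refine and_congr_right fun _ => ⟨fun hc b hb => ?_, fun hc b hb => hc b (by omega)⟩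
      rcases Nat.lt_succ_iff_lt_or_eq.1 hb with hb | rfl
      · exact hc b hb
      · exact hv.1 c
  have houter : ∀ i < 2 * M + 1, ∀ m, J m → m.reg 7 = i →
      (m.reg 14 ≠ 0 ↔ ∀ a < i, ∀ b < a, PairOk G M l b a) →
      Run W (.forLoop 8 (.reg 7) (.when badExpr (.assign 14 (.const 0)))) m
        ((2 * n + 6) * 49) (fun m' => m'.reg 7 = i ∧ J m' ∧
          (m'.reg 14 ≠ 0 ↔ ∀ a < i + 1, ∀ b < a, PairOk G M l b a)) := by
    intro i hi m hJm h7 hI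
    refine Run.mono (Run.forLoop (N := i) (T := 40) (fun j m => J m ∧ m.reg 7 = i ∧
      (m.reg 14 ≠ 0 ↔ (∀ a < i, ∀ b < a, PairOk G M l b a) ∧ ∀ b < j, PairOk G M l b i))
      (Q := fun m' => m'.reg 7 = i ∧ J m' ∧
          (m'.reg 14 ≠ 0 ↔ ∀ a < i + 1, ∀ b < a, PairOk G M l b a)) (by omega)
      (fun j m v hI => ⟨hJset m 8 v (by omega) (by omega) hI.1, by simpa using hI.2.1,
        by simpa using hI.2.2⟩) ⟨hJm, h7, by simpa using hI⟩ ?_ ?_ ?_) ?_ (fun _ h => h)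
    · rintro j m v hv ⟨hJm, h7, -⟩
      simp only [Expr.Fits, Expr.val, Memory.reg_setReg]
      simp [h7]
      omega
    · rintro j hj m h8 ⟨hJm, h7, hI⟩
      exact (hinner i hi j hj m hJm h7 h8 hI).mono le_rfl fun m' h' => h'
    · rintro m ⟨hJm, h7, hI⟩
      refine ⟨h7, hJm, hI.trans ⟨fun hc a ha => ?_, fun hc => ⟨fun a ha => hc a (by omega),
        hc i (by omega)⟩⟩⟩
      rcases Nat.lt_succ_iff_lt_or_eq.1 ha with ha | rfl
      · exact hc.1 a ha
      · exact hc.2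
    · simp only [Expr.cost]
      exact Nat.mul_le_mul (by omega) (by omega)
  refine Run.mono (Run.seq (Run.assign ?_ (Run.forLoop (N := 2 * M + 1) (T := (2 * n + 6) * 49)
    (fun i m => J m ∧ (m.reg 14 ≠ 0 ↔ ∀ a < i, ∀ b < a, PairOk G M l b a)) (by omega)
    (fun i m v hI => ⟨hJset m 7 v (by omega) (by omega) hI.1, by simpa using hI.2⟩)
    ⟨⟨h.setReg _ (by omega), rfl, by simp [Expr.val], by simpa using h12⟩,
      by simp [Expr.val]⟩ ?_ ?_ ?_))) ?_ (fun _ h => h)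
  · change 1 < W; omega
  · rintro i m v hv ⟨⟨-, -, -, h12⟩, -⟩
    simp only [Expr.Fits, Expr.val, Op.apply, Memory.reg_setReg]
    simp [h12]
    omega
  · rintro i hi m h7 ⟨hJm, hI⟩
    exact houter i hi m hJm h7 hI
  · rintro m ⟨⟨hE, h3, h14, h12⟩, hI⟩
    exact ⟨hE, h3, h14, hI⟩
  · simp only [Expr.cost]
    have : (2 * M + 1 + 1) * ((2 * n + 6) * 49 + (1 + 1 + 1 + 1 + 1) + 8) ≤
        (2 * n + 6) * ((2 * n + 6) * 49 + 13) := Nat.mul_le_mul (by omega) (by omega)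
    nlinarith

/-- This is soundness: it needs nothing about pyramids, jewels or the origin of the candidate. -/
theorem hasOddHole_of_pairOk {M : ℕ} {l : ℕ → ℕ} (hl : ∀ i, l i < n) (hM : 2 ≤ M)
    (h : ∀ i < 2 * M + 1, ∀ j < i, PairOk G M l j i) : HasOddHole G := by
  have hf : HoleSeq G (2 * M + 1) (fun i => Fin.ofNat n (l i)) := by
    refine ⟨by omega, fun j i hji hi => ?_, fun j i hji hi => ?_⟩
    · rw [Ne, ofNat_inj (hl j) (hl i)]
      exact (h i hi j hji).1
    · refine (h i hi j hji).2.trans (or_congr_right (and_congr_right fun _ => ?_))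
      omega
  obtain ⟨C, hC, hcard⟩ := hf.isHole
  exact ⟨C, hC, by rw [hcard]; exact ⟨M, rfl⟩⟩

/-- The five vertices `c 2, …, c 6` determine a clean shortest odd hole: an edge whose neighbours
are deleted, the neighbours of its ends along the hole, and the vertex opposite to it. -/
def IsGood (G : SimpleGraph (Fin n)) (c : ℕ → ℕ) : Prop :=
  ∃ (m : ℕ) (f : ℕ → Fin n), 2 ≤ m ∧ Setting G (2 * m + 1) ∧
    Clean G (Kept G (f 0) (f (2 * m)) (f (2 * m - 1)) (f (2 * m - 2))) (2 * m + 1) f ∧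
    (f 0).val = c 2 ∧ (f (2 * m)).val = c 3 ∧ (f (2 * m - 1)).val = c 4 ∧
    (f (2 * m - 2)).val = c 5 ∧ (f (m - 1)).val = c 6

theorem ofNat_val (x : Fin n) : Fin.ofNat n x.val = x :=
  Fin.ext (Nat.mod_eq_of_lt x.2)

/-- The parents of a reached vertex form a route to the root. The search never tests the root for
being kept, so its membership in `O` is assumed separately. -/
theorem Layers.route {d r a b x : ℕ} {S : ℕ → Prop} {D P : ℕ → ℕ} {O : Set (Fin n)}
    (h : Layers n (NAdj G) S d r a b D P) (hd : Fin.ofNat n d ∈ O)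
    (hS : ∀ y < n, S y → Fin.ofNat n y ∈ O) (hx : x < n) (h0 : D x ≠ 0) :
    Route G O (D x - 1) (fun t => Fin.ofNat n ((P^[t]) x)) ∧ (P^[D x - 1]) x = d := by
  have hlast : (P^[D x - 1]) x = d := by
    obtain ⟨h1, h2⟩ := h.iterate_parent hx (D x - 1) (by omega)
    exact h.eq_root _ h1 (by omega)
  refine ⟨⟨fun i hi => ?_, fun i hi => ?_⟩, hlast⟩
  · obtain ⟨h1, h2⟩ := h.iterate_parent hx i (by omega)
    have := (h.parent _ h1 (by omega)).2.2.1
    simp only [Function.iterate_succ_apply']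
    exact SimpleGraph.Adj.symm this
  · obtain ⟨h1, h2⟩ := h.iterate_parent hx i (by omega)
    rcases Nat.lt_or_ge i (D x - 1) with hlt | hge
    · exact hS _ h1 (h.parent _ h1 (by omega)).1
    · rw [show i = D x - 1 by omega, hlast]
      exact hd

/-- The two halves of the good hole are themselves walks available to the search, so the labels of
both targets are at most `m`. `Setting.swap_twice` then makes both equal to `m` and turns the tree
paths into a hole, which is the candidate. As labels exceed distances by one, the label itself is
the half-length `M`. -/
theorem IsGood.pairOk {D P : ℕ → ℕ}
    (hgood : IsGood G m₀.reg)
    (h : Layers n (NAdj G) (NKept G m₀) (m₀.reg 6) (n + 1) 0 0 D P) :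
    2 ≤ D (m₀.reg 2) ∧ D (m₀.reg 2) = D (m₀.reg 5) ∧ ∀ i < 2 * D (m₀.reg 2) + 1, ∀ j < i,
      PairOk G (D (m₀.reg 2)) (candidate (D (m₀.reg 2)) P m₀.reg) j i := by
  obtain ⟨m, f, hm, hG, hf, e2, e3, e4, e5, e6⟩ := hgood
  have hole := hf.hole
  -- The hole has at most `n` vertices, so `n` rounds of the search cover distance `m - 1`.
  have hmn : 2 * m + 1 ≤ n := by
    have := Fintype.card_le_of_injective (fun i : Fin (2 * m + 1) => f i)
      fun i j hij => Fin.ext (hole.eq_of_eq i.2 j.2 hij)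
    simpa using this
  have hadj : ∀ a b, NAdj G (f a).val (f b).val ↔ G.Adj (f a) (f b) := fun a b => by
    rw [NAdj, ofNat_val, ofNat_val]
  have hkept : ∀ i ≤ 2 * m - 2, NKept G m₀ (f i).val := by
    intro i hi
    rw [NKept, ← e2, ← e3, ← e4, ← e5, hadj, hadj]
    by_cases h0 : i = 0
    · subst h0; exact Or.inl rfl
    by_cases h1 : i = 2 * m - 2
    · subst h1; exact Or.inr (Or.inl rfl)
    · rw [hole.adj_iff (by omega) (by omega), hole.adj_iff (by omega) (by omega)]
      omega
  have hmem : ∀ y < n, NKept G m₀ y → Fin.ofNat n y ∈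
      Kept G (f 0) (f (2 * m)) (f (2 * m - 1)) (f (2 * m - 2)) := by
    rintro y hy (h1 | h1 | h1)
    · exact Or.inl (by rw [h1, ← e2, ofNat_val])
    · exact Or.inr (Or.inl (by rw [h1, ← e5, ofNat_val]))
    · refine Or.inr (Or.inr (Or.inr (Or.inr ?_)))
      rwa [NAdj, NAdj, ← e3, ← e4, ofNat_val, ofNat_val] at h1
  have hroot : Fin.ofNat n (m₀.reg 6) ∈
      Kept G (f 0) (f (2 * m)) (f (2 * m - 1)) (f (2 * m - 2)) := by
    rw [← e6, ofNat_val]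
    exact hf.mem _ (by omega)
  have l1 := h.label_le (fun t => (f (m - 1 - t)).val) (m - 1) (by omega) e6
    (fun i _ => (f _).2) (fun i hi => hkept _ (by omega))
    (fun i hi => by rw [hadj, hole.adj_iff (by omega) (by omega)]; omega)
  have l2 := h.label_le (fun t => (f (m - 1 + t)).val) (m - 1) (by omega) e6
    (fun i _ => (f _).2) (fun i hi => hkept _ (by omega))
    (fun i hi => by rw [hadj, hole.adj_iff (by omega) (by omega)]; omega)
  simp only [Nat.sub_self, show m - 1 + (m - 1) = 2 * m - 2 by omega, e2, e5] at l1 l2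
  have a2 : m₀.reg 2 < n := e2 ▸ (f 0).2
  have a5 : m₀.reg 5 < n := e5 ▸ (f _).2
  obtain ⟨rp, pe⟩ := h.route hroot hmem a2 l1.1
  obtain ⟨rq, qe⟩ := h.route hroot hmem a5 l2.1
  obtain ⟨hk, hl, hh⟩ := hG.swap_twice hf hm rp rq
    (by simp only [Function.iterate_zero, id]; rw [← e2, ofNat_val])
    (by rw [pe, ← e6, ofNat_val])
    (by simp only [Function.iterate_zero, id]; rw [← e5, ofNat_val])
    (by rw [qe, ← e6, ofNat_val]) (by omega) (by omega)
  have hD : D (m₀.reg 2) = m := by omega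
  refine ⟨by omega, by omega, ?_⟩
  rw [hD]
  have hc : HoleSeq G (2 * m + 1) (fun i => Fin.ofNat n (candidate m P m₀.reg i)) := by
    refine hh.congr fun i hi => ?_
    unfold candidate
    by_cases h1 : i + 1 < m
    · simp only [if_pos h1]
    by_cases h2 : i ≤ 2 * m - 2
    · simp only [if_neg h1, if_pos h2]
    by_cases h3 : i = 2 * m - 1
    · simp only [if_neg h1, if_neg h2, if_pos h3]
      rw [← e4, ofNat_val, h3]
    · simp only [if_neg h1, if_neg h2, if_neg h3]
      rw [← e3, ofNat_val, show i = 2 * m by omega]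
  intro i hi j hji
  refine ⟨fun he => hc.ne j i hji hi (by rw [he]), (hc.adj j i hji hi).trans ?_⟩
  exact or_congr_right (and_congr_right fun _ => by omega)

end Check
end OddHole

namespace OddHole

/-! ### Running through all guesses. -/

section Enumeration

variable {n : ℕ} {G : SimpleGraph (Fin n)} {W T : ℕ} {m₀ m : Memory}

/-- The memory between two choices of vertices: the output register holds a correct answer `1`, or
the answer `2`. -/
def Base (G : SimpleGraph (Fin n)) (m : Memory) : Prop :=
  Env G m m ∧ (m.reg 0 = 2 ∨ (m.reg 0 = 1 ∧ HasOddHole G))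

theorem Base.setReg (h : Base G m) {x : ℕ} (v : ℕ) (hx : 2 ≤ x) : Base G (m.setReg x v) := by
  refine ⟨⟨?_, h.1.adj, fun _ _ => rfl, h.1.label_le, h.1.parent_lt, h.1.list_lt⟩, ?_⟩
  · rw [Memory.reg_setReg, if_neg (by omega)]; exact h.1.size
  · rw [Memory.reg_setReg, if_neg (by omega)]; exact h.2

theorem Base.of_env (h : Base G m) {m' : Memory} (he : Env G m m') : Base G m' :=
  ⟨{ he with arg := fun _ _ => rfl }, by rw [he.arg 0 (by omega)]; exact h.2⟩

theorem IsGood.congr [NeZero n] {c c' : ℕ → ℕ} (h : IsGood G c)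
    (hc : ∀ x, 2 ≤ x → x ≤ 6 → c' x = c x) : IsGood G c' := by
  obtain ⟨m, f, h⟩ := h
  refine ⟨m, f, ?_⟩
  rwa [hc 2 (by omega) (by omega), hc 3 (by omega) (by omega), hc 4 (by omega) (by omega),
    hc 5 (by omega) (by omega), hc 6 (by omega) (by omega)]

/-- Each branch that leaves the output unchanged is incompatible with a good guess, by
`IsGood.pairOk`; the branch that writes `1` has verified a hole, by `hasOddHole_of_pairOk`. -/
theorem run_tryVertices [NeZero n] (hW : n * n + 2 * n + 10 ≤ W) (hB : Base G m)
    (harg : ∀ x, 2 ≤ x → x ≤ 6 → m.reg x < n) :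
    Run W tryVertices m ((n + 1) ^ 3 * 3000) (fun m' => Base G m' ∧
      (∀ x, 2 ≤ x → x ≤ 6 → m'.reg x = m.reg x) ∧ (m.reg 0 = 1 → m'.reg 0 = 1) ∧
      (IsGood G m.reg → m'.reg 0 = 1)) := by
  have hskip : ∀ m', Env G m m' → ¬ IsGood G m.reg → Base G m' ∧
      (∀ x, 2 ≤ x → x ≤ 6 → m'.reg x = m.reg x) ∧ (m.reg 0 = 1 → m'.reg 0 = 1) ∧
      (IsGood G m.reg → m'.reg 0 = 1) := fun m' hE hno =>
    ⟨hB.of_env hE, fun x _ hx => hE.arg x hx, fun h => (hE.arg 0 (by omega)).trans h,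
      fun h => absurd h hno⟩
  refine Run.mono (Run.seq ((run_search hW harg hB.1).mono le_rfl fun m₁ ⟨hE₁, hL⟩ =>
    Run.when ?_ (fun c1 => Run.when ?_ (fun c2 => Run.seq ((run_extract hW harg hE₁ rfl ?_).mono
      le_rfl fun m₂ ⟨hE₂, h12, hcand⟩ => Run.seq ((run_check hW hE₂ ?_ (hE₁.label_le _) h12).mono
      le_rfl fun m₃ ⟨hE₃, hl, h14, hok⟩ => Run.when ?_ (fun c3 => Run.assign ?_ ?_)
        fun c3 => hskip _ hE₃ fun hg => ?_)))
      fun c2 => hskip _ hE₁ fun hg => ?_) fun c1 => hskip _ hE₁ fun hg => ?_)) ?_ (fun _ h => h)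
  all_goals try
      have r2 := hE₁.arg 2 (by omega)
      have r5 := hE₁.arg 5 (by omega)
      have d2 := hE₁.label_le (m.reg 2)
      have d5 := hE₁.label_le (m.reg 5)
      have a2 := harg 2 (by omega) (by omega)
      have a5 := harg 5 (by omega) (by omega)
  · simp only [Expr.Fits, Expr.val, Op.apply, r2]
    split_ifs <;> omega
  · simp only [Expr.Fits, Expr.val, Op.apply, r2, r5]
    split_ifs <;> omega
  · simp only [Expr.val, Op.apply, r2] at c1
    by_contra hc
    exact c1 (if_neg (by omega))
  · simp only [Expr.val, Op.apply, r2] at c1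
    by_contra hc
    exact c1 (if_neg (by omega))
  · change m₃.reg 14 < W; omega
  · change 1 < W; omega
  · have h2M : 2 ≤ m₁.arr 1 (m.reg 2) := by
      simp only [Expr.val, Op.apply, r2] at c1
      by_contra hc
      exact c1 (if_neg (by omega))
    have hodd := hasOddHole_of_pairOk hE₂.list_lt h2M (hok.1 c3)
    refine ⟨⟨⟨?_, hE₃.adj, fun _ _ => rfl, hE₃.label_le, hE₃.parent_lt, hE₃.list_lt⟩,
      Or.inr ⟨by simp [Expr.val], hodd⟩⟩, fun x hx hx6 => ?_, fun _ => by simp [Expr.val],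
      fun _ => by simp [Expr.val]⟩
    · rw [Memory.reg_setReg, if_neg (by omega)]; exact hE₃.size
    · rw [Memory.reg_setReg, if_neg (by omega)]; exact hE₃.arg x hx6
  · refine hok.2 (fun i hi j hji => ?_) c3
    rw [PairOk, hcand i hi, hcand j (by omega)]
    exact (hg.pairOk hL).2.2 i hi j hji
  · have := (hg.pairOk hL).2.1
    simp only [Expr.val, Op.apply, r2, r5, if_pos this] at c2
    exact absurd c2 one_ne_zero
  · have := (hg.pairOk hL).1
    simp only [Expr.val, Op.apply, r2] at c1
    rw [if_pos (by omega)] at c1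
    exact absurd c1 one_ne_zero
  · have h1 : 1 ≤ n + 1 := by omega
    have e2 : (n + 3) ^ 2 ≤ 9 * (n + 1) ^ 2 := by nlinarith
    have e3 : (n + 1) ^ 2 ≤ (n + 1) ^ 3 := Nat.pow_le_pow_right h1 (by omega)
    have e4 : n + 1 ≤ (n + 1) ^ 3 := Nat.le_self_pow (by omega) _
    simp only [Expr.cost]
    omega

/-- `p` tests all choices of five vertices that start with those in the registers below `k`. -/
def Enumerates [NeZero n] (G : SimpleGraph (Fin n)) (W T k : ℕ) (p : Program) : Prop :=
  ∀ m, Base G m → (∀ x, 2 ≤ x → x < k → m.reg x < n) → Run W p m T (fun m' => Base G m' ∧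
    (∀ x, 2 ≤ x → x < k → m'.reg x = m.reg x) ∧ (m.reg 0 = 1 → m'.reg 0 = 1) ∧
    ∀ c : ℕ → ℕ, (∀ x, 2 ≤ x → x < k → c x = m.reg x) → (∀ x, 2 ≤ x → x ≤ 6 → c x < n) →
      IsGood G c → m'.reg 0 = 1)

/-- The invariant covers the good choices `c` with `c k < i`. It persists because an answer `1` is
never revoked. -/
theorem Enumerates.forLoop [NeZero n] {k : ℕ} {p : Program} (hW : n * n + 2 * n + 10 ≤ W) (hk : 2 ≤ k)
    (hk6 : k ≤ 6) (h : Enumerates G W T (k + 1) p) :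
    Enumerates G W ((n + 1) * (T + 9)) k (.forLoop k (.reg 1) p) := by
  intro m hB hlt
  refine Run.forLoop (N := n) (fun i m' => Base G m' ∧
    (∀ x, 2 ≤ x → x < k → m'.reg x = m.reg x) ∧ (m.reg 0 = 1 → m'.reg 0 = 1) ∧
    ∀ c : ℕ → ℕ, (∀ x, 2 ≤ x → x < k → c x = m.reg x) → (∀ x, 2 ≤ x → x ≤ 6 → c x < n) →
      c k < i → IsGood G c → m'.reg 0 = 1) (by omega) ?_
    ⟨hB, fun _ _ _ => rfl, id, fun c _ _ hc => absurd hc (by omega)⟩ ?_ ?_ ?_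
  · rintro i m' v ⟨h1, h2, h3, h4⟩
    refine ⟨h1.setReg v hk, fun x hx hxk => ?_, fun h => ?_, fun c hc hcn hck hg => ?_⟩
    · rw [Memory.reg_setReg, if_neg (by omega)]; exact h2 x hx hxk
    · rw [Memory.reg_setReg, if_neg (by omega)]; exact h3 h
    · rw [Memory.reg_setReg, if_neg (by omega)]; exact h4 c hc hcn hck hg
  · rintro i m' v hv ⟨h1, -⟩
    have e : (m'.setReg k v).reg 1 = n := (h1.setReg v hk).1.size
    exact ⟨by change (m'.setReg k v).reg 1 < W; rw [e]; omega, e⟩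
  · rintro i hi m' hki ⟨h1, h2, h3, h4⟩
    have hx' : ∀ x, 2 ≤ x → x < k + 1 → m'.reg x < n := fun x hx hxk => by
      rcases Nat.lt_succ_iff_lt_or_eq.1 hxk with hlt' | rfl
      · rw [h2 x hx hlt']; exact hlt x hx hlt'
      · rwa [hki]
    refine (h m' h1 hx').mono le_rfl fun m'' ⟨g1, g2, g3, g4⟩ =>
      ⟨(g2 k hk (by omega)).trans hki, g1,
        fun x hx hxk => (g2 x hx (by omega)).trans (h2 x hx hxk), fun h => g3 (h3 h),
        fun c hc hcn hck hg => ?_⟩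
    rcases Nat.lt_succ_iff_lt_or_eq.1 hck with hlt' | he
    · exact g3 (h4 c hc hcn hlt' hg)
    · refine g4 c (fun x hx hxk => ?_) hcn hg
      rcases Nat.lt_succ_iff_lt_or_eq.1 hxk with hlt' | rfl
      · rw [hc x hx hlt', h2 x hx hlt']
      · rw [he, hki]
  · rintro m' ⟨h1, h2, h3, h4⟩
    exact ⟨h1, h2, h3, fun c hc hcn hg => h4 c hc hcn (hcn k hk hk6) hg⟩

theorem enumerates_tryVertices [NeZero n] (hW : n * n + 2 * n + 10 ≤ W) :
    Enumerates G W ((n + 1) ^ 3 * 3000) 7 tryVertices := fun m hB hlt =>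
  (run_tryVertices hW hB fun x hx hx6 => hlt x hx (by omega)).mono le_rfl
    fun m' ⟨h1, h2, h3, h4⟩ => ⟨h1, fun x hx hx7 => h2 x hx (by omega), h3, fun c hc _ hg =>
      h4 (hg.congr fun x hx hx6 => (hc x hx (by omega)).symm)⟩

theorem run_algorithm [NeZero n] (hW : n * n + 2 * n + 10 ≤ W) (G : SimpleGraph (Fin n)) :
    Run W algorithm (inputMemory G) (3100 * (n + 1) ^ 8) (fun m' =>
      (m'.reg 0 = 2 ∨ (m'.reg 0 = 1 ∧ HasOddHole G)) ∧
      ∀ c : ℕ → ℕ, (∀ x, 2 ≤ x → x ≤ 6 → c x < n) → IsGood G c → m'.reg 0 = 1) := by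
  have hn := Nat.pos_of_neZero n
  have h := (((((enumerates_tryVertices (G := G) hW).forLoop hW (by omega) le_rfl).forLoop hW
    (by omega) (by omega)).forLoop hW (by omega) (by omega)).forLoop hW
    (by omega) (by omega)).forLoop hW (by omega) (by omega)
  have hr : (inputMemory G).reg 0 = n := rfl
  refine Run.mono (Run.seq (Run.assign ?_ (Run.seq (Run.assign ?_ ((h _ ?_ ?_).mono le_rfl
    fun m' h' => ⟨h'.1.2, fun c hcn hg => h'.2.2.2 c (fun x hx hx2 => by omega) hcn hg⟩)))))
    ?_ (fun _ h => h)
  · simp only [Expr.Fits, hr]; omega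
  · change 2 < W; omega
  · refine ⟨⟨?_, rfl, fun _ _ => rfl, fun i => ?_, fun i => ?_, fun i => ?_⟩, Or.inl ?_⟩
    · simp [Expr.val, hr]
    · simp [inputMemory]
    · simpa [inputMemory] using hn
    · simpa [inputMemory] using hn
    · simp [Expr.val]
  · intro x hx hx2; omega
  · have h1 : 1 ≤ n + 1 := by omega
    generalize n + 1 = N at *
    -- Five loops around a cubic body give `3000 * N ^ 8`; the overheads of the loops fit into the
    -- remaining `100 * N ^ 8`.
    have e : N * (N * (N * (N * (N * (N ^ 3 * 3000 + 9) + 9) + 9) + 9) + 9) =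
      3000 * N ^ 8 + 9 * N ^ 5 + 9 * N ^ 4 + 9 * N ^ 3 + 9 * N ^ 2 + 9 * N := by ring
    have e5 : N ^ 5 ≤ N ^ 8 := Nat.pow_le_pow_right h1 (by omega)
    have e4 : N ^ 4 ≤ N ^ 8 := Nat.pow_le_pow_right h1 (by omega)
    have e3 : N ^ 3 ≤ N ^ 8 := Nat.pow_le_pow_right h1 (by omega)
    have e2 : N ^ 2 ≤ N ^ 8 := Nat.pow_le_pow_right h1 (by omega)
    have e1 : N ≤ N ^ 8 := Nat.le_self_pow (by omega) N
    have e0 : 1 ≤ N ^ 8 := Nat.one_le_pow _ _ h1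
    rw [e]
    simp only [Expr.cost]
    omega

end Enumeration

/-- The empty graph is treated apart because `Fin.ofNat` needs a nonzero `n`; here the outermost
loop has no iterations. -/
theorem run_algorithm_of_empty {W : ℕ} (hW : 10 ≤ W) (G : SimpleGraph (Fin 0)) :
    Run W algorithm (inputMemory G) 3100 (fun m' => m'.reg 0 = 2) := by
  refine Run.mono (Run.seq (Run.assign ?_ (Run.seq (Run.assign ?_ (Run.forLoop (N := 0) (T := 0)
    (fun _ m => m.reg 0 = 2 ∧ m.reg 1 = 0) (by omega) ?_ ?_ ?_ ?_ ?_))))) ?_ (fun _ h => h)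
  · change 0 < W; omega
  · change 2 < W; omega
  · intro i m v h; simpa using h
  · simp [Expr.val, inputMemory]
  · intro i m v hv h
    simp only [Expr.Fits, Expr.val, Memory.reg_setReg]
    simp [h.2]
    omega
  · intro i hi; omega
  · exact fun m h => h.1
  · simp [Expr.cost]

end OddHole

theorem mainTheorem6 :
    ∃ (A : OddHole.Program) (k c : ℕ), ∀ (n : ℕ) (G : SimpleGraph (Fin n)),
      ¬ OddHole.HasPyramid G → ¬ OddHole.HasJewel G →
        ∃ (m : OddHole.Memory) (t : ℕ),
          OddHole.Exec ((n + 2) ^ k) A (OddHole.inputMemory G) m t ∧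
          t ≤ c * (n + 1) ^ 8 ∧
          ((m.reg 0 = 1 ∧ OddHole.HasOddHole G) ∨
            (m.reg 0 = 2 ∧ ¬ ∃ C : Set (Fin n),
              OddHole.IsShortestOddHole G C ∧ OddHole.IsHeavyCleanable G C)) := by
  -- The exponent `4` makes words large enough for matrix indices below `n * n` and positions of
  -- about `2 * n`, and already gives `16 ≥ 10` for `n = 0`.
  refine ⟨OddHole.algorithm, 4, 3100, fun n G hP hJ => ?_⟩
  rcases Nat.eq_zero_or_pos n with rfl | hn
  · obtain ⟨m, t, h1, h2, h3⟩ := OddHole.run_algorithm_of_empty (W := 2 ^ 4) (by norm_num) G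
    refine ⟨m, t, h1, by simpa using h2, Or.inr ⟨h3, ?_⟩⟩
    rintro ⟨C, hC, -⟩
    have := hC.1.1.1
    simp [Set.eq_empty_of_isEmpty C] at this
  · have : NeZero n := ⟨by omega⟩
    have hW : n * n + 2 * n + 10 ≤ (n + 2) ^ 4 := by nlinarith [Nat.zero_le (n ^ 4), Nat.zero_le (n ^ 3)]
    obtain ⟨m, t, h1, h2, h3, h4⟩ := OddHole.run_algorithm hW G
    refine ⟨m, t, h1, h2, ?_⟩
    rcases h3 with h3 | h3
    · refine Or.inr ⟨h3, ?_⟩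
      rintro ⟨C, hC, hH⟩
      obtain ⟨k, f, hk, hG, hf⟩ := hH.exists_clean hP hJ hC
      have := h4 (fun x => if x = 2 then (f 0).val else if x = 3 then (f (2 * k)).val else
        if x = 4 then (f (2 * k - 1)).val else if x = 5 then (f (2 * k - 2)).val else
          (f (k - 1)).val) (fun x _ _ => by split_ifs <;> exact Fin.isLt _)
        ⟨k, f, hk, hG, hf, by simp, by simp, by simp, by simp, by simp⟩
      omega
    · exact Or.inl h3
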